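/- \textbf{Conventions.} Let $R$ be a commutative $\mathbb{Q}$-algebra. Graded modules are $\mathbb{Z}$-graded $R$-modules, with cohomological degrees. A commutative dg algebra $(A,d,\mu)$ is a $\mathbb{Z}$-graded, associative, graded commutative $R$-algebra (a unit is not required) with a differential $d$ of degree $+1$ satisfying the Leibniz rule; $H(A)=\ker d/\operatorname{im} d$, and $\mu^*$ is the induced product on $H(A)$. An $A_\infty$-algebra $(M,\{m_n\}_{n\ge1})$ is a graded module with maps $m_n:M^{\otimes n}\to M$ of degree $2-n$ such that for all $n\ge 1$ $$\sum_{r+s+t=n,\ s\ge1}(-1)^{r+st}\,m_{r+1+t}(1^{\otimes r}\otimes m_s\otimes 1^{\otimes t})=0 .$$ A morphism $\{f_n\}_{n\ge1}:(M,\{m_n\})\to(M',\{m'_n\})$ consists of maps $f_n:M^{\otimes n}\to M'$ of degree $1-n$ such that for all $n\ge1$ $$\sum_{r+s+t=n,\ s\ge1}(-1)^{r+st}f_{r+1+t}(1^{\otimes r}\otimes m_s\otimes1^{\otimes t})=\sum_{k_1+\dots+k_q=n}(-1)^{\sum_i (q-i)(k_i-1)}\,m'_q(f_{k_1}\otimes\dots\otimes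 f_{k_q}),$$ and composition of morphisms is given by $(g\circ f)_n=\sum_{k_1+\dots+k_q=n}(-1)^{\sum_i (q-i)(k_i-1)}g_q(f_{k_1}\otimes\dots\otimes f_{k_q})$ (Koszul signs appear on evaluation). An $A_\infty$-algebra (respectively, a morphism) is $C_\infty$ if all its components vanish on shuffles: for $0<k<n$ and homogeneous $a_1,\dots,a_n$, $$\sum_\sigma \varepsilon(\sigma)\,m_n(a_{\sigma(1)}\otimes\dots\otimes a_{\sigma(n)})=0$$ (respectively the same with $f_n$), where $\sigma$ runs over the permutations for which $1,\dots,k$ and $k+1,\dots,n$ each occur in increasing order in the sequence $\sigma(1),\dots,\sigma(n)$, and $\varepsilon(\sigma)$ is the signature of $\sigma$ times its Koszul sign. A morphism of $C_\infty$-algebras is an isomorphism if it has a two-sided inverse $C_\infty$-morphism. A weak equivalence is a morphism whose first component $f_1:(M,m_1)\to(M',m_1')$ induces an isomorphism on homology. For a commutative dg algebra $A$, a \emph{minimal $C_\infty$-model on $H(A)$} is a $C_\infty$-algebra structure $\{m_n\}$ on $H(A)$ with $m_1=0$ and $m_2=\mu^*$, together with a weak equivalence of $C_\infty$-algebras $$\{f_n\}:(H(A),\{m_n\})\to(A,\{d,\mu,0,0,\dots\})$$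 such that $f_1^*=\mathrm{id}_{H(A)}$, that is, $f_1(h)$ is a cocycle of class $h$ for every $h\in H(A)$. \textbf{Theorem ($C_\infty$ minimality theorem).} Let $A$ be a commutative dg algebra over $R$ such that all cohomology modules $H^i(A)$ are free. (a) There exists a minimal $C_\infty$-model on $H(A)$. Moreover, if $d(A)$ is a projective $R$-module (for instance, if $R$ is a field), then for every minimal $C_\infty$-model the map of bar constructions induced by $\{f_n\}$ is also a homology isomorphism. (b) Let $A'$ be another commutative dg algebra over $R$ such that all $H^i(A')$ are free, let $g:A\to A'$ be a map of commutative dg algebras, and let minimal $C_\infty$-models with operations $\{m_n\}$ on $H(A)$ and $\{m'_n\}$ on $H(A')$ be given. Then there is a morphism of $C_\infty$-algebras $\{g_n\}:(H(A),\{m_n\})\to(H(A'),\{m'_n\})$ with $g_1=g^*$. (c) The structure is unique up to isomorphism: if $\{m_n\}$ and $\{m'_n\}$ are the operations of two minimal $C_\infty$-models on $H(A)$, then there is an isomorphism of $C_\infty$-algebras $\{g_n\}:(H(A),\{m_n\})\to(H(A),\{m'_n\})$ with $g_1=\mathrm{id}$. -/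

import Mathlib

open scoped TensorProduct DirectSum

universe u v w

noncomputable section

namespace CInf

/-! ### Families of multilinear maps on graded modules

A graded module is an `R`-module `M` with an internal direct sum decomposition
`M = ⨁ i, gr i` indexed by `ℤ`.  Degrees are cohomological. -/

/-- A family `f_n : M^{⊗ n} → M'`; members of arity `0` are required to vanish below. -/
abbrev MultiFamily (R : Type u) (M : Type v) (M' : Type w) [CommRing R]
    [AddCommGroup M] [Module R M] [AddCommGroup M'] [Module R M'] : Type _ :=
  ∀ n : ℕ, MultilinearMap R (fun _ : Fin n => M) M'

section Families

variable {R : Type u} {M : Type v} {M' : Type w} [CommRing R]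
  [AddCommGroup M] [Module R M] [AddCommGroup M'] [Module R M']

/-- The family `(φ, 0, 0, …)` concentrated in arity one. -/
def linearFamily (φ : M →ₗ[R] M') : MultiFamily R M M'
  | 1 => MultilinearMap.ofSubsingleton R M M' (0 : Fin 1) φ
  | _ => 0

/-- The first component `f_1` of a family, as a linear map. -/
def firstComponent (f : MultiFamily R M M') : M →ₗ[R] M' :=
  (MultilinearMap.ofSubsingleton R M M' (0 : Fin 1)).symm (f 1)

/-- `f_n` has degree `c - n` for every `n`. -/
def HasShift (gr : ℤ → Submodule R M) (gr' : ℤ → Submodule R M') (c : ℤ)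
    (f : MultiFamily R M M') : Prop :=
  ∀ (n : ℕ) (p : Fin n → ℤ) (a : Fin n → M), (∀ i, a i ∈ gr (p i)) →
    f n a ∈ gr' ((∑ i, p i) + c - n)

/-- The sequence `a_0, …, a_{r-1}, m_s(a_r, …, a_{r+s-1}), a_{r+s}, a_{r+s+1}, …`. -/
def insertOp (m : MultiFamily R M M) (r s : ℕ) (a : ℕ → M) : ℕ → M := fun i =>
  if i < r then a i
  else if i = r then m s (fun j => a (r + j))
  else a (i + s - 1)

/-- `∑_{r+s+t=n} (-1)^{r+st} f_{r+1+t}(1^{⊗ r} ⊗ m_s ⊗ 1^{⊗ t})` evaluated on homogeneous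
`a_0, …, a_{n-1}` of degrees `p_0, …, p_{n-1}`, including the Koszul sign that comes from
moving `m_s` (of degree `2 - s`) past `a_0, …, a_{r-1}`. -/
def innerSum (f : MultiFamily R M M') (m : MultiFamily R M M) (n : ℕ)
    (p : ℕ → ℤ) (a : ℕ → M) : M' :=
  ∑ r ∈ Finset.range n, ∑ s ∈ Finset.Icc 1 (n - r),
    Int.negOnePow ((r : ℤ) + s * ((n : ℤ) - r - s)
      + (2 - (s : ℤ)) * ∑ j ∈ Finset.range r, p j) •
      f (n - s + 1) (fun i => insertOp m r s a i)

/-- The sign of the term of `outerSum` that belongs to the composition `n = k_1 + … + k_t`: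
the exponent is `∑_i (t - i)(k_i - 1)` plus the Koszul contribution
`∑_i (1 - k_i)(p_0 + … + p_{k_1 + … + k_{i-1} - 1})` of moving `f_{k_i}` (of degree `1 - k_i`)
past the arguments on its left. -/
def outerSign {n : ℕ} (c : Composition n) (p : ℕ → ℤ) : ℤˣ :=
  Int.negOnePow (∑ i : Fin c.length,
    (((c.length : ℤ) - 1 - (i : ℕ)) * ((c.blocksFun i : ℤ) - 1)
      + (1 - (c.blocksFun i : ℤ)) * ∑ j ∈ Finset.range (c.sizeUpTo i), p j))

/-- `∑_{k_1+…+k_t=n} ± g_t(f_{k_1} ⊗ … ⊗ f_{k_t})` evaluated on homogeneous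
`a_0, …, a_{n-1}` of degrees `p_0, …, p_{n-1}`. -/
def outerSum {M'' : Type*} [AddCommGroup M''] [Module R M'']
    (g : MultiFamily R M' M'') (f : MultiFamily R M M') (n : ℕ)
    (p : ℕ → ℤ) (a : ℕ → M) : M'' :=
  ∑ c : Composition n, outerSign c p •
    g c.length (fun i => f (c.blocksFun i) (fun j => a (c.sizeUpTo i + j)))

/-- `(M, {m_n}_{n ≥ 1})` is an `A_∞`-algebra: `deg m_n = 2 - n` and the Stasheff identities
hold. -/
structure IsAInfAlgebra (gr : ℤ → Submodule R M) (m : MultiFamily R M M) : Prop where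
  zero : m 0 = 0
  degree : HasShift gr gr 2 m
  stasheff : ∀ n : ℕ, 1 ≤ n → ∀ (p : ℕ → ℤ) (a : ℕ → M), (∀ i, a i ∈ gr (p i)) →
    innerSum m m n p a = 0

/-- `{f_n}_{n ≥ 1} : (M, {m_n}) → (M', {m'_n})` is a morphism of `A_∞`-algebras:
`deg f_n = 1 - n` and `∑ ± f(1 ⊗ m ⊗ 1) = ∑ ± m'(f ⊗ … ⊗ f)`. -/
structure IsAInfMorphism (gr : ℤ → Submodule R M) (gr' : ℤ → Submodule R M')
    (m : MultiFamily R M M) (m' : MultiFamily R M' M') (f : MultiFamily R M M') : Prop where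
  zero : f 0 = 0
  degree : HasShift gr gr' 1 f
  relation : ∀ n : ℕ, 1 ≤ n → ∀ (p : ℕ → ℤ) (a : ℕ → M), (∀ i, a i ∈ gr (p i)) →
    innerSum f m n p a = outerSum m' f n p a

/-- `h` is the composite `g ∘ f` of morphisms of `A_∞`-algebras. (The values on homogeneous
arguments determine `h_n`.) -/
def IsComposite {M'' : Type*} [AddCommGroup M''] [Module R M''] (gr : ℤ → Submodule R M)
    (g : MultiFamily R M' M'') (f : MultiFamily R M M') (h : MultiFamily R M M'') : Prop :=
  ∀ n : ℕ, 1 ≤ n → ∀ (p : ℕ → ℤ) (a : ℕ → M), (∀ i, a i ∈ gr (p i)) →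
    h n (fun i => a i) = outerSum g f n p a

/-! ### Shuffles -/

/-- `a_{σ(0)} ⊗ … ⊗ a_{σ(n-1)}` is a term of the shuffle product of `a_0 ⊗ … ⊗ a_{k-1}` and
`a_k ⊗ … ⊗ a_{n-1}`: each of the two groups of letters occurs in its original order. -/
def IsShuffle {n : ℕ} (k : ℕ) (σ : Equiv.Perm (Fin n)) : Prop :=
  ∀ i j : Fin n, σ i < σ j → (((σ j : Fin n) : ℕ) < k ∨ k ≤ ((σ i : Fin n) : ℕ)) → i < j

/-- The sign of the term `a_{σ(0)} ⊗ … ⊗ a_{σ(n-1)}`, for `deg a_i = p_i`: every transposed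
pair `a, a'` contributes `-(-1)^{deg a · deg a'}`. This is the signature of `σ` times its Koszul
sign; equivalently, the Koszul sign in the shuffle algebra of the desuspension, transported to
operations on `M` by the desuspension isomorphism. -/
def shuffleSign {n : ℕ} (p : Fin n → ℤ) (σ : Equiv.Perm (Fin n)) : ℤˣ :=
  ∏ i : Fin n, ∏ j : Fin n,
    if i < j ∧ σ j < σ i then Int.negOnePow (1 + p (σ i) * p (σ j)) else 1

open Classical in
/-- Every component of the family vanishes on shuffles. -/
def VanishesOnShuffles (gr : ℤ → Submodule R M) (f : MultiFamily R M M') : Prop :=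
  ∀ (n k : ℕ), 0 < k → k < n → ∀ (p : Fin n → ℤ) (a : Fin n → M), (∀ i, a i ∈ gr (p i)) →
    ∑ σ : Equiv.Perm (Fin n) with IsShuffle k σ, shuffleSign p σ • f n (fun i => a (σ i)) = 0

/-- A `C_∞`-algebra: an `A_∞`-algebra whose operations vanish on shuffles. -/
structure IsCInfAlgebra (gr : ℤ → Submodule R M) (m : MultiFamily R M M) : Prop
    extends IsAInfAlgebra gr m where
  shuffle : VanishesOnShuffles gr m

/-- A morphism of `C_∞`-algebras: a morphism of `A_∞`-algebras whose components vanish on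
shuffles. -/
structure IsCInfMorphism (gr : ℤ → Submodule R M) (gr' : ℤ → Submodule R M')
    (m : MultiFamily R M M) (m' : MultiFamily R M' M') (f : MultiFamily R M M') : Prop
    extends IsAInfMorphism gr gr' m m' f where
  shuffle : VanishesOnShuffles gr f

/-- `g` is an isomorphism `(M, m) → (M', m')` in the category of `C_∞`-algebras. -/
def IsCInfIso (gr : ℤ → Submodule R M) (gr' : ℤ → Submodule R M')
    (m : MultiFamily R M M) (m' : MultiFamily R M' M') (g : MultiFamily R M M') : Prop :=
  IsCInfMorphism gr gr' m m' g ∧ ∃ h : MultiFamily R M' M, IsCInfMorphism gr' gr m' m h ∧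
    IsComposite gr h g (linearFamily LinearMap.id) ∧
    IsComposite gr' g h (linearFamily LinearMap.id)

/-- `F : (M, d) → (M', d')` is a chain map that induces a bijection
`ker d / im d → ker d' / im d'`. -/
structure IsQuasiIso (d : M →ₗ[R] M) (d' : M' →ₗ[R] M') (F : M →ₗ[R] M') : Prop where
  comm : ∀ x, F (d x) = d' (F x)
  injective : ∀ x, d x = 0 → (∃ y', F x = d' y') → ∃ y, x = d y
  surjective : ∀ z, d' z = 0 → ∃ x y', d x = 0 ∧ z = F x + d' y'

/-! ### The bar construction -/

/-- The linear map `a ↦ (-1)^{deg a} a`. -/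
def signMap (gr : ℤ → Submodule R M) [DirectSum.Decomposition gr] : M →ₗ[R] M :=
  DirectSum.toModule R ℤ M (fun i => ((Int.negOnePow i : ℤˣ) : ℤ) • (gr i).subtype) ∘ₗ
    (DirectSum.decomposeLinearEquiv gr).toLinearMap

/-- The component of arity `k` of the family on (de)suspensions that corresponds to `f`:
`(a_0, …, a_{k-1}) ↦ (-1)^{∑_i (k-1-i) deg a_i} f_k(a_0, …, a_{k-1})`. -/
def suspended (gr : ℤ → Submodule R M) [DirectSum.Decomposition gr] (f : MultiFamily R M M') :
    MultiFamily R M M' := fun k =>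
  (f k).compLinearMap (fun i : Fin k => (signMap gr) ^ (k - 1 - (i : ℕ)))

/-- The underlying module of the bar construction: the tensor coalgebra on the desuspension of
`M`. The desuspension only shifts degrees, hence affects signs and not the module. -/
abbrev Bar (R : Type u) (M : Type v) [CommRing R] [AddCommGroup M] [Module R M] : Type _ :=
  ⨁ n : ℕ, ⨂[R]^n M

/-- For a composition `n = k_1 + … + k_t`, the map
`g_1 ⊗ … ⊗ g_t : M^{⊗ n} → M'^{⊗ t}`, where `g_i` has arity `k_i`. -/
def tensorAlong {n : ℕ} (c : Composition n)
    (g : ∀ i : Fin c.length, MultilinearMap R (fun _ : Fin (c.blocksFun i) => M) M') :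
    (⨂[R]^n M) →ₗ[R] Bar R M' :=
  DirectSum.lof R ℕ (fun t => ⨂[R]^t M') c.length ∘ₗ
    PiTensorProduct.lift
      (((PiTensorProduct.tprod R (s := fun _ : Fin c.length => M')).compMultilinearMap
        g).domDomCongr c.blocksFinEquiv)

/-- The differential of the bar construction, the coderivation
`∑ 1 ⊗ … ⊗ 1 ⊗ b_s ⊗ 1 ⊗ … ⊗ 1` of degree one, where `b_s` is the suspended `m_s`. Moving `b_s`
past a desuspended `a` gives the sign `(-1)^{deg a - 1}`. -/
def barDifferential (gr : ℤ → Submodule R M) [DirectSum.Decomposition gr]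
    (m : MultiFamily R M M) : Bar R M →ₗ[R] Bar R M :=
  DirectSum.toModule R ℕ (Bar R M) fun n =>
    ∑ c : Composition n, ∑ i : Fin c.length, tensorAlong c fun j =>
      if j < i then linearFamily (-signMap gr) (c.blocksFun j)
      else if j = i then suspended gr m (c.blocksFun j)
      else linearFamily LinearMap.id (c.blocksFun j)

/-- The map of bar constructions induced by a family `f`. -/
def barMap (gr : ℤ → Submodule R M) [DirectSum.Decomposition gr]
    (f : MultiFamily R M M') : Bar R M →ₗ[R] Bar R M' :=
  DirectSum.toModule R ℕ (Bar R M') fun n =>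
    ∑ c : Composition n, tensorAlong c fun j => suspended gr f (c.blocksFun j)

/-- The induced map of bar constructions is a homology isomorphism. -/
def IsBarQuasiIso (gr : ℤ → Submodule R M) (gr' : ℤ → Submodule R M')
    [DirectSum.Decomposition gr] [DirectSum.Decomposition gr']
    (m : MultiFamily R M M) (m' : MultiFamily R M' M') (f : MultiFamily R M M') : Prop :=
  IsQuasiIso (barDifferential gr m) (barDifferential gr' m') (barMap gr f)

end Families

/-! ### Commutative dg algebras and their cohomology -/

/-- A `ℤ`-graded (graded) commutative dg algebra over `R`, with differential of degree `1`.
A unit is not required. -/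
structure CDGAlg (R : Type u) [CommRing R] where
  carrier : Type v
  [addCommGroup : AddCommGroup carrier]
  [module : Module R carrier]
  gr : ℤ → Submodule R carrier
  [decomposition : DirectSum.Decomposition gr]
  d : carrier →ₗ[R] carrier
  mul : carrier →ₗ[R] carrier →ₗ[R] carrier
  d_mem : ∀ {p : ℤ} {a : carrier}, a ∈ gr p → d a ∈ gr (p + 1)
  d_d : ∀ a, d (d a) = 0
  mul_mem : ∀ {p q : ℤ} {a b : carrier}, a ∈ gr p → b ∈ gr q → mul a b ∈ gr (p + q)
  mul_assoc : ∀ a b c, mul (mul a b) c = mul a (mul b c)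
  mul_comm : ∀ {p q : ℤ} {a b : carrier}, a ∈ gr p → b ∈ gr q →
    mul a b = Int.negOnePow (p * q) • mul b a
  leibniz : ∀ {p : ℤ} {a : carrier}, a ∈ gr p → ∀ b,
    d (mul a b) = mul (d a) b + Int.negOnePow p • mul a (d b)

attribute [instance] CDGAlg.addCommGroup CDGAlg.module CDGAlg.decomposition

namespace CDGAlg

variable {R : Type u} [CommRing R]

/-- The operations `{d, μ, 0, 0, …}` of a dg algebra. -/
def ops (A : CDGAlg.{u, v} R) : MultiFamily R A.carrier A.carrier
  | 1 => MultilinearMap.ofSubsingleton R A.carrier A.carrier (0 : Fin 1) A.d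
  | 2 => MultilinearMap.mk' (fun a : Fin 2 → A.carrier => A.mul (a 0) (a 1))
      (fun a i x y => by fin_cases i <;> simp [Function.update])
      (fun a i c x => by fin_cases i <;> simp [Function.update])
  | _ => 0

/-- The cocycles. -/
abbrev cocycles (A : CDGAlg.{u, v} R) : Submodule R A.carrier := LinearMap.ker A.d

/-- `H(A) = ker d / im d`. -/
abbrev Cohomology (A : CDGAlg.{u, v} R) : Type v :=
  A.cocycles ⧸ (LinearMap.range A.d).comap A.cocycles.subtype

/-- The cohomology class of a cocycle. -/
abbrev cls (A : CDGAlg.{u, v} R) : A.cocycles →ₗ[R] A.Cohomology :=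
  Submodule.mkQ _

/-- `H^i(A)`, as the submodule of `H(A)` of classes of cocycles of degree `i`. -/
def cohomologyGr (A : CDGAlg.{u, v} R) (i : ℤ) : Submodule R A.Cohomology :=
  ((A.gr i).comap A.cocycles.subtype).map A.cls

/-- The projection of `A` onto its component of degree `i`. -/
def proj (A : CDGAlg.{u, v} R) (i : ℤ) : A.carrier →ₗ[R] A.carrier :=
  (A.gr i).subtype ∘ₗ DirectSum.component R ℤ (fun i => A.gr i) i ∘ₗ
    (DirectSum.decomposeLinearEquiv A.gr).toLinearMap

lemma proj_apply (A : CDGAlg.{u, v} R) (i : ℤ) (x : A.carrier) :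
    A.proj i x = (DirectSum.decompose A.gr x i : A.carrier) := rfl

lemma d_proj (A : CDGAlg.{u, v} R) (i : ℤ) (x : A.carrier) :
    A.d (A.proj i x) = A.proj (i + 1) (A.d x) := by
  induction x using DirectSum.Decomposition.inductionOn A.gr with
  | zero => simp
  | @homogeneous j m =>
    by_cases h : j = i
    · subst h
      rw [proj_apply, proj_apply, DirectSum.decompose_of_mem_same _ m.2,
        DirectSum.decompose_of_mem_same _ (A.d_mem m.2)]
    · rw [proj_apply, proj_apply, DirectSum.decompose_of_mem_ne _ m.2 h,
        DirectSum.decompose_of_mem_ne _ (A.d_mem m.2) (by omega), map_zero]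
  | add x y hx hy => simp [hx, hy]

lemma proj_mem_cocycles (A : CDGAlg.{u, v} R) (i : ℤ) {x : A.carrier} (hx : x ∈ A.cocycles) :
    A.proj i x ∈ A.cocycles := by
  rw [LinearMap.mem_ker] at hx ⊢
  rw [d_proj, hx, map_zero]

/-- The projection of `H(A)` onto its component of degree `i`. -/
def cohomologyProj (A : CDGAlg.{u, v} R) (i : ℤ) : A.Cohomology →ₗ[R] A.Cohomology :=
  Submodule.mapQ _ _ ((A.proj i).restrict fun _ hx => A.proj_mem_cocycles i hx) (by
    rintro ⟨x, hx⟩ ⟨y, rfl⟩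
    refine ⟨A.proj (i - 1) y, ?_⟩
    rw [d_proj, sub_add_cancel]
    rfl)

lemma cohomologyProj_same (A : CDGAlg.{u, v} R) {i : ℤ} {h : A.Cohomology}
    (hh : h ∈ A.cohomologyGr i) : A.cohomologyProj i h = h := by
  obtain ⟨z, hz, rfl⟩ := hh
  change A.cls _ = A.cls _
  congr 1
  exact Subtype.ext (DirectSum.decompose_of_mem_same A.gr (x := (z : A.carrier)) hz)

lemma cohomologyProj_ne (A : CDGAlg.{u, v} R) {i j : ℤ} (hij : j ≠ i) {h : A.Cohomology}
    (hh : h ∈ A.cohomologyGr j) : A.cohomologyProj i h = 0 := by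
  obtain ⟨z, hz, rfl⟩ := hh
  change A.cls _ = 0
  rw [← map_zero A.cls]
  congr 1
  exact Subtype.ext (DirectSum.decompose_of_mem_ne A.gr (x := (z : A.carrier)) hz hij)

lemma cohomology_isInternal (A : CDGAlg.{u, v} R) : DirectSum.IsInternal A.cohomologyGr := by
  constructor
  · have key : ∀ (i : ℤ) (x : ⨁ i, A.cohomologyGr i),
        A.cohomologyProj i (DirectSum.coeAddMonoidHom A.cohomologyGr x) = x i := by
      intro i x
      induction x using DirectSum.induction_on with
      | zero => simp
      | of j y =>
        rw [DirectSum.coeAddMonoidHom_of]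
        by_cases h : j = i
        · subst h
          rw [DirectSum.of_eq_same, A.cohomologyProj_same y.2]
        · rw [DirectSum.of_eq_of_ne _ _ _ (Ne.symm h), A.cohomologyProj_ne h y.2]
          rfl
      | add x y hx hy => simp [hx, hy]
    intro x y hxy
    refine DFinsupp.ext fun i => Subtype.ext ?_
    rw [← key i x, ← key i y, hxy]
  · intro h
    obtain ⟨z, rfl⟩ := Submodule.mkQ_surjective _ h
    classical
    refine ⟨∑ i ∈ (DirectSum.decompose A.gr (z : A.carrier)).support,
      DirectSum.of (fun i => A.cohomologyGr i) i
        ⟨A.cls ⟨A.proj i z, A.proj_mem_cocycles i z.2⟩, ⟨_, ?_, rfl⟩⟩, ?_⟩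
    · exact (DirectSum.decompose A.gr (z : A.carrier) i).2
    · rw [map_sum]
      simp only [DirectSum.coeAddMonoidHom_of]
      rw [← map_sum]
      congr 1
      refine Subtype.ext ?_
      rw [AddSubmonoidClass.coe_finsetSum]
      exact DirectSum.sum_support_decompose A.gr (z : A.carrier)

instance (A : CDGAlg.{u, v} R) : DirectSum.Decomposition A.cohomologyGr :=
  A.cohomology_isInternal.chooseDecomposition

lemma mul_mem_cocycles (A : CDGAlg.{u, v} R) (x y : A.cocycles) :
    A.mul x y ∈ A.cocycles := by
  classical
  have hy : A.d y = 0 := y.2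
  rw [LinearMap.mem_ker, ← DirectSum.sum_support_decompose A.gr (x : A.carrier), map_sum,
    LinearMap.sum_apply, map_sum]
  refine Finset.sum_eq_zero fun i _ => ?_
  have hx : A.d (DirectSum.decompose A.gr (x : A.carrier) i) = 0 :=
    A.proj_mem_cocycles i x.2
  rw [A.leibniz (DirectSum.decompose A.gr (x : A.carrier) i).2, hx, hy]
  simp

/-- `φ : H(A) → A` satisfies `φ^* = id`: each `φ(h)` is a cocycle in the class `h`. -/
def ChoosesCocycles (A : CDGAlg.{u, v} R) (φ : A.Cohomology →ₗ[R] A.carrier) : Prop :=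
  ∀ h : A.Cohomology, ∃ hz : φ h ∈ A.cocycles, A.cls ⟨φ h, hz⟩ = h

/-- `({m_i}, {f_i})` is a minimal `C_∞`-algebra structure on `H(A)` with `m_1 = 0` and
`m_2 = μ^*`, together with a weak equivalence of `C_∞`-algebras
`(H(A), {m_i}) → (A, {d, μ, 0, …})` with `f_1^* = id`. -/
structure IsMinimalModel (A : CDGAlg.{u, v} R) (m : MultiFamily R A.Cohomology A.Cohomology)
    (f : MultiFamily R A.Cohomology A.carrier) : Prop where
  algebra : IsCInfAlgebra A.cohomologyGr m
  minimal : m 1 = 0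
  product : ∀ x y : A.cocycles,
    m 2 ![A.cls x, A.cls y] = A.cls ⟨A.mul x y, A.mul_mem_cocycles x y⟩
  morphism : IsCInfMorphism A.cohomologyGr A.gr m A.ops f
  weakEquiv : IsQuasiIso (firstComponent m) A.d (firstComponent f)
  first : A.ChoosesCocycles (firstComponent f)

/-- A map of commutative dg algebras. -/
structure Hom (A : CDGAlg.{u, v} R) (A' : CDGAlg.{u, w} R) where
  toFun : A.carrier →ₗ[R] A'.carrier
  map_mem : ∀ {p : ℤ} {a : A.carrier}, a ∈ A.gr p → toFun a ∈ A'.gr p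
  map_d : ∀ a, toFun (A.d a) = A'.d (toFun a)
  map_mul : ∀ a b, toFun (A.mul a b) = A'.mul (toFun a) (toFun b)

/-- The map `g^* : H(A) → H(A')` induced by a map of commutative dg algebras. -/
def Hom.cohomologyMap {A : CDGAlg.{u, v} R} {A' : CDGAlg.{u, w} R} (g : Hom A A') :
    A.Cohomology →ₗ[R] A'.Cohomology :=
  Submodule.mapQ _ _ (g.toFun.restrict (p := A.cocycles) (q := A'.cocycles) fun x hx => by
      rw [LinearMap.mem_ker] at hx ⊢
      rw [← g.map_d, hx, map_zero]) (by
    rintro ⟨x, hx⟩ ⟨y, rfl⟩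
    exact ⟨g.toFun y, (g.map_d y).symm⟩)

end CDGAlg

end CInf

end

/-! Everything is moved to the tensor coalgebra on the desuspension `V` of `H(A)`. Since the
`H^i(A)` are free, `V` has a homogeneous basis, and linear maps out of the tensor algebra are
defined by their values on words. A family of operations becomes one linear map `b` to `V`. The
Stasheff identities say that `b ∘ D = 0` for the coderivation `D` with corestriction `b`. Morphisms
become coalgebra maps that intertwine the coderivations, and morphisms into `A` become twisting
cochains `τ`, that is, solutions of `dτ = τ ∘ D + τ ∪ τ` up to Koszul signs. The `C_∞` condition
says that the map kills proper shuffle products. `hat` and `unhat` are this dictionary; its signs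
are verified in `hat_coder_tens`, `hat_comap_tens`, `smul_outerSum_ops` and `shuffleSum_eq`.

Existence is obstruction theory in the length of words. Suppose that `(b, τ)` solves the twisting
equation on words of length at most `n`. On words of length `n + 1` the defect is a cocycle by a
Bianchi identity (`d_defect`, `corestriction_vanish`), and it vanishes on shuffles because `A` is
commutative and `D` is a derivation of the shuffle product (`defect_shZero`, `coder_sh`). It is
therefore a chosen representative of a class `δ` plus a coboundary `d ε`. Adding `δ` to `b` and
subtracting `ε` from `τ` removes it. The delicate point is to choose `ε` so that it vanishes on
shuffles: words modulo shuffles form a vector space over `ℚ`, which is projective (`exists_lift`).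
The same Bianchi identity yields `b ∘ D = 0`.

For the extension of `g`, the composite of `g` and `f` is a twisting cochain with values in `A'`. A
coalgebra map with corestriction `G` is sought such that this cochain is gauge equivalent to the
pullback of `f'`, through a gauge transformation `1 + q`. Compatibility with shuffles forces `1 + q`
to be multiplicative, which is not a linear condition. So `q` is generated by a map `θ` that
vanishes on shuffles, through `|w| q(w) = θ(w) + ∑ θ(u) q(v)`, which is solvable over `ℚ`;
`gauge_sh` gives multiplicativity. The pair `(G, θ)` is then built by the same induction on length
(`d_gaugeDefect`, `gaugeDefect_sh`, `exists_ext_step`).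

For uniqueness, take `g = id`. The resulting coalgebra map is the identity up to shorter words, so a
geometric series inverts it, and the inverse inherits all required properties
(`exists_inverse_morphism`).

For the bar constructions, filter by tensor length. Up to shorter tensors, the differential of the
source is zero, that of the target is the tensor differential of `d`, and the map is the tensor
power of `f_1`. If the coboundaries are projective, `A` contracts onto `H(A)`, the tensor trick
extends the contraction to tensors (`skew_homotopy`), and induction on the filtration finishes the
proof (`isQuasiIso_of_filtration`). -/

noncomputable section

namespace CInf

/-! ### Signs -/

section Signs

variable (R : Type*) [CommRing R]

/-- The sign `(-1)^i` as an element of `R`. -/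
def chi (i : ZMod 2) : R := if i = 0 then 1 else -1

@[simp] lemma chi_zero : chi R 0 = 1 := rfl

@[simp] lemma chi_one : chi R 1 = -1 := by simp [chi]

lemma chi_add (i j : ZMod 2) : chi R (i + j) = chi R i * chi R j := by
  have h : ∀ i : ZMod 2, i = 0 ∨ i = 1 := by decide
  have h2 : (1 + 1 : ZMod 2) = 0 := by decide
  rcases h i with rfl | rfl <;> rcases h j with rfl | rfl <;> simp [h2]

lemma chi_mul_self (i : ZMod 2) : chi R i * chi R i = 1 := by
  rw [← chi_add, CharTwo.add_self_eq_zero, chi_zero]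

lemma chi_smul_chi_smul {X : Type*} [AddCommGroup X] [Module R X] (i : ZMod 2) (x : X) :
    chi R i • chi R i • x = x := by
  rw [smul_smul, chi_mul_self, one_smul]

lemma negOnePow_smul {X : Type*} [AddCommGroup X] [Module R X] (n : ℤ) (x : X) :
    Int.negOnePow n • x = chi R (n : ZMod 2) • x := by
  rcases Int.even_or_odd n with h | h
  · rw [Int.negOnePow_even n h, (ZMod.intCast_zmod_eq_zero_iff_dvd n 2).2 h.two_dvd]
    simp
  · rw [Int.negOnePow_odd n h]
    obtain ⟨k, rfl⟩ := h
    have h2 : (2 : ZMod 2) = 0 := by decide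
    simp [h2]

end Signs

/-! ### Sums over the splittings of a list -/

section Split

variable {B : Type*} {Z : Type*} [AddCommMonoid Z]

/-- `∑_{w = u ++ v} F u v`. -/
def spl : (List B → List B → Z) → List B → Z
  | F, [] => F [] []
  | F, a :: w => F [] (a :: w) + spl (fun u v => F (a :: u) v) w

@[simp] lemma spl_nil (F : List B → List B → Z) : spl F [] = F [] [] := by rw [spl]

lemma spl_cons (F : List B → List B → Z) (a : B) (w : List B) :
    spl F (a :: w) = F [] (a :: w) + spl (fun u v => F (a :: u) v) w := by rw [spl]

lemma spl_congr {F G : List B → List B → Z} {w : List B} (h : ∀ u v, u ++ v = w → F u v = G u v) :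
    spl F w = spl G w := by
  induction w generalizing F G with
  | nil => simpa using h [] [] rfl
  | cons a w ih =>
    rw [spl_cons, spl_cons, h [] _ rfl, ih fun u v huv => h (a :: u) v (by simp [huv])]

lemma spl_add (F G : List B → List B → Z) (w : List B) :
    spl (fun u v => F u v + G u v) w = spl F w + spl G w := by
  induction w generalizing F G with
  | nil => simp
  | cons a w ih => rw [spl_cons, spl_cons, spl_cons, ih]; abel

lemma spl_zero (w : List B) : spl (fun _ _ => (0 : Z)) w = 0 := by
  induction w with
  | nil => simp
  | cons a w ih => rw [spl_cons, ih, add_zero]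

lemma spl_eq_zero {F : List B → List B → Z} {w : List B} (h : ∀ u v, u ++ v = w → F u v = 0) :
    spl F w = 0 := by
  rw [spl_congr h, spl_zero]

lemma map_spl {Y : Type*} [AddCommMonoid Y] {F' : Type*} [FunLike F' Z Y] [AddMonoidHomClass F' Z Y]
    (f : F') (F : List B → List B → Z) (w : List B) :
    f (spl F w) = spl (fun u v => f (F u v)) w := by
  induction w generalizing F with
  | nil => simp
  | cons a w ih => rw [spl_cons, spl_cons, map_add, ih]

lemma smul_spl {S : Type*} [DistribSMul S Z] (c : S)
    (F : List B → List B → Z) (w : List B) :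
    c • spl F w = spl (fun u v => c • F u v) w :=
  map_spl (DistribSMul.toAddMonoidHom Z c) F w

lemma spl_mem {σ : Type*} [SetLike σ Z] [AddSubmonoidClass σ Z] (s : σ)
    {F : List B → List B → Z} {w : List B} (h : ∀ u v, u ++ v = w → F u v ∈ s) :
    spl F w ∈ s := by
  induction w generalizing F with
  | nil => simpa using h [] [] rfl
  | cons a w ih =>
    rw [spl_cons]
    exact add_mem (h [] _ rfl) (ih fun u v huv => h (a :: u) v (by simp [huv]))

/-- Coassociativity of deconcatenation; it is the source of the associativity of convolution and of
all regroupings of double sums below. -/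
lemma spl_assoc (K : List B → List B → List B → Z) (w : List B) :
    spl (fun u v => spl (fun v₁ v₂ => K u v₁ v₂) v) w =
      spl (fun x v₂ => spl (fun u v₁ => K u v₁ v₂) x) w := by
  induction w generalizing K with
  | nil => simp
  | cons a w ih =>
    simp only [spl_cons, spl_nil]
    rw [ih, spl_add, add_assoc]

/-- Only the splitting `w ++ []` contributes. -/
lemma spl_eq_right_nil {F : List B → List B → Z} {w : List B}
    (h : ∀ u v, u ++ v = w → v ≠ [] → F u v = 0) : spl F w = F w [] := by
  induction w generalizing F with
  | nil => simp
  | cons a w ih =>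
    rw [spl_cons, h [] _ rfl (by simp), zero_add,
      ih fun u v huv hv => h (a :: u) v (by simp [huv]) hv]

/-- Only the splitting `[] ++ w` contributes. -/
lemma spl_eq_left_nil {F : List B → List B → Z} {w : List B}
    (h : ∀ u v, u ++ v = w → u ≠ [] → F u v = 0) : spl F w = F [] w := by
  cases w with
  | nil => simp
  | cons a w =>
    rw [spl_cons, spl_eq_zero fun u v huv => h (a :: u) v (by simp [huv]) (by simp), add_zero]

lemma spl_neg {Z : Type*} [AddCommGroup Z] (F : List B → List B → Z) (w : List B) :
    spl (fun u v => - F u v) w = - spl F w :=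
  (map_spl (negAddMonoidHom : Z →+ Z) F w).symm

lemma spl_sub {Z : Type*} [AddCommGroup Z] (F G : List B → List B → Z) (w : List B) :
    spl (fun u v => F u v - G u v) w = spl F w - spl G w := by
  simp only [sub_eq_add_neg, spl_add, spl_neg]

lemma spl_comm {C : Type*} (K : List B → List B → List C → List C → Z) (x : List B) (y : List C) :
    spl (fun x₁ x₂ => spl (fun y₁ y₂ => K x₁ x₂ y₁ y₂) y) x =
      spl (fun y₁ y₂ => spl (fun x₁ x₂ => K x₁ x₂ y₁ y₂) x) y := by
  induction x generalizing K with
  | nil => simp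
  | cons a x ih => simp only [spl_cons]; rw [ih, spl_add]

end Split

lemma mul_spl {B T : Type*} [Ring T] (x : T) (F : List B → List B → T) (w : List B) :
    x * spl F w = spl (fun u v => x * F u v) w :=
  map_spl (AddMonoidHom.mulLeft x) F w

lemma spl_apply {R X Y : Type*} [CommRing R] [AddCommGroup X] [Module R X] [AddCommGroup Y]
    [Module R Y] {B : Type*} (F : List B → List B → X →ₗ[R] Y) (w : List B) (x : X) :
    spl F w x = spl (fun u v => F u v x) w :=
  map_spl (LinearMap.applyₗ (R := R) x) F w

/-! ### Words in a basis of a free module -/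

section Words

open TensorAlgebra

variable {R : Type*} [CommRing R] {H : Type*} [AddCommGroup H] [Module R H] {B : Type*}
  (e : Module.Basis B R H) (dg : B → ℤ)
  {X Y Z : Type*} [AddCommGroup X] [Module R X] [AddCommGroup Y] [Module R Y]
  [AddCommGroup Z] [Module R Z]

/-- The degree of a word. -/
def wdeg (w : List B) : ℤ := (w.map dg).sum

/-- The parity of a word. -/
def par (w : List B) : ZMod 2 := (wdeg dg w : ZMod 2)

@[simp] lemma wdeg_nil : wdeg dg [] = 0 := rfl

@[simp] lemma wdeg_cons (a : B) (w : List B) : wdeg dg (a :: w) = dg a + wdeg dg w := by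
  simp [wdeg]

@[simp] lemma wdeg_append (u v : List B) : wdeg dg (u ++ v) = wdeg dg u + wdeg dg v := by
  simp [wdeg]

@[simp] lemma par_nil : par dg [] = 0 := by simp [par]

@[simp] lemma par_cons (a : B) (w : List B) : par dg (a :: w) = (dg a : ZMod 2) + par dg w := by
  simp [par]

@[simp] lemma par_append (u v : List B) : par dg (u ++ v) = par dg u + par dg v := by
  simp [par]

/-- The element of the tensor algebra that belongs to a word of basis elements. -/
def E (w : List B) : TensorAlgebra R H := (w.map fun b => ι R (e b)).prod

@[simp] lemma E_nil : E e [] = 1 := rfl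

@[simp] lemma E_cons (a : B) (w : List B) : E e (a :: w) = ι R (e a) * E e w := by
  simp [E]

lemma tensorAlgebra_basis_apply (w : List B) :
    e.tensorAlgebra (FreeMonoid.ofList w) = E e w := by
  have h : ∀ w : List B, (FreeAlgebra.basisFreeMonoid R B) (FreeMonoid.ofList w) =
      (w.map (FreeAlgebra.ι R)).prod := by
    intro w
    simp [FreeAlgebra.basisFreeMonoid, FreeAlgebra.equivMonoidAlgebraFreeMonoid]
  rw [Module.Basis.tensorAlgebra, Module.Basis.map_apply, h]
  simp [E, map_list_prod, Function.comp_def]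

/-- The linear map with given values on words. -/
def lin (φ : List B → X) : TensorAlgebra R H →ₗ[R] X :=
  e.tensorAlgebra.constr R fun w => φ (FreeMonoid.toList w)

@[simp] lemma lin_E (φ : List B → X) (w : List B) : lin e φ (E e w) = φ w := by
  rw [← tensorAlgebra_basis_apply, lin, Module.Basis.constr_basis]
  rfl

variable {e} in
lemma ext_E {f g : TensorAlgebra R H →ₗ[R] X} (h : ∀ w, f (E e w) = g (E e w)) : f = g :=
  e.tensorAlgebra.ext fun w => by
    have := h (FreeMonoid.toList w)
    rwa [← tensorAlgebra_basis_apply, FreeMonoid.ofList_toList] at this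

lemma lin_eq (f : TensorAlgebra R H →ₗ[R] X) : lin e (fun w => f (E e w)) = f :=
  ext_E (e := e) fun w => by simp

/-- `∑_{w = uv} F(u, v)` as a linear map on the tensor algebra. -/
def splT (F : TensorAlgebra R H →ₗ[R] TensorAlgebra R H →ₗ[R] Z) : TensorAlgebra R H →ₗ[R] Z :=
  lin e fun w => spl (fun u v => F (E e u) (E e v)) w

lemma splT_E (F : TensorAlgebra R H →ₗ[R] TensorAlgebra R H →ₗ[R] Z) (w : List B) :
    splT e F (E e w) = spl (fun u v => F (E e u) (E e v)) w := by
  simp [splT]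

variable {e} in
lemma word_induction {p : TensorAlgebra R H → Prop} (z : TensorAlgebra R H)
    (hE : ∀ w, p (E e w)) (hadd : ∀ x y, p x → p y → p (x + y))
    (hsmul : ∀ (c : R) x, p x → p (c • x)) : p z := by
  have hz := e.tensorAlgebra.mem_span z
  induction hz using Submodule.span_induction with
  | mem x hx =>
    obtain ⟨w, rfl⟩ := hx
    have := hE (FreeMonoid.toList w)
    rwa [← tensorAlgebra_basis_apply, FreeMonoid.ofList_toList] at this
  | zero => simpa using hsmul 0 _ (hE [])
  | add x y _ _ hx hy => exact hadd x y hx hy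
  | smul c x _ hx => exact hsmul c x hx

/-- A cut falls in front of the first factor or behind it. The factor is an arbitrary `h`, not only
a basis letter, because coderivations and coalgebra maps put elements such as `b(u)` in first
position. -/
lemma splT_ι_mul (F : TensorAlgebra R H →ₗ[R] TensorAlgebra R H →ₗ[R] Z) (h : H)
    (z : TensorAlgebra R H) :
    splT e F (ι R h * z) = F 1 (ι R h * z) +
      splT e (F ∘ₗ LinearMap.mulLeft R (ι R h)) z := by
  have hh := e.mem_span h
  induction z using word_induction (e := e) with
  | hE w =>
    induction hh using Submodule.span_induction with
    | mem x hx =>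
      obtain ⟨a, rfl⟩ := hx
      rw [← E_cons, splT_E, spl_cons, splT_E]
      simp
    | zero => simp [splT_E, spl_zero]
    | add x y _ _ hx hy =>
      simp only [map_add, add_mul, hx, hy]
      simp only [splT_E, LinearMap.comp_apply, LinearMap.mulLeft_apply, map_add, add_mul,
        LinearMap.add_apply, spl_add]
      abel
    | smul c x _ hx =>
      simp only [map_smul, smul_mul_assoc, hx]
      simp only [splT_E, LinearMap.comp_apply, LinearMap.mulLeft_apply, map_smul, smul_mul_assoc,
        LinearMap.smul_apply, smul_spl, smul_add]
  | hadd x y hx hy => simp only [mul_add, map_add, hx, hy]; abel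
  | hsmul c x hx => simp only [mul_smul_comm, map_smul, hx, smul_add]

/-- The sign operator `w ↦ (-1)^{|w|} w`. -/
def sgn : TensorAlgebra R H →ₗ[R] TensorAlgebra R H := lin e fun w => chi R (par dg w) • E e w

@[simp] lemma sgn_E (w : List B) : sgn e dg (E e w) = chi R (par dg w) • E e w := by simp [sgn]

@[simp] lemma sgn_one : sgn e dg 1 = 1 := by simpa using sgn_E e dg []

@[simp] lemma sgn_sgn (z : TensorAlgebra R H) : sgn e dg (sgn e dg z) = z := by
  induction z using word_induction (e := e) with
  | hE w => simp [chi_smul_chi_smul]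
  | hadd x y hx hy => simp [hx, hy]
  | hsmul c x hx => simp [hx]

/-- The span of the basis elements of degree `i`. -/
def HD (i : ℤ) : Submodule R H := Submodule.span R (e '' {b | dg b = i})

/-- The span of the words of degree `i`. -/
def TD (i : ℤ) : Submodule R (TensorAlgebra R H) := Submodule.span R (E e '' {w | wdeg dg w = i})

lemma mem_HD (a : B) : e a ∈ HD e dg (dg a) := Submodule.subset_span ⟨a, rfl, rfl⟩

lemma mem_TD (w : List B) : E e w ∈ TD e dg (wdeg dg w) := Submodule.subset_span ⟨w, rfl, rfl⟩

variable {e dg}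

@[elab_as_elim]
lemma HD_induction {i : ℤ} {p : H → Prop} {h : H} (hh : h ∈ HD e dg i)
    (he : ∀ a, dg a = i → p (e a)) (h0 : p 0) (hadd : ∀ x y, p x → p y → p (x + y))
    (hsmul : ∀ (c : R) x, p x → p (c • x)) : p h := by
  induction hh using Submodule.span_induction with
  | mem x hx => obtain ⟨a, ha, rfl⟩ := hx; exact he a ha
  | zero => exact h0
  | add x y _ _ hx hy => exact hadd x y hx hy
  | smul c x _ hx => exact hsmul c x hx

@[elab_as_elim]
lemma TD_induction {i : ℤ} {p : TensorAlgebra R H → Prop} {z : TensorAlgebra R H}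
    (hz : z ∈ TD e dg i)
    (hE : ∀ w, wdeg dg w = i → p (E e w)) (h0 : p 0) (hadd : ∀ x y, p x → p y → p (x + y))
    (hsmul : ∀ (c : R) x, p x → p (c • x)) : p z := by
  induction hz using Submodule.span_induction with
  | mem x hx => obtain ⟨a, ha, rfl⟩ := hx; exact hE a ha
  | zero => exact h0
  | add x y _ _ hx hy => exact hadd x y hx hy
  | smul c x _ hx => exact hsmul c x hx

lemma ι_mul_mem_TD {i j : ℤ} {h : H} (hh : h ∈ HD e dg i) {z : TensorAlgebra R H}
    (hz : z ∈ TD e dg j) : ι R h * z ∈ TD e dg (i + j) := by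
  refine HD_induction hh (fun a ha => ?_) (by simp) (fun x y hx hy => ?_) (fun c x hx => ?_)
  · refine TD_induction hz (fun w hw => ?_) (by simp) (fun x y hx hy => ?_) (fun c x hx => ?_)
    · rw [← E_cons]
      convert mem_TD e dg (a :: w) using 1
      simp [ha, hw]
    · rw [mul_add]; exact add_mem hx hy
    · rw [mul_smul_comm]; exact Submodule.smul_mem _ _ hx
  · rw [map_add, add_mul]; exact add_mem hx hy
  · rw [map_smul, smul_mul_assoc]; exact Submodule.smul_mem _ _ hx

lemma sgn_of_mem {i : ℤ} {z : TensorAlgebra R H} (hz : z ∈ TD e dg i) :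
    sgn e dg z = chi R (i : ZMod 2) • z := by
  refine TD_induction hz (fun w hw => ?_) (by simp) (fun x y hx hy => ?_) (fun c x hx => ?_)
  · rw [sgn_E, par, hw]
  · rw [map_add, hx, hy, smul_add]
  · rw [map_smul, hx, smul_comm]

variable (e dg)

/-! ### The coderivation with given corestriction -/

/-- The bilinear map `(x, y) ↦ b(x) · y`. -/
def headMul (b : TensorAlgebra R H →ₗ[R] X) (c : TensorAlgebra R H →ₗ[R] TensorAlgebra R X) :
    TensorAlgebra R H →ₗ[R] TensorAlgebra R H →ₗ[R] TensorAlgebra R X :=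
  (LinearMap.mul R (TensorAlgebra R X)).compl₁₂ (ι R ∘ₗ b) c

@[simp] lemma headMul_apply (b : TensorAlgebra R H →ₗ[R] X)
    (c : TensorAlgebra R H →ₗ[R] TensorAlgebra R X) (x y : TensorAlgebra R H) :
    headMul b c x y = ι R (b x) * c y := rfl

/-- `∑_{w = uv} b(u) v`. -/
def headOp (b : TensorAlgebra R H →ₗ[R] H) : TensorAlgebra R H →ₗ[R] TensorAlgebra R H :=
  splT e (headMul b LinearMap.id)

lemma headOp_E (b : TensorAlgebra R H →ₗ[R] H) (w : List B) :
    headOp e b (E e w) = spl (fun u v => ι R (b (E e u)) * E e v) w := by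
  simp [headOp, splT_E]

/-- The values on words of the coderivation with corestriction `b`. -/
def coderWord (b : TensorAlgebra R H →ₗ[R] H) : List B → TensorAlgebra R H
  | [] => 0
  | a :: w => headOp e b (E e (a :: w)) +
      chi R (dg a : ZMod 2) • (ι R (e a) * coderWord b w)

/-- The coderivation of degree one with corestriction `b`:
`w ↦ ∑_{w = u v t} (-1)^{|u|} u b(v) t`. -/
def coder (b : TensorAlgebra R H →ₗ[R] H) : TensorAlgebra R H →ₗ[R] TensorAlgebra R H :=
  lin e (coderWord e dg b)

@[simp] lemma coder_one (b : TensorAlgebra R H →ₗ[R] H) : coder e dg b 1 = 0 := by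
  rw [← E_nil e, coder, lin_E, coderWord]

lemma coder_cons (b : TensorAlgebra R H →ₗ[R] H) (a : B) (z : TensorAlgebra R H) :
    coder e dg b (ι R (e a) * z) = headOp e b (ι R (e a) * z) +
      chi R (dg a : ZMod 2) • (ι R (e a) * coder e dg b z) := by
  induction z using word_induction (e := e) with
  | hE w => rw [← E_cons, coder, lin_E, coderWord, lin_E]
  | hadd x y hx hy => simp only [mul_add, map_add, hx, hy, smul_add]; abel
  | hsmul c x hx =>
    simp only [mul_smul_comm, map_smul, hx, smul_add]
    rw [smul_comm c (chi R _)]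

lemma coder_ι_mul (b : TensorAlgebra R H →ₗ[R] H) {i : ℤ} {h : H} (hh : h ∈ HD e dg i)
    (z : TensorAlgebra R H) :
    coder e dg b (ι R h * z) = headOp e b (ι R h * z) +
      chi R (i : ZMod 2) • (ι R h * coder e dg b z) := by
  refine HD_induction hh (fun a ha => ?_) (by simp) (fun x y hx hy => ?_) (fun c x hx => ?_)
  · rw [coder_cons, ha]
  · simp only [map_add, add_mul, hx, hy, smul_add]; abel
  · simp only [map_smul, smul_mul_assoc, hx, smul_add]
    rw [smul_comm c (chi R _)]

/-- As `b(u)` is a single letter, a cut of `b(u) v` falls in front of it or inside `v`; in the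
second case `spl_assoc` collects the part to the left of the cut. -/
lemma splT_headOp (b : TensorAlgebra R H →ₗ[R] H)
    (F : TensorAlgebra R H →ₗ[R] TensorAlgebra R H →ₗ[R] Z) (z : TensorAlgebra R H) :
    splT e F (headOp e b z) = F 1 (headOp e b z) + splT e (F ∘ₗ headOp e b) z := by
  induction z using word_induction (e := e) with
  | hE w =>
    rw [headOp_E, map_spl, map_spl, splT_E]
    simp only [splT_ι_mul, spl_add, splT_E, LinearMap.comp_apply, LinearMap.mulLeft_apply,
      headOp_E]
    rw [spl_assoc]
    congr 1
    refine spl_congr fun u v _ => ?_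
    rw [map_spl, spl_apply]
  | hadd x y hx hy => simp only [map_add, hx, hy]; abel
  | hsmul c x hx => simp only [map_smul, hx, smul_add]

lemma headOp_one {b : TensorAlgebra R H →ₗ[R] H} (hb : b 1 = 0) : headOp e b 1 = 0 := by
  rw [← E_nil e, headOp_E]
  simp [hb]

/-- `∑_{w = uv}` against the coderivation: the coderivation property. -/
lemma splT_coder {b : TensorAlgebra R H →ₗ[R] H} (hb : b 1 = 0)
    (F : TensorAlgebra R H →ₗ[R] TensorAlgebra R H →ₗ[R] Z) (z : TensorAlgebra R H) :
    splT e F (coder e dg b z) = splT e (F ∘ₗ coder e dg b) z +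
      splT e (F.compl₁₂ (sgn e dg) (coder e dg b)) z := by
  induction z using word_induction (e := e) with
  | hE w =>
    -- Peeling off the first letter replaces `F` by `F` precomposed with multiplication by that
    -- letter.
    induction w generalizing F with
    | nil => simp [splT_E, - E_nil, spl_nil]; simp
    | cons a w ih =>
      simp only [E_cons, coder_cons, map_add, map_smul, splT_headOp]
      rw [splT_ι_mul _ F, ih, splT_ι_mul _ (F ∘ₗ coder e dg b), splT_ι_mul _ (F.compl₁₂ _ _),
        splT_ι_mul _ (F ∘ₗ headOp e b)]
      simp only [splT_E, LinearMap.comp_apply, LinearMap.mulLeft_apply, LinearMap.compl₁₂_apply,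
        ← E_cons, sgn_E, par_cons, chi_add,
        map_smul, LinearMap.smul_apply, smul_spl, smul_add, coder_one, sgn_one, headOp_one e hb,
        map_zero, LinearMap.zero_apply, mul_smul]
      simp only [E_cons, coder_cons, map_add, LinearMap.add_apply, spl_add, map_smul,
         LinearMap.smul_apply]
      abel
  | hadd x y hx hy => simp only [map_add, hx, hy]; abel
  | hsmul c x hx => simp only [map_smul, hx, smul_add]

/-- A linear map vanishes on words of length less than `n`. -/
def VanishBelow (n : ℕ) (α : TensorAlgebra R H →ₗ[R] X) : Prop :=
  ∀ w : List B, w.length < n → α (E e w) = 0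

/-- The square of the coderivation is governed by its corestriction. -/
lemma coder_coder_cons {b : TensorAlgebra R H →ₗ[R] H} (hb : b 1 = 0)
    (hdeg : ∀ w, b (E e w) ∈ HD e dg (wdeg dg w + 1)) (a : B) (w : List B) :
    coder e dg b (coder e dg b (E e (a :: w))) =
      spl (fun u v => ι R (b (coder e dg b (E e u))) * E e v) (a :: w) +
        ι R (e a) * coder e dg b (coder e dg b (E e w)) := by
  -- The letter `b(u)` has degree `|u| + 1`, so moving the coderivation past it gives `-(-1)^{|u|}`;
  -- these terms cancel against those of `h2`.
  have h1 : coder e dg b (headOp e b (E e (a :: w))) = headOp e b (headOp e b (E e (a :: w))) -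
      spl (fun u v => chi R (par dg u) • (ι R (b (E e u)) * coder e dg b (E e v))) (a :: w) := by
    rw [headOp_E, map_spl, map_spl, ← spl_sub]
    refine spl_congr fun u v _ => ?_
    rw [coder_ι_mul e dg b (hdeg u)]
    push_cast
    rw [← par, chi_add, chi_one]
    simp [sub_eq_add_neg]
  have h2 := splT_coder e dg hb (headMul b LinearMap.id) (E e (a :: w))
  change headOp e b _ = _ at h2
  rw [splT_E, splT_E] at h2
  simp only [LinearMap.comp_apply, LinearMap.compl₁₂_apply, headMul_apply, sgn_E, map_smul,
    LinearMap.smul_apply, LinearMap.id_apply] at h2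
  have h3 : coder e dg b (E e (a :: w)) = headOp e b (E e (a :: w)) +
      chi R (dg a : ZMod 2) • (ι R (e a) * coder e dg b (E e w)) := by
    rw [E_cons, coder_cons]
  rw [eq_comm, ← eq_sub_iff_add_eq] at h2
  rw [h2, h3, map_add, h1, map_smul, coder_cons, smul_add, chi_smul_chi_smul, map_add, map_smul]
  abel

/-- The square of an odd coderivation is again a coderivation, with corestriction `b ∘ D`. If the
latter vanishes on shorter words, only the term that consumes the whole word survives. -/
lemma coder_coder_of_vanish {b : TensorAlgebra R H →ₗ[R] H} (hb : b 1 = 0)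
    (hdeg : ∀ w, b (E e w) ∈ HD e dg (wdeg dg w + 1)) {n : ℕ}
    (hN : VanishBelow e n (b ∘ₗ coder e dg b)) :
    ∀ w : List B, w.length ≤ n →
      coder e dg b (coder e dg b (E e w)) = ι R (b (coder e dg b (E e w)))
  | [], _ => by simp
  | a :: w, hw => by
    have hw' : w.length < n := by simpa using hw
    rw [coder_coder_cons e dg hb hdeg, coder_coder_of_vanish hb hdeg hN w hw'.le,
      show b (coder e dg b (E e w)) = 0 from hN w hw']
    rw [spl_eq_right_nil]
    · simp
    · intro u v huv hv
      have : u.length < n := by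
        have := congrArg List.length huv
        have := List.length_pos_iff.2 hv
        simp at *; omega
      rw [show b (coder e dg b (E e u)) = 0 from hN u this]
      simp

lemma coder_coder {b : TensorAlgebra R H →ₗ[R] H} (hb : b 1 = 0)
    (hdeg : ∀ w, b (E e w) ∈ HD e dg (wdeg dg w + 1)) (hN : b ∘ₗ coder e dg b = 0) :
    coder e dg b ∘ₗ coder e dg b = 0 :=
  ext_E (e := e) fun w => by
    have h := coder_coder_of_vanish e dg hb hdeg (n := w.length)
      (fun u _ => LinearMap.congr_fun hN _) w le_rfl
    rw [LinearMap.comp_apply, h, show b (coder e dg b (E e w)) = 0 from LinearMap.congr_fun hN _]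
    simp

/-! ### The coalgebra map with given corestriction -/

/-- Auxiliary recursion for `comapWord`. -/
def comapAux : (List B → X) → (List B → X) → List B → TensorAlgebra R X
  | _, K, [] => ι R (K [])
  | G, K, a :: w => ι R (K []) * comapAux G (fun u => G (a :: u)) w +
      comapAux G (fun u => K (a :: u)) w

/-- The values on words of the coalgebra map with corestriction `G`. -/
def comapWord (G : List B → X) : List B → TensorAlgebra R X
  | [] => 1
  | a :: w => comapAux G (fun u => G (a :: u)) w

lemma comapAux_eq (G K : List B → X) (w : List B) :
    comapAux G K w = spl (fun u v => ι R (K u) * comapWord G v) w := by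
  induction w generalizing K with
  | nil => simp [comapAux, comapWord]
  | cons a w ih => rw [comapAux, spl_cons, ← ih]; rfl

/-- The coalgebra map with corestriction `G`: `w ↦ ∑ G(w₁) ⋯ G(w_k)` over all ways to write `w`
as a concatenation of nonempty words. -/
def comap (G : TensorAlgebra R H →ₗ[R] X) : TensorAlgebra R H →ₗ[R] TensorAlgebra R X :=
  lin e (comapWord fun w => G (E e w))

@[simp] lemma comap_one (G : TensorAlgebra R H →ₗ[R] X) : comap e G 1 = 1 := by
  rw [← E_nil e, comap, lin_E, comapWord]

lemma comap_E {G : TensorAlgebra R H →ₗ[R] X} (hG : G 1 = 0) {w : List B} (hw : w ≠ []) :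
    comap e G (E e w) = spl (fun u v => ι R (G (E e u)) * comap e G (E e v)) w := by
  cases w with
  | nil => exact absurd rfl hw
  | cons a w =>
    rw [spl_cons, E_nil, hG, map_zero, zero_mul, zero_add]
    simp only [comap, lin_E]
    rw [comapWord, comapAux_eq]

/-- The augmentation. -/
def aug : TensorAlgebra R H →ₗ[R] R := lin e fun w => if w = [] then 1 else 0

lemma comap_eq {G : TensorAlgebra R H →ₗ[R] X} (hG : G 1 = 0) (z : TensorAlgebra R H) :
    comap e G z = aug e z • 1 + splT e (headMul G (comap e G)) z := by
  induction z using word_induction (e := e) with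
  | hE w =>
    rcases eq_or_ne w [] with rfl | hw
    · rw [splT_E, aug, lin_E]; simp [hG]
    · rw [comap_E e hG hw, splT_E]
      simp [aug, hw]
  | hadd x y hx hy => simp only [map_add, hx, hy, add_smul]; abel
  | hsmul c x hx => simp only [map_smul, hx, smul_add, smul_smul, smul_eq_mul]

@[simp] lemma aug_ι_mul (h : H) (z : TensorAlgebra R H) : aug e (ι R h * z) = 0 := by
  induction z using word_induction (e := e) with
  | hE w =>
    have hh := e.mem_span h
    induction hh using Submodule.span_induction with
    | mem x hx => obtain ⟨a, rfl⟩ := hx; rw [← E_cons, aug, lin_E]; simp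
    | zero => simp
    | add x y _ _ hx hy => simp only [map_add, add_mul, hx, hy, add_zero]
    | smul c x _ hx => simp only [map_smul, smul_mul_assoc, hx, smul_zero]
  | hadd x y hx hy => simp only [mul_add, map_add, hx, hy, add_zero]
  | hsmul c x hx => simp only [mul_smul_comm, map_smul, hx, smul_zero]

@[simp] lemma aug_coder (b : TensorAlgebra R H →ₗ[R] H) (z : TensorAlgebra R H) :
    aug e (coder e dg b z) = 0 := by
  induction z using word_induction (e := e) with
  | hE w =>
    cases w with
    | nil => simp
    | cons a w =>
      rw [E_cons, coder_cons, ← E_cons, headOp_E, map_add, map_spl, map_smul]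
      simp [spl_zero]
  | hadd x y hx hy => simp only [map_add, hx, hy, add_zero]
  | hsmul c x hx => simp only [map_smul, hx, smul_zero]

variable {H' : Type*} [AddCommGroup H'] [Module R H'] {B' : Type*}
  (e' : Module.Basis B' R H') (dg' : B' → ℤ)

lemma aug_comap {G : TensorAlgebra R H →ₗ[R] H'} (hG : G 1 = 0) {w : List B} (hw : w ≠ []) :
    aug e' (comap e G (E e w)) = 0 := by
  rw [comap_E e hG hw, map_spl]
  simp [spl_zero]

/-- The map `comap e G` is compatible with deconcatenation. -/
lemma splT_comap {G : TensorAlgebra R H →ₗ[R] H'} (hG : G 1 = 0)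
    (F : TensorAlgebra R H' →ₗ[R] TensorAlgebra R H' →ₗ[R] Z) (w : List B) :
    splT e' F (comap e G (E e w)) =
      spl (fun u v => F (comap e G (E e u)) (comap e G (E e v))) w := by
  induction hn : w.length using Nat.strong_induction_on generalizing w F with
  | _ n ih =>
    subst hn
    cases w with
    | nil =>
      simp only [E_nil, comap_one, spl_nil]
      rw [← E_nil e', splT_E, spl_nil]
    | cons a w =>
      have h1 : splT e' F (comap e G (E e (a :: w))) =
          spl (fun u v => F 1 (ι R (G (E e u)) * comap e G (E e v)) +
            spl (fun v₁ v₂ => F (ι R (G (E e u)) * comap e G (E e v₁)) (comap e G (E e v₂))) v)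
            (a :: w) := by
        rw [comap_E e hG (by simp), map_spl]
        refine spl_congr fun u v huv => ?_
        rcases u with _ | ⟨c, u⟩
        · simp [hG, spl_zero]
        · rw [splT_ι_mul, ih v.length _ _ _ rfl]
          · rfl
          · have := congrArg List.length huv
            simp at this ⊢; omega
      rw [h1, spl_add, ← map_spl, ← comap_E e hG (by simp), spl_assoc, spl_cons, spl_cons]
      simp only [spl_nil, E_nil, hG, map_zero, zero_mul, LinearMap.zero_apply, zero_add, comap_one]
      congr 1
      refine spl_congr fun u v _ => ?_
      rw [comap_E e hG (show a :: u ≠ [] by simp), map_spl, spl_apply]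

lemma comap_coder {b : TensorAlgebra R H →ₗ[R] H} (hb : b 1 = 0)
    {G : TensorAlgebra R H →ₗ[R] X} (hG : G 1 = 0) (w : List B) :
    comap e G (coder e dg b (E e w)) =
      spl (fun u v => ι R (G (coder e dg b (E e u))) * comap e G (E e v)) w +
      spl (fun u v => chi R (par dg u) •
        (ι R (G (E e u)) * comap e G (coder e dg b (E e v)))) w := by
  rw [comap_eq e hG, aug_coder, zero_smul, zero_add, splT_coder e dg hb, splT_E, splT_E]
  simp

/-- The same recursion over the first block as in `comap_coder`, with another inhomogeneous term.
The two composites can therefore be compared through their corestrictions alone. -/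
lemma coder_comap {b' : TensorAlgebra R H' →ₗ[R] H'} (hb' : b' 1 = 0)
    {G : TensorAlgebra R H →ₗ[R] H'} (hG : G 1 = 0)
    (hdeg : ∀ w, G (E e w) ∈ HD e' dg' (wdeg dg w)) (w : List B) :
    coder e' dg' b' (comap e G (E e w)) =
      spl (fun u v => ι R (b' (comap e G (E e u))) * comap e G (E e v)) w +
      spl (fun u v => chi R (par dg u) •
        (ι R (G (E e u)) * coder e' dg' b' (comap e G (E e v)))) w := by
  rcases eq_or_ne w [] with rfl | hw
  · simp [hG, hb']
  have h1 := splT_comap e e' hG (headMul b' LinearMap.id) w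
  change headOp e' b' _ = _ at h1
  simp only [headMul_apply, LinearMap.id_apply] at h1
  rw [← h1]
  nth_rewrite 1 [comap_E e hG hw]
  rw [comap_E e hG hw, map_spl, map_spl, ← spl_add]
  refine spl_congr fun u v _ => ?_
  rw [coder_ι_mul e' dg' b' (hdeg u)]
  rfl

/-- If the corestrictions agree on short words, then so do the two composites, and the first
difference is in the corestriction. -/
lemma intertwine_of_vanish {b : TensorAlgebra R H →ₗ[R] H} (hb : b 1 = 0)
    {G : TensorAlgebra R H →ₗ[R] X} (hG : G 1 = 0)
    {D : TensorAlgebra R X →ₗ[R] TensorAlgebra R X} {M : List B → X}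
    (hD : ∀ w, D (comap e G (E e w)) =
      spl (fun u v => ι R (M u) * comap e G (E e v)) w +
      spl (fun u v => chi R (par dg u) • (ι R (G (E e u)) * D (comap e G (E e v)))) w)
    {n : ℕ} (hM : ∀ w, w.length < n → M w = G (coder e dg b (E e w))) :
    ∀ w : List B, w.length ≤ n → D (comap e G (E e w)) - comap e G (coder e dg b (E e w)) =
      ι R (M w - G (coder e dg b (E e w))) := by
  intro w
  induction hn : w.length using Nat.strong_induction_on generalizing w with
  | _ k ih =>
    subst hn
    intro hw
    rw [hD, comap_coder e dg hb hG, add_sub_add_comm, ← spl_sub, ← spl_sub]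
    rw [spl_eq_right_nil, spl_eq_zero]
    · simp [map_sub]
    · rintro (_ | ⟨c, u⟩) v huv
      · simp [hG]
      · have hlt : v.length < w.length := by
          have := congrArg List.length huv
          simp at this ⊢; omega
        rw [← smul_sub, ← mul_sub, ih v.length hlt v rfl (by omega), hM v (by omega)]
        simp
    · intro u v huv hv
      have hlt : u.length < w.length := by
        have := congrArg List.length huv
        have := List.length_pos_iff.2 hv
        simp at *; omega
      rw [hM u (by omega), sub_self]

/-- Of `D` only the recursion over the first block is required, so that this also covers the bar
differential of `A`, whose underlying module need not be free. -/
lemma intertwine {b : TensorAlgebra R H →ₗ[R] H} (hb : b 1 = 0)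
    {G : TensorAlgebra R H →ₗ[R] X} (hG : G 1 = 0)
    {D : TensorAlgebra R X →ₗ[R] TensorAlgebra R X} {M : List B → X}
    (hD : ∀ w, D (comap e G (E e w)) =
      spl (fun u v => ι R (M u) * comap e G (E e v)) w +
      spl (fun u v => chi R (par dg u) • (ι R (G (E e u)) * D (comap e G (E e v)))) w)
    (hM : ∀ w, M w = G (coder e dg b (E e w))) :
    D ∘ₗ comap e G = comap e G ∘ₗ coder e dg b :=
  ext_E (e := e) fun w => by
    have := intertwine_of_vanish e dg hb hG hD (n := w.length) (fun w _ => hM w) w le_rfl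
    rw [hM, sub_self, map_zero, sub_eq_zero] at this
    exact this

lemma comap_comp {G : TensorAlgebra R H →ₗ[R] H'} (hG : G 1 = 0)
    {h : TensorAlgebra R H' →ₗ[R] X} (hh : h 1 = 0) :
    comap e (h ∘ₗ comap e G) = comap e' h ∘ₗ comap e G := by
  refine ext_E (e := e) fun w => ?_
  induction hn : w.length using Nat.strong_induction_on generalizing w with
  | _ k ih =>
    subst hn
    rcases eq_or_ne w [] with rfl | hw
    · simp
    rw [comap_E e (by simp [hh]) hw, LinearMap.comp_apply, comap_eq e' hh,
      aug_comap e e' hG hw, zero_smul, zero_add, splT_comap e e' hG]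
    refine spl_congr ?_
    rintro (_ | ⟨c, u⟩) v huv
    · simp [hh]
    · rw [ih v.length _ v rfl]
      · rfl
      · have := congrArg List.length huv
        simp at this ⊢; omega

/-! ### Degrees -/

lemma headOp_mem_TD {b : TensorAlgebra R H →ₗ[R] H}
    (hdeg : ∀ w, b (E e w) ∈ HD e dg (wdeg dg w + 1)) (w : List B) :
    headOp e b (E e w) ∈ TD e dg (wdeg dg w + 1) := by
  rw [headOp_E]
  refine spl_mem _ fun u v huv => ?_
  convert ι_mul_mem_TD (hdeg u) (mem_TD e dg v) using 2
  rw [← huv, wdeg_append]; ring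

lemma coder_mem_TD {b : TensorAlgebra R H →ₗ[R] H}
    (hdeg : ∀ w, b (E e w) ∈ HD e dg (wdeg dg w + 1)) :
    ∀ w : List B, coder e dg b (E e w) ∈ TD e dg (wdeg dg w + 1)
  | [] => by simp
  | a :: w => by
    rw [E_cons, coder_cons, ← E_cons]
    refine add_mem (headOp_mem_TD e dg hdeg _) (Submodule.smul_mem _ _ ?_)
    convert ι_mul_mem_TD (mem_HD e dg a) (coder_mem_TD hdeg w) using 2
    rw [wdeg_cons]; ring

lemma comap_mem_TD {G : TensorAlgebra R H →ₗ[R] H'} (hG : G 1 = 0)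
    (hdeg : ∀ w, G (E e w) ∈ HD e' dg' (wdeg dg w)) (w : List B) :
    comap e G (E e w) ∈ TD e' dg' (wdeg dg w) := by
  induction hn : w.length using Nat.strong_induction_on generalizing w with
  | _ k ih =>
    subst hn
    rcases eq_or_ne w [] with rfl | hw
    · simpa using mem_TD e' dg' []
    rw [comap_E e hG hw]
    refine spl_mem _ ?_
    rintro (_ | ⟨c, u⟩) v huv
    · simp [hG]
    · rw [← huv, wdeg_append]
      refine ι_mul_mem_TD (hdeg _) (ih v.length ?_ v rfl)
      have := congrArg List.length huv
      simp at this ⊢; omega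

lemma sgn_coder {b : TensorAlgebra R H →ₗ[R] H}
    (hdeg : ∀ w, b (E e w) ∈ HD e dg (wdeg dg w + 1)) :
    sgn e dg ∘ₗ coder e dg b = - coder e dg b ∘ₗ sgn e dg :=
  ext_E (e := e) fun w => by
    rw [LinearMap.comp_apply, sgn_of_mem (coder_mem_TD e dg hdeg w)]
    push_cast
    simp [chi_add, par]

lemma sgn_comap {G : TensorAlgebra R H →ₗ[R] H'} (hG : G 1 = 0)
    (hdeg : ∀ w, G (E e w) ∈ HD e' dg' (wdeg dg w)) :
    sgn e' dg' ∘ₗ comap e G = comap e G ∘ₗ sgn e dg :=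
  ext_E (e := e) fun w => by
    rw [LinearMap.comp_apply, sgn_of_mem (comap_mem_TD e dg e' dg' hG hdeg w)]
    simp [par]

/-! ### Convolution products -/

/-- The convolution product `w ↦ ∑_{w = uv} m(α(u), β(v))`. -/
def cup (m : X →ₗ[R] Y →ₗ[R] Z) (α : TensorAlgebra R H →ₗ[R] X) (β : TensorAlgebra R H →ₗ[R] Y) :
    TensorAlgebra R H →ₗ[R] Z :=
  splT e (m.compl₁₂ α β)

lemma cup_eq (m : X →ₗ[R] Y →ₗ[R] Z) (α : TensorAlgebra R H →ₗ[R] X)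
    (β : TensorAlgebra R H →ₗ[R] Y) : cup e m α β = splT e (m.compl₁₂ α β) := rfl

lemma cup_E (m : X →ₗ[R] Y →ₗ[R] Z) (α : TensorAlgebra R H →ₗ[R] X)
    (β : TensorAlgebra R H →ₗ[R] Y) (w : List B) :
    cup e m α β (E e w) = spl (fun u v => m (α (E e u)) (β (E e v))) w := by
  rw [cup_eq, splT_E]; rfl

lemma cup_add_left (m : X →ₗ[R] Y →ₗ[R] Z) (α α' : TensorAlgebra R H →ₗ[R] X)
    (β : TensorAlgebra R H →ₗ[R] Y) : cup e m (α + α') β = cup e m α β + cup e m α' β :=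
  ext_E (e := e) fun w => by
    simp only [cup_E, LinearMap.add_apply, map_add, spl_add]

lemma cup_add_right (m : X →ₗ[R] Y →ₗ[R] Z) (α : TensorAlgebra R H →ₗ[R] X)
    (β β' : TensorAlgebra R H →ₗ[R] Y) : cup e m α (β + β') = cup e m α β + cup e m α β' :=
  ext_E (e := e) fun w => by
    simp only [cup_E, LinearMap.add_apply, map_add, spl_add]

lemma cup_neg_left (m : X →ₗ[R] Y →ₗ[R] Z) (α : TensorAlgebra R H →ₗ[R] X)
    (β : TensorAlgebra R H →ₗ[R] Y) : cup e m (-α) β = - cup e m α β :=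
  ext_E (e := e) fun w => by
    simp only [cup_E, LinearMap.neg_apply, map_neg, spl_neg]

lemma cup_neg_right (m : X →ₗ[R] Y →ₗ[R] Z) (α : TensorAlgebra R H →ₗ[R] X)
    (β : TensorAlgebra R H →ₗ[R] Y) : cup e m α (-β) = - cup e m α β :=
  ext_E (e := e) fun w => by
    simp only [cup_E, LinearMap.neg_apply, map_neg, spl_neg]

lemma cup_sub_left (m : X →ₗ[R] Y →ₗ[R] Z) (α α' : TensorAlgebra R H →ₗ[R] X)
    (β : TensorAlgebra R H →ₗ[R] Y) : cup e m (α - α') β = cup e m α β - cup e m α' β := by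
  rw [sub_eq_add_neg, cup_add_left, cup_neg_left, sub_eq_add_neg]

lemma cup_sub_right (m : X →ₗ[R] Y →ₗ[R] Z) (α : TensorAlgebra R H →ₗ[R] X)
    (β β' : TensorAlgebra R H →ₗ[R] Y) : cup e m α (β - β') = cup e m α β - cup e m α β' := by
  rw [sub_eq_add_neg, cup_add_right, cup_neg_right, sub_eq_add_neg]

/-- Dual form of `splT_coder`: precomposition with a coderivation is a derivation of the convolution
product, where `sgn` records the passage of `D` over the left factor. -/
lemma cup_coder (m : X →ₗ[R] Y →ₗ[R] Z) (α : TensorAlgebra R H →ₗ[R] X)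
    (β : TensorAlgebra R H →ₗ[R] Y) {b : TensorAlgebra R H →ₗ[R] H} (hb : b 1 = 0) :
    cup e m α β ∘ₗ coder e dg b =
      cup e m (α ∘ₗ coder e dg b) β + cup e m (α ∘ₗ sgn e dg) (β ∘ₗ coder e dg b) :=
  ext_E (e := e) fun w => by
    rw [LinearMap.comp_apply, cup_eq, splT_coder e dg hb, splT_E, splT_E, LinearMap.add_apply,
      cup_E, cup_E]
    simp only [LinearMap.comp_apply, LinearMap.compl₁₂_apply]

lemma cup_sgn (m : X →ₗ[R] Y →ₗ[R] Z) (α : TensorAlgebra R H →ₗ[R] X)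
    (β : TensorAlgebra R H →ₗ[R] Y) :
    cup e m α β ∘ₗ sgn e dg = cup e m (α ∘ₗ sgn e dg) (β ∘ₗ sgn e dg) :=
  ext_E (e := e) fun w => by
    simp only [LinearMap.comp_apply, sgn_E, map_smul, cup_E, smul_spl, LinearMap.smul_apply]
    refine spl_congr fun u v huv => ?_
    rw [← huv, par_append, chi_add, mul_smul, smul_comm]

lemma cup_comap (m : X →ₗ[R] Y →ₗ[R] Z) (α : TensorAlgebra R H' →ₗ[R] X)
    (β : TensorAlgebra R H' →ₗ[R] Y) {G : TensorAlgebra R H →ₗ[R] H'} (hG : G 1 = 0) :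
    cup e' m α β ∘ₗ comap e G = cup e m (α ∘ₗ comap e G) (β ∘ₗ comap e G) :=
  ext_E (e := e) fun w => by
    rw [LinearMap.comp_apply, cup_eq, splT_comap e e' hG, cup_E]; rfl

lemma cup_assoc (m : X →ₗ[R] X →ₗ[R] X) (hm : ∀ x y z, m (m x y) z = m x (m y z))
    (α β γ : TensorAlgebra R H →ₗ[R] X) :
    cup e m (cup e m α β) γ = cup e m α (cup e m β γ) :=
  ext_E (e := e) fun w => by
    simp only [cup_E, map_spl]
    rw [spl_assoc]
    refine spl_congr fun u v _ => ?_
    rw [spl_apply]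
    simp only [hm]

end Words

/-! ### The shuffle product -/

section Shuffle

open TensorAlgebra

variable {R : Type*} [CommRing R] {H : Type*} [AddCommGroup H] [Module R H] {B : Type*}
  (e : Module.Basis B R H) (dg : B → ℤ)
  {X Y Z : Type*} [AddCommGroup X] [Module R X] [AddCommGroup Y] [Module R Y]
  [AddCommGroup Z] [Module R Z]

/-- The shuffle product of two words, with Koszul signs. -/
def sh : List B → List B → TensorAlgebra R H
  | [], y => E e y
  | a :: x, [] => E e (a :: x)
  | a :: x, b :: y => ι R (e a) * sh x (b :: y) +
      chi R ((dg b : ZMod 2) * par dg (a :: x)) • (ι R (e b) * sh (a :: x) y)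
termination_by x y => x.length + y.length

@[simp] lemma sh_nil_left (y : List B) : sh e dg [] y = E e y := by rw [sh]

@[simp] lemma sh_nil_right (x : List B) : sh e dg x [] = E e x := by
  cases x with
  | nil => simp
  | cons a x => rw [sh]

lemma sh_cons_cons (a b : B) (x y : List B) :
    sh e dg (a :: x) (b :: y) = ι R (e a) * sh e dg x (b :: y) +
      chi R ((dg b : ZMod 2) * par dg (a :: x)) • (ι R (e b) * sh e dg (a :: x) y) := by
  rw [sh]

/-- The shuffle product on the tensor algebra. -/
def shT : TensorAlgebra R H →ₗ[R] TensorAlgebra R H →ₗ[R] TensorAlgebra R H :=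
  lin e fun x => lin e (sh e dg x)

@[simp] lemma shT_E (x y : List B) : shT e dg (E e x) (E e y) = sh e dg x y := by
  rw [shT, lin_E, lin_E]

@[simp] lemma shT_one_left (y : TensorAlgebra R H) : shT e dg 1 y = y := by
  have : shT e dg 1 = LinearMap.id := ext_E (e := e) fun w => by
    rw [← E_nil e, shT_E]; simp
  rw [this]; rfl

@[simp] lemma shT_one_right (y : TensorAlgebra R H) : shT e dg y 1 = y := by
  have : (shT e dg).flip 1 = LinearMap.id := ext_E (e := e) fun w => by
    rw [← E_nil e, LinearMap.flip_apply, shT_E]; simp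
  rw [← LinearMap.flip_apply, this]; rfl

lemma sh_induction {p : List B → List B → Prop} (h1 : ∀ y, p [] y) (h2 : ∀ x, p x [])
    (h3 : ∀ a b x y, p x (b :: y) → p (a :: x) y → p (a :: x) (b :: y)) (x y : List B) : p x y := by
  induction x generalizing y with
  | nil => exact h1 y
  | cons a x ih =>
    induction y with
    | nil => exact h2 _
    | cons b y ih' => exact h3 a b x y (ih _) ih'

/-- The defining recursion of the shuffle product, extended from letters to homogeneous elements so
that it applies when a factor starts with `b(u)` or `G(u)`. -/
lemma shT_ι_mul_ι_mul {i j l : ℤ} {h k : H} (hh : h ∈ HD e dg i) (hk : k ∈ HD e dg j)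
    {x : TensorAlgebra R H} (hx : x ∈ TD e dg l) (y : TensorAlgebra R H) :
    shT e dg (ι R h * x) (ι R k * y) = ι R h * shT e dg x (ι R k * y) +
      chi R ((j : ZMod 2) * (i + l : ℤ)) • (ι R k * shT e dg (ι R h * x) y) := by
  induction y using word_induction (e := e) with
  | hE w =>
    refine HD_induction hh (fun a ha => ?_) (by simp) (fun x y hx hy => ?_) (fun c x hx => ?_)
    · refine HD_induction hk (fun b hb => ?_) (by simp) (fun x y hx hy => ?_) (fun c x hx => ?_)
      · refine TD_induction hx (fun x hx => ?_) (by simp) (fun x y hx hy => ?_) (fun c x hx => ?_)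
        · simp only [← E_cons, shT_E]
          rw [sh_cons_cons, par_cons, par, ha, hb, hx]
          simp
        · simp only [mul_add, map_add, LinearMap.add_apply, hx, hy, smul_add]; abel
        · simp only [mul_smul_comm, map_smul, LinearMap.smul_apply, hx, smul_add]
          rw [smul_comm c (chi R _)]
      · simp only [map_add, add_mul, mul_add, hx, hy, smul_add]; abel
      · simp only [map_smul, smul_mul_assoc, mul_smul_comm, hx, smul_add]
        rw [smul_comm c (chi R _)]
    · simp only [map_add, add_mul, mul_add, hx, hy, smul_add, LinearMap.add_apply]; abel
    · simp only [map_smul, smul_mul_assoc, mul_smul_comm, hx, smul_add, LinearMap.smul_apply]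
      rw [smul_comm c (chi R _)]
  | hadd x y hx hy => simp only [mul_add, map_add, hx, hy, smul_add]; abel
  | hsmul c x hx =>
    simp only [mul_smul_comm, map_smul, hx, smul_add]
    rw [smul_comm c (chi R _)]

lemma sh_mem_TD (x y : List B) : sh e dg x y ∈ TD e dg (wdeg dg x + wdeg dg y) := by
  induction x, y using sh_induction with
  | h1 y => simpa using mem_TD e dg y
  | h2 y => simpa using mem_TD e dg y
  | h3 a b x y h1 h2 =>
    rw [sh_cons_cons]
    refine add_mem ?_ (Submodule.smul_mem _ _ ?_)
    · convert ι_mul_mem_TD (mem_HD e dg a) h1 using 2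
      simp; ring
    · convert ι_mul_mem_TD (mem_HD e dg b) h2 using 2
      simp; ring

/-- Deconcatenation is multiplicative for the shuffle product. -/
lemma splT_sh (F : TensorAlgebra R H →ₗ[R] TensorAlgebra R H →ₗ[R] Z) (x y : List B) :
    splT e F (sh e dg x y) =
      spl (fun x₁ x₂ => spl (fun y₁ y₂ => chi R (par dg y₁ * par dg x₂) •
        F (sh e dg x₁ y₁) (sh e dg x₂ y₂)) y) x := by
  induction x, y using sh_induction generalizing F with
  | h1 y => simp [splT_E]
  | h2 y => simp [splT_E]
  | h3 a b x y h1 h2 =>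
    rw [sh_cons_cons, map_add, map_smul, splT_ι_mul, splT_ι_mul, h1, h2]
    simp only [spl_cons, spl_add, sh_nil_left, sh_nil_right, E_cons, par_nil, zero_mul, chi_zero,
      one_smul, sh_cons_cons, LinearMap.comp_apply, LinearMap.mulLeft_apply, map_add,
      LinearMap.add_apply, map_smul, LinearMap.smul_apply, smul_add, smul_spl, E_nil, smul_smul,
      ← chi_add]
    -- The terms already correspond; `e1` and `e2` match the Koszul signs of moving `b` to the front
    -- before and after the cut.
    have e1 : spl (fun u v => chi R (↑(dg b) * par dg (a :: x) + par dg u * par dg (a :: x)) •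
        F (ι R (e b) * E e u) (sh e dg (a :: x) v)) y =
        spl (fun u v => chi R (par dg (b :: u) * par dg (a :: x)) •
        F (ι R (e b) * E e u) (sh e dg (a :: x) v)) y := by
      refine spl_congr fun u v _ => ?_
      rw [par_cons dg b, add_mul]
    have e2 : spl (fun u v => spl (fun u_1 v_1 => chi R (↑(dg b) * par dg (a :: x) +
          par dg u_1 * par dg v) • F (ι R (e b) * sh e dg (a :: u) u_1) (sh e dg v v_1)) y) x =
        spl (fun u v => spl (fun u_1 v_1 => chi R (par dg (b :: u_1) * par dg v +
          ↑(dg b) * par dg (a :: u)) • F (ι R (e b) * sh e dg (a :: u) u_1) (sh e dg v v_1)) y)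
          x := by
      refine spl_congr fun u v huv => spl_congr fun u' v' _ => ?_
      congr 2
      rw [← huv]
      simp only [par_cons, par_append]
      ring
    rw [e1, e2]
    abel

/-- A linear map vanishes on the unit and on proper shuffles. -/
def ShZero (α : TensorAlgebra R H →ₗ[R] X) : Prop :=
  α 1 = 0 ∧ ∀ x y : List B, x ≠ [] → y ≠ [] → α (sh e dg x y) = 0

/-- Used for cuts of a shuffle product when the left tensor factor is killed by the unit and by
proper shuffles: then exactly one of the left parts is empty. -/
lemma spl_spl_of_vanish (K : List B → List B → List B → List B → Z) (x y : List B)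
    (h0 : ∀ x₂ y₂, K [] x₂ [] y₂ = 0)
    (h1 : ∀ x₁ x₂ y₁ y₂, x₁ ≠ [] → y₁ ≠ [] → K x₁ x₂ y₁ y₂ = 0) :
    spl (fun x₁ x₂ => spl (fun y₁ y₂ => K x₁ x₂ y₁ y₂) y) x =
      spl (fun x₁ x₂ => K x₁ x₂ [] y) x + spl (fun y₁ y₂ => K [] x y₁ y₂) y := by
  cases x with
  | nil => simp [h0]
  | cons a x =>
    rw [spl_cons, spl_cons, h0, zero_add, add_comm]
    congr 1
    refine spl_congr fun u v _ => ?_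
    refine spl_eq_left_nil fun u' v' _ hu' => h1 _ _ _ _ (by simp) hu'

lemma spl_spl_of_vanish' (K : List B → List B → List B → List B → Z) (x y : List B)
    (h0 : ∀ x₁ y₁, K x₁ [] y₁ [] = 0)
    (h1 : ∀ x₁ x₂ y₁ y₂, x₂ ≠ [] → y₂ ≠ [] → K x₁ x₂ y₁ y₂ = 0) :
    spl (fun x₁ x₂ => spl (fun y₁ y₂ => K x₁ x₂ y₁ y₂) y) x =
      spl (fun x₁ x₂ => K x₁ x₂ y []) x + spl (fun y₁ y₂ => K x [] y₁ y₂) y := by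
  have : ∀ x₁ x₂, spl (fun y₁ y₂ => K x₁ x₂ y₁ y₂) y =
      K x₁ x₂ y [] + if x₂ = [] then spl (fun y₁ y₂ => K x₁ [] y₁ y₂) y else 0 := by
    intro x₁ x₂
    split_ifs with h
    · rw [h, h0, zero_add]
    · rw [add_zero]
      exact spl_eq_right_nil fun u v _ hv => h1 _ _ _ _ h hv
  rw [spl_congr fun u v _ => this u v, spl_add]
  congr 1
  rw [spl_eq_right_nil]
  · simp
  · intro u v _ hv
    simp [hv]

lemma splT_sh_left {F : TensorAlgebra R H →ₗ[R] TensorAlgebra R H →ₗ[R] Z}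
    (hF : ShZero e dg F) (x y : List B) :
    splT e F (sh e dg x y) = spl (fun u v => F (E e u) (sh e dg v y)) x +
      spl (fun u v => chi R (par dg u * par dg x) • F (E e u) (sh e dg x v)) y := by
  rw [splT_sh, spl_spl_of_vanish]
  · simp only [par_nil, zero_mul, chi_zero, one_smul, sh_nil_right, sh_nil_left]
  · intro x₂ y₂; simp [hF.1]
  · intro x₁ x₂ y₁ y₂ hx hy; simp [hF.2 _ _ hx hy]

lemma splT_sh_right {F : TensorAlgebra R H →ₗ[R] TensorAlgebra R H →ₗ[R] Z}
    (hF : ShZero e dg F.flip) (x y : List B) :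
    splT e F (sh e dg x y) =
      spl (fun u v => chi R (par dg y * par dg v) • F (sh e dg u y) (E e v)) x +
      spl (fun u v => F (sh e dg x u) (E e v)) y := by
  rw [splT_sh, spl_spl_of_vanish']
  · simp only [par_nil, mul_zero, chi_zero, one_smul, sh_nil_right, sh_nil_left]
  · intro x₂ y₂; simp only [sh_nil_left, E_nil]; rw [← LinearMap.flip_apply, hF.1]; simp
  · intro x₁ x₂ y₁ y₂ hx hy; rw [← LinearMap.flip_apply, hF.2 _ _ hx hy]; simp

variable {e dg}

lemma ShZero.headMul {α : TensorAlgebra R H →ₗ[R] X} (h : ShZero e dg α)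
    (c : TensorAlgebra R H →ₗ[R] TensorAlgebra R X) : ShZero e dg (headMul α c) :=
  ⟨LinearMap.ext fun z => by simp [h.1], fun x y hx hy => LinearMap.ext fun z => by
    simp [h.2 x y hx hy]⟩

lemma ShZero.compl₁₂_left {α : TensorAlgebra R H →ₗ[R] X} (h : ShZero e dg α)
    (m : X →ₗ[R] Y →ₗ[R] Z) (β : TensorAlgebra R H →ₗ[R] Y) : ShZero e dg (m.compl₁₂ α β) :=
  ⟨LinearMap.ext fun z => by simp [h.1], fun x y hx hy => LinearMap.ext fun z => by
    simp [h.2 x y hx hy]⟩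

lemma ShZero.compl₁₂_right {β : TensorAlgebra R H →ₗ[R] Y} (h : ShZero e dg β)
    (m : X →ₗ[R] Y →ₗ[R] Z) (α : TensorAlgebra R H →ₗ[R] X) :
    ShZero e dg (m.compl₁₂ α β).flip :=
  ⟨LinearMap.ext fun z => by simp [h.1], fun x y hx hy => LinearMap.ext fun z => by
    simp [h.2 x y hx hy]⟩

lemma ShZero.add {α β : TensorAlgebra R H →ₗ[R] X} (hα : ShZero e dg α) (hβ : ShZero e dg β) :
    ShZero e dg (α + β) :=
  ⟨by simp [hα.1, hβ.1], fun x y hx hy => by simp [hα.2 x y hx hy, hβ.2 x y hx hy]⟩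

lemma ShZero.neg {α : TensorAlgebra R H →ₗ[R] X} (hα : ShZero e dg α) : ShZero e dg (-α) :=
  ⟨by simp [hα.1], fun x y hx hy => by simp [hα.2 x y hx hy]⟩

lemma ShZero.sub {α β : TensorAlgebra R H →ₗ[R] X} (hα : ShZero e dg α) (hβ : ShZero e dg β) :
    ShZero e dg (α - β) :=
  ⟨by simp [hα.1, hβ.1], fun x y hx hy => by simp [hα.2 x y hx hy, hβ.2 x y hx hy]⟩

lemma ShZero.comp {α : TensorAlgebra R H →ₗ[R] X} (hα : ShZero e dg α) (f : X →ₗ[R] Y) :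
    ShZero e dg (f ∘ₗ α) :=
  ⟨by simp [hα.1], fun x y hx hy => by simp [hα.2 x y hx hy]⟩

lemma ShZero.shT {α : TensorAlgebra R H →ₗ[R] X} (hα : ShZero e dg α) {x y : TensorAlgebra R H}
    (hx : aug e x = 0) (hy : aug e y = 0) : α (shT e dg x y) = 0 := by
  -- Both sides are bilinear in `x` and `y`, so words suffice; the terms with `aug` account for
  -- empty words.
  have key : α (CInf.shT e dg x y) + aug e x • aug e y • α 1 = aug e x • α y + aug e y • α x := by
    clear hx hy
    induction x using word_induction (e := e) with
    | hE x =>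
      induction y using word_induction (e := e) with
      | hE y =>
        rw [shT_E, aug, lin_E, lin_E]
        by_cases hx : x = []
        · by_cases hy : y = []
          · simp [hx, hy]
          · simp [hx, hy]
        · by_cases hy : y = []
          · simp [hx, hy]
          · simp [hx, hy, hα.2 x y hx hy]
      | hadd x y hx hy =>
        simp only [map_add, smul_add, add_smul]
        rw [add_add_add_comm, hx, hy]; abel
      | hsmul c x hx =>
        simp only [map_smul, smul_eq_mul, mul_smul] at hx ⊢
        rw [smul_comm _ c, ← smul_add, hx, smul_comm _ c, smul_add]
    | hadd x y hx hy =>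
      simp only [map_add, smul_add, add_smul, LinearMap.add_apply]
      rw [add_add_add_comm, hx, hy]; abel
    | hsmul c x hx =>
      simp only [map_smul, smul_eq_mul, mul_smul, LinearMap.smul_apply] at hx ⊢
      rw [← smul_add, hx, smul_comm _ c, smul_add]
  simpa [hx, hy, hα.1] using key

variable (e dg)

lemma shT_headOp_left {b : TensorAlgebra R H →ₗ[R] H}
    (hdeg : ∀ w, b (E e w) ∈ HD e dg (wdeg dg w + 1)) (x : List B) (c : B)
    (z : TensorAlgebra R H) :
    shT e dg (headOp e b (E e x)) (ι R (e c) * z) =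
      spl (fun u v => ι R (b (E e u)) * shT e dg (E e v) (ι R (e c) * z)) x +
      chi R ((dg c : ZMod 2) * (par dg x + 1)) •
          (ι R (e c) * shT e dg (headOp e b (E e x)) z) := by
  rw [headOp_E]
  simp only [map_spl, spl_apply, mul_spl, smul_spl]
  rw [← spl_add]
  refine spl_congr fun u v huv => ?_
  rw [shT_ι_mul_ι_mul e dg (hdeg u) (mem_HD e dg c) (mem_TD e dg v), ← huv]
  push_cast
  rw [par_append, par, par]
  ring_nf

lemma shT_headOp_right {b : TensorAlgebra R H →ₗ[R] H}
    (hdeg : ∀ w, b (E e w) ∈ HD e dg (wdeg dg w + 1)) (a : B) {x : TensorAlgebra R H} {l : ℤ}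
    (hx : x ∈ TD e dg l) (y : List B) :
    shT e dg (ι R (e a) * x) (headOp e b (E e y)) =
      spl (fun u v => chi R ((par dg u + 1) * (dg a + l : ℤ)) •
        (ι R (b (E e u)) * shT e dg (ι R (e a) * x) (E e v))) y +
      ι R (e a) * shT e dg x (headOp e b (E e y)) := by
  rw [headOp_E]
  simp only [map_spl, mul_spl]
  rw [← spl_add]
  refine spl_congr fun u v huv => ?_
  rw [shT_ι_mul_ι_mul e dg (mem_HD e dg a) (hdeg u) hx, add_comm]
  push_cast
  rfl

/-- A coderivation whose corestriction vanishes on shuffles is a derivation of the shuffle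
product. -/
lemma coder_sh {b : TensorAlgebra R H →ₗ[R] H} (hb : ShZero e dg b)
    (hdeg : ∀ w, b (E e w) ∈ HD e dg (wdeg dg w + 1)) (x y : List B) :
    coder e dg b (sh e dg x y) = shT e dg (coder e dg b (E e x)) (E e y) +
      chi R (par dg x) • shT e dg (E e x) (coder e dg b (E e y)) := by
  induction x, y using sh_induction with
  | h1 y => simp
  | h2 y => simp
  | h3 a c x y h1 h2 =>
    -- The only place where `hb` is needed: an initial segment of the shuffle contributes only if it
    -- comes from one of the two words alone.
    have hP : headOp e b (sh e dg (a :: x) (c :: y)) = _ :=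
      splT_sh_left e dg (hb.headMul LinearMap.id) (a :: x) (c :: y)
    simp only [headMul_apply, LinearMap.id_apply] at hP
    have hL : coder e dg b (sh e dg (a :: x) (c :: y)) =
        headOp e b (sh e dg (a :: x) (c :: y)) +
        chi R (dg a : ZMod 2) • (ι R (e a) * coder e dg b (sh e dg x (c :: y))) +
        chi R ((dg c : ZMod 2) * par dg (a :: x)) •
          chi R (dg c : ZMod 2) • (ι R (e c) * coder e dg b (sh e dg (a :: x) y)) := by
      rw [sh_cons_cons, map_add, map_smul, coder_cons, coder_cons, map_add, map_smul, smul_add]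
      abel
    have hA := shT_headOp_left e dg hdeg (a :: x) c (E e y)
    have hB := shT_headOp_right e dg hdeg a (mem_TD e dg x) (c :: y)
    have hC := shT_ι_mul_ι_mul e dg (mem_HD e dg a) (mem_HD e dg c) (coder_mem_TD e dg hdeg x)
      (E e y)
    have hD := shT_ι_mul_ι_mul e dg (mem_HD e dg a) (mem_HD e dg c) (mem_TD e dg x)
      (coder e dg b (E e y))
    simp only [← E_cons, shT_E] at hA hB hC hD
    have hX : coder e dg b (E e (a :: x)) = headOp e b (E e (a :: x)) +
        chi R (dg a : ZMod 2) • (ι R (e a) * coder e dg b (E e x)) := by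
      rw [E_cons, coder_cons]
    have hY : coder e dg b (E e (c :: y)) = headOp e b (E e (c :: y)) +
        chi R (dg c : ZMod 2) • (ι R (e c) * coder e dg b (E e y)) := by
      rw [E_cons, coder_cons]
    have s1 : spl (fun u v => chi R (par dg u * par dg (a :: x)) •
          (ι R (b (E e u)) * sh e dg (a :: x) v)) (c :: y) =
        chi R (par dg (a :: x)) • spl (fun u v => chi R ((par dg u + 1) * (dg a + wdeg dg x : ℤ)) •
          (ι R (b (E e u)) * sh e dg (a :: x) v)) (c :: y) := by
      rw [smul_spl]
      refine spl_congr fun u v _ => ?_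
      rw [smul_smul, ← chi_add]
      congr 2
      simp only [wdeg_cons, par]
      push_cast
      linear_combination (-(dg a : ZMod 2) - wdeg dg x) * (by decide : (2 : ZMod 2) = 0)
    have c1 : ((dg a + (wdeg dg x + 1) : ℤ) : ZMod 2) = par dg (a :: x) + 1 := by
      rw [par_cons, par]; push_cast; ring
    have c2 : ((dg a + wdeg dg x : ℤ) : ZMod 2) = par dg (a :: x) := by
      rw [par_cons, par]; push_cast; ring
    have hR1 := congrArg (fun z => shT e dg z (E e (c :: y))) hX
    have hR2 := congrArg (fun z => shT e dg (E e (a :: x)) z) hY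
    have hR3 := congrArg (fun z => ι R (e c) * shT e dg z (E e y)) hX
    have hR4 := congrArg (fun z => ι R (e a) * shT e dg (E e x) z) hY
    simp only [map_add, map_smul, LinearMap.add_apply, LinearMap.smul_apply, mul_add,
      mul_smul_comm] at hR1 hR2 hR3 hR4
    rw [c1, mul_add, mul_one, chi_add] at hC
    rw [mul_add, mul_one, chi_add] at hA
    rw [c2] at hD
    rw [hR1, hR2, hA, hB, hC, hD, hL, hP, s1, h1, h2]
    simp only [mul_add, smul_add, mul_smul_comm, hR3, hR4]
    rw [par_cons dg a x, chi_add R (dg a : ZMod 2)]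
    module

variable {H' : Type*} [AddCommGroup H'] [Module R H'] {B' : Type*}
  (e' : Module.Basis B' R H') (dg' : B' → ℤ)

/-- A coalgebra map whose corestriction vanishes on shuffles is multiplicative for the shuffle
product. -/
lemma comap_sh {G : TensorAlgebra R H →ₗ[R] H'} (hG : ShZero e dg G)
    (hdeg : ∀ w, G (E e w) ∈ HD e' dg' (wdeg dg w)) (x y : List B) :
    comap e G (sh e dg x y) = shT e' dg' (comap e G (E e x)) (comap e G (E e y)) := by
  induction hn : x.length + y.length using Nat.strong_induction_on generalizing x y with
  | _ n ih =>
    subst hn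
    rcases eq_or_ne x [] with rfl | hx
    · simp
    rcases eq_or_ne y [] with rfl | hy
    · simp
    have haug : aug e (sh e dg x y) = 0 := by
      obtain ⟨a, x, rfl⟩ := List.exists_cons_of_ne_nil hx
      obtain ⟨b, y, rfl⟩ := List.exists_cons_of_ne_nil hy
      rw [sh_cons_cons]
      simp
    have hL := comap_eq e hG.1 (sh e dg x y)
    rw [haug, zero_smul, zero_add, splT_sh_left e dg (hG.headMul (comap e G))] at hL
    simp only [headMul_apply] at hL
    -- Expand both factors by their first blocks. The first letter of the shuffle is one of these
    -- two blocks, and the remaining sum reassembles the other factor.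
    have hsum : shT e' dg' (comap e G (E e x)) (comap e G (E e y)) =
        spl (fun u v => ι R (G (E e u)) * shT e' dg' (comap e G (E e v)) (comap e G (E e y))) x +
        spl (fun u v => chi R (par dg u * par dg x) •
          (ι R (G (E e u)) * shT e' dg' (comap e G (E e x)) (comap e G (E e v)))) y := by
      have hx1 := comap_E e hG.1 hx
      have hy1 := comap_E e hG.1 hy
      have key : shT e' dg' (comap e G (E e x)) (comap e G (E e y)) =
          spl (fun u v => spl (fun u' v' =>
            ι R (G (E e u)) * shT e' dg' (comap e G (E e v))
              (ι R (G (E e u')) * comap e G (E e v')) +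
            chi R (par dg u' * par dg x) • (ι R (G (E e u')) *
              shT e' dg' (ι R (G (E e u)) * comap e G (E e v)) (comap e G (E e v')))) y) x := by
        rw [hx1, hy1]
        simp only [map_spl, spl_apply]
        rw [spl_comm]
        refine spl_congr fun u v huv => spl_congr fun u' v' _ => ?_
        rw [shT_ι_mul_ι_mul e' dg' (hdeg u) (hdeg u') (comap_mem_TD e dg e' dg' hG.1 hdeg v), ← huv]
        push_cast
        rw [par_append]
        rfl
      rw [key]
      simp only [spl_add, ← mul_spl, ← map_spl, ← hy1]
      congr 1
      rw [spl_comm]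
      refine spl_congr fun u v _ => ?_
      rw [← smul_spl, ← mul_spl]
      simp only [← spl_apply, ← map_spl, ← hx1]
    rw [hL, hsum]
    congr 1
    · refine spl_congr ?_
      rintro (_ | ⟨c, u⟩) v huv
      · simp [hG.1]
      · rw [ih _ _ v y rfl]
        have := congrArg List.length huv
        simp at this ⊢; omega
    · refine spl_congr ?_
      rintro (_ | ⟨c, u⟩) v huv
      · simp [hG.1]
      · rw [ih _ _ x v rfl]
        have := congrArg List.length huv
        simp at this ⊢; omega

end Shuffle

/-! ### Locality with respect to the length of words -/

section Length

open TensorAlgebra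

variable {R : Type*} [CommRing R] {H : Type*} [AddCommGroup H] [Module R H] {B : Type*}
  (e : Module.Basis B R H) (dg : B → ℤ)
  {X Y Z : Type*} [AddCommGroup X] [Module R X] [AddCommGroup Y] [Module R Y]
  [AddCommGroup Z] [Module R Z]

/-- The span of the words of length less than `n`. -/
def TLt (n : ℕ) : Submodule R (TensorAlgebra R H) := Submodule.span R (E e '' {w | w.length < n})

/-- The span of the words of length `n` and degree `k`. -/
def TG (n : ℕ) (k : ℤ) : Submodule R (TensorAlgebra R H) :=
  Submodule.span R (E e '' {w | w.length = n ∧ wdeg dg w = k})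

variable {e dg}

lemma mem_TLt {w : List B} {n : ℕ} (h : w.length < n) : E e w ∈ TLt e n :=
  Submodule.subset_span ⟨w, h, rfl⟩

lemma mem_TG {w : List B} {n : ℕ} {k : ℤ} (h : w.length = n) (h' : wdeg dg w = k) :
    E e w ∈ TG e dg n k :=
  Submodule.subset_span ⟨w, ⟨h, h'⟩, rfl⟩

lemma TLt_mono {m n : ℕ} (h : m ≤ n) : TLt e m ≤ TLt e n :=
  Submodule.span_mono (Set.image_mono fun _ hw => lt_of_lt_of_le hw h)

lemma ι_mul_mem_TLt {n : ℕ} (h : H) {z : TensorAlgebra R H} (hz : z ∈ TLt e n) :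
    ι R h * z ∈ TLt e (n + 1) := by
  have hh := e.mem_span h
  induction hh using Submodule.span_induction with
  | mem x hx =>
    obtain ⟨a, rfl⟩ := hx
    induction hz using Submodule.span_induction with
    | mem x hx =>
      obtain ⟨w, hw, rfl⟩ := hx
      rw [← E_cons]
      exact mem_TLt (by simpa using hw)
    | zero => simp
    | add x y _ _ hx hy => rw [mul_add]; exact add_mem hx hy
    | smul c x _ hx => rw [mul_smul_comm]; exact Submodule.smul_mem _ _ hx
  | zero => simp
  | add x y _ _ hx hy => rw [map_add, add_mul]; exact add_mem hx hy
  | smul c x _ hx => rw [map_smul, smul_mul_assoc]; exact Submodule.smul_mem _ _ hx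

lemma ι_mul_mem_TG {n : ℕ} {k : ℤ} (a : B) {z : TensorAlgebra R H} (hz : z ∈ TG e dg n k) :
    ι R (e a) * z ∈ TG e dg (n + 1) (dg a + k) := by
  induction hz using Submodule.span_induction with
  | mem x hx =>
    obtain ⟨w, ⟨hw, hk⟩, rfl⟩ := hx
    rw [← E_cons]
    exact mem_TG (by simpa using hw) (by simpa using hk)
  | zero => simp
  | add x y _ _ hx hy => rw [mul_add]; exact add_mem hx hy
  | smul c x _ hx => rw [mul_smul_comm]; exact Submodule.smul_mem _ _ hx

variable (e dg) in
lemma sh_mem_TG (x y : List B) :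
    sh e dg x y ∈ TG e dg (x.length + y.length) (wdeg dg x + wdeg dg y) := by
  induction x, y using sh_induction with
  | h1 y => rw [sh_nil_left]; exact mem_TG (by simp) (by simp)
  | h2 y => rw [sh_nil_right]; exact mem_TG (by simp) (by simp)
  | h3 a b x y h1 h2 =>
    rw [sh_cons_cons]
    refine add_mem ?_ (Submodule.smul_mem _ _ ?_)
    · convert ι_mul_mem_TG a h1 using 2
      · simp; ring
      · simp; ring
    · convert ι_mul_mem_TG b h2 using 2
      · simp; ring
      · simp; ring

/-- Modifying the values of a linear map by operators that depend only on length and degree. -/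
lemma lin_of_mem_TG (P : ℕ → ℤ → X →ₗ[R] Y) (α : TensorAlgebra R H →ₗ[R] X) {n : ℕ} {k : ℤ}
    {z : TensorAlgebra R H} (hz : z ∈ TG e dg n k) :
    lin e (fun w => P w.length (wdeg dg w) (α (E e w))) z = P n k (α z) := by
  induction hz using Submodule.span_induction with
  | mem x hx => obtain ⟨w, ⟨hw, hk⟩, rfl⟩ := hx; rw [lin_E, hw, hk]
  | zero => simp
  | add x y _ _ hx hy => simp only [map_add, hx, hy]
  | smul c x _ hx => simp only [map_smul, hx]

/-- A shuffle of two words is homogeneous in length and degree, so a single operator `P n k` acts on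
its value. This permits truncation by length and projection to the correct degree. -/
lemma ShZero.lin {α : TensorAlgebra R H →ₗ[R] X} (hα : ShZero e dg α)
    (P : ℕ → ℤ → X →ₗ[R] Y) :
    ShZero e dg (lin e fun w => P w.length (wdeg dg w) (α (E e w))) :=
  ⟨by rw [← E_nil e, lin_E, E_nil, hα.1, map_zero], fun x y hx hy => by
    rw [lin_of_mem_TG P α (sh_mem_TG e dg x y), hα.2 x y hx hy, map_zero]⟩

/-- The part of a linear map that lives on words of length `n`. -/
def trunc (e : Module.Basis B R H) (n : ℕ) (α : TensorAlgebra R H →ₗ[R] X) :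
    TensorAlgebra R H →ₗ[R] X :=
  lin e fun w => if w.length = n then α (E e w) else 0

lemma trunc_E (n : ℕ) (α : TensorAlgebra R H →ₗ[R] X) (w : List B) :
    trunc e n α (E e w) = if w.length = n then α (E e w) else 0 := by
  rw [trunc, lin_E]

lemma ShZero.trunc {α : TensorAlgebra R H →ₗ[R] X} (hα : ShZero e dg α) (n : ℕ) :
    ShZero e dg (trunc e n α) := by
  have := hα.lin fun l _ => if l = n then LinearMap.id else (0 : X →ₗ[R] X)
  convert this using 1
  refine ext_E (e := e) fun w => ?_
  rw [trunc_E, lin_E]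
  split_ifs <;> rfl

lemma trunc_vanishBelow (n : ℕ) (α : TensorAlgebra R H →ₗ[R] X) :
    VanishBelow e n (CInf.trunc e n α) := fun w hw => by
  rw [trunc_E, if_neg hw.ne]

lemma VanishBelow.of_mem {n : ℕ} {α : TensorAlgebra R H →ₗ[R] X} (h : VanishBelow e n α)
    {z : TensorAlgebra R H} (hz : z ∈ TLt e n) : α z = 0 := by
  induction hz using Submodule.span_induction with
  | mem x hx => obtain ⟨w, hw, rfl⟩ := hx; exact h w hw
  | zero => simp
  | add x y _ _ hx hy => rw [map_add, hx, hy, add_zero]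
  | smul c x _ hx => rw [map_smul, hx, smul_zero]

lemma VanishBelow.mono {m n : ℕ} {α : TensorAlgebra R H →ₗ[R] X} (h : VanishBelow e n α)
    (hmn : m ≤ n) : VanishBelow e m α := fun w hw => h w (hw.trans_le hmn)

lemma VanishBelow.add {n : ℕ} {α β : TensorAlgebra R H →ₗ[R] X} (h : VanishBelow e n α)
    (h' : VanishBelow e n β) : VanishBelow e n (α + β) := fun w hw => by
  rw [LinearMap.add_apply, h w hw, h' w hw, add_zero]

lemma length_lt_left {u v w : List B} (h : u ++ v = w) (hv : v ≠ []) : u.length < w.length := by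
  have := List.length_pos_iff.2 hv
  rw [← h, List.length_append]; omega

lemma length_lt_right {u v w : List B} (h : u ++ v = w) (hu : u ≠ []) : v.length < w.length := by
  have := List.length_pos_iff.2 hu
  rw [← h, List.length_append]; omega

lemma cup_vanish_left {n : ℕ} (m : X →ₗ[R] Y →ₗ[R] Z) {α : TensorAlgebra R H →ₗ[R] X}
    (hα : VanishBelow e n α) {β : TensorAlgebra R H →ₗ[R] Y} (hβ : β 1 = 0) {w : List B}
    (hw : w.length ≤ n) : cup e m α β (E e w) = 0 := by
  rw [cup_E, spl_eq_right_nil]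
  · simp [hβ]
  · intro u v huv hv
    rw [hα u ((length_lt_left huv hv).trans_le hw), map_zero, LinearMap.zero_apply]

lemma cup_vanish_right {n : ℕ} (m : X →ₗ[R] Y →ₗ[R] Z) {α : TensorAlgebra R H →ₗ[R] X}
    (hα : α 1 = 0) {β : TensorAlgebra R H →ₗ[R] Y} (hβ : VanishBelow e n β) {w : List B}
    (hw : w.length ≤ n) : cup e m α β (E e w) = 0 := by
  rw [cup_E, spl_eq_left_nil]
  · simp [hα]
  · intro u v huv hu
    rw [hβ v ((length_lt_right huv hu).trans_le hw), map_zero]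

variable (dg) in
lemma VanishBelow.comp_sgn {n : ℕ} {α : TensorAlgebra R H →ₗ[R] X} (h : VanishBelow e n α) :
    VanishBelow e n (α ∘ₗ sgn e dg) := fun w hw => by
  rw [LinearMap.comp_apply, sgn_E, map_smul, h w hw, smul_zero]

lemma headOp_vanish {n : ℕ} {δ : TensorAlgebra R H →ₗ[R] H} (hδ : VanishBelow e n δ) {w : List B}
    (hw : w.length ≤ n) : headOp e δ (E e w) = ι R (δ (E e w)) := by
  rw [headOp_E, spl_eq_right_nil]
  · simp
  · intro u v huv hv
    rw [hδ u ((length_lt_left huv hv).trans_le hw), map_zero, zero_mul]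

variable (dg) in
lemma coder_vanish {n : ℕ} {δ : TensorAlgebra R H →ₗ[R] H} (hδ : VanishBelow e n δ) (h1 : δ 1 = 0) :
    ∀ w : List B, w.length ≤ n → coder e dg δ (E e w) = ι R (δ (E e w))
  | [], _ => by simp [h1]
  | a :: w, hw => by
    have hw' : w.length < n := by simpa using hw
    rw [E_cons, coder_cons, ← E_cons, headOp_vanish hδ hw, coder_vanish hδ h1 w hw'.le, hδ w hw']
    simp

lemma coder_add (b δ : TensorAlgebra R H →ₗ[R] H) :
    coder e dg (b + δ) = coder e dg b + coder e dg δ := by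
  refine ext_E (e := e) fun w => ?_
  induction w with
  | nil => simp
  | cons a w ih =>
    rw [E_cons, LinearMap.add_apply, coder_cons, coder_cons, coder_cons, ih, ← E_cons, headOp_E,
      headOp_E, headOp_E]
    simp only [LinearMap.add_apply, map_add, add_mul, spl_add, mul_add, smul_add]
    abel

/-- If `b` vanishes on words of length at most one, `coder e dg b` decreases the length. -/
lemma coder_mem_TLt {b : TensorAlgebra R H →ₗ[R] H} (hb : VanishBelow e 2 b) :
    ∀ w : List B, coder e dg b (E e w) ∈ TLt e w.length
  | [] => by simp
  | a :: w => by
    rw [E_cons, coder_cons, ← E_cons, headOp_E]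
    refine add_mem (spl_mem _ fun u v huv => ?_)
      (Submodule.smul_mem _ _ (ι_mul_mem_TLt _ (coder_mem_TLt hb w)))
    by_cases hu : u.length < 2
    · rw [hb u hu]; simp
    · refine TLt_mono (m := v.length + 1 + 1) ?_ (ι_mul_mem_TLt _ (mem_TLt (Nat.lt_succ_self _)))
      have := congrArg List.length huv
      simp at this ⊢; omega

/-- To leading order the coalgebra map is linear in its corestriction: on words of length at most
`n`, a block on which `δ` does not vanish must be the whole word. -/
lemma comap_add_vanish {n : ℕ} {G δ : TensorAlgebra R H →ₗ[R] X} (hG : G 1 = 0)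
    (h1 : δ 1 = 0) (hδ : VanishBelow e n δ) (w : List B) (hw : w.length ≤ n) :
    comap e (G + δ) (E e w) = comap e G (E e w) + ι R (δ (E e w)) := by
  induction hn : w.length using Nat.strong_induction_on generalizing w with
  | _ k ih =>
    subst hn
    rcases eq_or_ne w [] with rfl | hne
    · simp [h1]
    rw [comap_E e (by simp [hG, h1]) hne, comap_E e hG hne]
    have : ∀ u v, u ++ v = w → ι R ((G + δ) (E e u)) * comap e (G + δ) (E e v) =
        ι R (G (E e u)) * comap e G (E e v) + ι R (δ (E e u)) * comap e G (E e v) := by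
      rintro u v huv
      rcases eq_or_ne u [] with rfl | hu
      · simp [hG, h1]
      · have hlt := length_lt_right huv hu
        rw [ih _ hlt v (by omega) rfl, hδ v (by omega)]
        simp [add_mul]
    rw [spl_congr this, spl_add]
    congr 1
    rw [spl_eq_right_nil]
    · simp
    · intro u v huv hv
      rw [hδ u ((length_lt_left huv hv).trans_le hw), map_zero, zero_mul]

/-- Limits of sequences of pairs of linear maps that become stationary on each word. -/
lemma exists_limit (P : ℕ → (TensorAlgebra R H →ₗ[R] X) → (TensorAlgebra R H →ₗ[R] Y) → Prop)
    (n₀ : ℕ) (α₀ : TensorAlgebra R H →ₗ[R] X) (β₀ : TensorAlgebra R H →ₗ[R] Y) (h₀ : P n₀ α₀ β₀)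
    (step : ∀ n α β, n₀ ≤ n → P n α β → ∃ α' β', P (n + 1) α' β' ∧
      VanishBelow e (n + 1) (α' - α) ∧ VanishBelow e (n + 1) (β' - β)) :
    ∃ α β, ∀ n, n₀ ≤ n → ∃ αn βn, P n αn βn ∧ VanishBelow e (n + 1) (α - αn) ∧
      VanishBelow e (n + 1) (β - βn) := by
  choose! f g hP hf hg using step
  let s : ℕ → (TensorAlgebra R H →ₗ[R] X) × (TensorAlgebra R H →ₗ[R] Y) := fun k =>
    Nat.rec (α₀, β₀) (fun k p => (f (n₀ + k) p.1 p.2, g (n₀ + k) p.1 p.2)) k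
  have hs : ∀ k, P (n₀ + k) (s k).1 (s k).2 := by
    intro k
    induction k with
    | zero => exact h₀
    | succ k ih => exact hP _ _ _ (Nat.le_add_right _ _) ih
  have h1 : ∀ k j, VanishBelow e (n₀ + k + 1) ((s (k + j)).1 - (s k).1) := by
    intro k j
    induction j with
    | zero => intro w _; simp
    | succ j ih =>
      intro w hw
      have := hf (n₀ + (k + j)) _ _ (by omega) (hs (k + j)) w (by omega)
      have h2 := ih w hw
      rw [LinearMap.sub_apply, sub_eq_zero] at this h2 ⊢
      exact this.trans h2
  have h2 : ∀ k j, VanishBelow e (n₀ + k + 1) ((s (k + j)).2 - (s k).2) := by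
    intro k j
    induction j with
    | zero => intro w _; simp
    | succ j ih =>
      intro w hw
      have := hg (n₀ + (k + j)) _ _ (by omega) (hs (k + j)) w (by omega)
      have h2 := ih w hw
      rw [LinearMap.sub_apply, sub_eq_zero] at this h2 ⊢
      exact this.trans h2
  -- Stage `n` is final on words of length at most `n`, so `w` is evaluated at index `w.length -
  -- n₀`, that is, at stage `max n₀ w.length`.
  refine ⟨lin e fun w => (s (w.length - n₀)).1 (E e w), lin e fun w => (s (w.length - n₀)).2 (E e w),
    fun n hn => ⟨(s (n - n₀)).1, (s (n - n₀)).2, ?_, ?_, ?_⟩⟩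
  · have := hs (n - n₀)
    rwa [Nat.add_sub_cancel' hn] at this
  · intro w hw
    have := h1 (w.length - n₀) (n - n₀ - (w.length - n₀)) w (by omega)
    rw [LinearMap.sub_apply, sub_eq_zero] at this
    rw [LinearMap.sub_apply, lin_E, sub_eq_zero, ← this]
    congr 3
    omega
  · intro w hw
    have := h2 (w.length - n₀) (n - n₀ - (w.length - n₀)) w (by omega)
    rw [LinearMap.sub_apply, sub_eq_zero] at this
    rw [LinearMap.sub_apply, lin_E, sub_eq_zero, ← this]
    congr 3
    omega

end Length

/-! ### Lifting along surjections, compatibly with shuffles -/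

section Lift

open TensorAlgebra

variable {R : Type*} [CommRing R] {H : Type*} [AddCommGroup H] [Module R H]
  {B : Type*} (e : Module.Basis B R H) (dg : B → ℤ)
  {X Y : Type*} [AddCommGroup X] [Module R X] [AddCommGroup Y] [Module R Y]

lemma lin_ι_mul {S : Type*} [CommRing S] {K : Type*} [AddCommGroup K] [Module S K]
    (e : Module.Basis B S K) [Module S X] (φ : List B → X) (a : B) (z : TensorAlgebra S K) :
    lin e φ (ι S (e a) * z) = lin e (fun w => φ (a :: w)) z := by
  induction z using word_induction (e := e) with
  | hE w => rw [← E_cons, lin_E, lin_E]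
  | hadd x y hx hy => simp only [mul_add, map_add, hx, hy]
  | hsmul c x hx => simp only [mul_smul_comm, map_smul, hx]

/-- Shuffle products have integer coefficients in the basis of words, so a function on words takes
the same value on them over `ℚ` and over `R`. -/
lemma lin_sh_baseChange [Module ℚ X] {K : Type*} [AddCommGroup K] [Module ℚ K]
    (e₀ : Module.Basis B ℚ K) (φ : List B → X) (x y : List B) :
    lin e₀ φ (sh e₀ dg x y) = lin e φ (sh e dg x y) := by
  have hchi : ∀ (i : ZMod 2) (x : X), chi ℚ i • x = chi R i • x := by
    intro i x
    unfold chi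
    split_ifs <;> simp
  induction x, y using sh_induction generalizing φ with
  | h1 y => simp
  | h2 x => simp
  | h3 a b x y h1 h2 =>
    rw [sh_cons_cons, sh_cons_cons, map_add, map_smul, map_add, map_smul, hchi, lin_ι_mul,
      lin_ι_mul, lin_ι_mul, lin_ι_mul, h1, h2]

/-- Over a `ℚ`-algebra, a map that vanishes on shuffles lifts along a linear map onto its values
to a map that vanishes on shuffles. -/
lemma exists_lift [Algebra ℚ R] (d : X →ₗ[R] Y) {α : TensorAlgebra R H →ₗ[R] Y} (hα : ShZero e dg α)
    (hr : ∀ w, α (E e w) ∈ LinearMap.range d) :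
    ∃ β : TensorAlgebra R H →ₗ[R] X, ShZero e dg β ∧ d ∘ₗ β = α := by
  let _ : Module ℚ X := Module.compHom X (algebraMap ℚ R)
  let _ : Module ℚ Y := Module.compHom Y (algebraMap ℚ R)
  have : IsScalarTower ℚ R X := IsScalarTower.of_compHom ℚ R X
  have : IsScalarTower ℚ R Y := IsScalarTower.of_compHom ℚ R Y
  let e₀ : Module.Basis B ℚ (B →₀ ℚ) := Finsupp.basisSingleOne
  let S : Submodule ℚ (TensorAlgebra ℚ (B →₀ ℚ)) :=
    Submodule.span ℚ ({z | ∃ x y : List B, x ≠ [] ∧ y ≠ [] ∧ z = sh e₀ dg x y} ∪ {1})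
  let α₀ : TensorAlgebra ℚ (B →₀ ℚ) →ₗ[ℚ] LinearMap.range (d.restrictScalars ℚ) :=
    lin e₀ fun w => ⟨α (E e w), hr w⟩
  have hα₀ : ∀ z, ((α₀ z : LinearMap.range (d.restrictScalars ℚ)) : Y) =
      lin e₀ (fun w => α (E e w)) z := by
    intro z
    induction z using word_induction (e := e₀) with
    | hE w => rw [lin_E, lin_E]
    | hadd x y hx hy => simp only [map_add, Submodule.coe_add, hx, hy]
    | hsmul c x hx => simp only [map_smul, Submodule.coe_smul, hx]
  have hS : S ≤ LinearMap.ker α₀ := by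
    refine Submodule.span_le.2 ?_
    rintro _ (⟨x, y, hx, hy, rfl⟩ | rfl)
    · refine Subtype.ext ?_
      rw [hα₀, lin_sh_baseChange e, lin_eq, hα.2 x y hx hy]
      rfl
    · refine Subtype.ext ?_
      rw [hα₀, ← E_nil e₀, lin_E, E_nil, hα.1]
      rfl
  -- The quotient by `S` is a vector space over `ℚ`, hence projective. The lift found there has
  -- values on words only; these define an `R`-linear map because words form an `R`-basis.
  obtain ⟨h, hh⟩ := Module.projective_lifting_property (d.restrictScalars ℚ).rangeRestrict
    (S.liftQ α₀ hS) (LinearMap.surjective_rangeRestrict _)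
  have key : ∀ z, lin e₀ (fun w => h (S.mkQ (E e₀ w))) z = h (S.mkQ z) := fun z =>
    LinearMap.congr_fun (lin_eq e₀ (h ∘ₗ S.mkQ)) z
  refine ⟨lin e fun w => h (S.mkQ (E e₀ w)), ⟨?_, fun x y hx hy => ?_⟩, ext_E (e := e) fun w => ?_⟩
  · rw [← E_nil e, lin_E, E_nil, Submodule.mkQ_apply, (Submodule.Quotient.mk_eq_zero S).2, map_zero]
    exact Submodule.subset_span (Or.inr rfl)
  · rw [← lin_sh_baseChange e dg e₀, key, Submodule.mkQ_apply, (Submodule.Quotient.mk_eq_zero S).2, map_zero]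
    exact Submodule.subset_span (Or.inl ⟨x, y, hx, hy, rfl⟩)
  · rw [LinearMap.comp_apply, lin_E]
    have := congrArg Subtype.val (LinearMap.congr_fun hh (S.mkQ (E e₀ w)))
    refine this.trans ?_
    change ((α₀ (E e₀ w) : LinearMap.range (d.restrictScalars ℚ)) : Y) = _
    rw [hα₀, lin_E]

end Lift

/-! ### Twisting cochains with values in a commutative dg algebra -/

section Twisting

open TensorAlgebra

variable {R : Type u} [CommRing R] (A : CDGAlg.{u, v} R) {H : Type*} [AddCommGroup H] [Module R H]
  {B : Type*} (e : Module.Basis B R H) (dg : B → ℤ)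

lemma CDGAlg.mul_comm_chi {p q : ℤ} {a b : A.carrier} (ha : a ∈ A.gr p) (hb : b ∈ A.gr q) :
    A.mul a b = chi R ((p : ZMod 2) * q) • A.mul b a := by
  rw [A.mul_comm ha hb, negOnePow_smul R]
  push_cast
  rfl

lemma CDGAlg.leibniz_chi {p : ℤ} {a : A.carrier} (ha : a ∈ A.gr p) (b : A.carrier) :
    A.d (A.mul a b) = A.mul (A.d a) b + chi R (p : ZMod 2) • A.mul a (A.d b) := by
  rw [A.leibniz ha, negOnePow_smul R]

lemma d_comp_d : A.d ∘ₗ A.d = 0 := LinearMap.ext A.d_d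

variable {e dg}

lemma d_cup {α : TensorAlgebra R H →ₗ[R] A.carrier} {k : ℤ}
    (hα : ∀ w, α (E e w) ∈ A.gr (wdeg dg w + k)) (β : TensorAlgebra R H →ₗ[R] A.carrier) :
    A.d ∘ₗ cup e A.mul α β = cup e A.mul (A.d ∘ₗ α) β +
      chi R (k : ZMod 2) • cup e A.mul (α ∘ₗ sgn e dg) (A.d ∘ₗ β) := by
  refine ext_E (e := e) fun w => ?_
  rw [LinearMap.add_apply, LinearMap.smul_apply, LinearMap.comp_apply, cup_E, cup_E, cup_E,
    map_spl, smul_spl, ← spl_add]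
  refine spl_congr fun u v _ => ?_
  rw [A.leibniz_chi (hα u)]
  simp only [LinearMap.comp_apply, sgn_E, map_smul, LinearMap.smul_apply, smul_smul, ← chi_add]
  push_cast
  rw [add_comm (k : ZMod 2)]
  rfl

variable (e dg)

/-- The defect `dτ - τ ∘ D - τ ∪ τ` of the twisting cochain equation. -/
def defect (b : TensorAlgebra R H →ₗ[R] H) (τ : TensorAlgebra R H →ₗ[R] A.carrier) :
    TensorAlgebra R H →ₗ[R] A.carrier :=
  A.d ∘ₗ τ - τ ∘ₗ coder e dg b - cup e A.mul (τ ∘ₗ sgn e dg) τ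

variable {A e dg}

/-- Bianchi identity: differentiate the defect and eliminate `dτ` by its definition; the triple
products cancel by associativity. The square of `D` is not assumed to vanish, because its vanishing
is later read off from this formula. -/
lemma d_defect {b : TensorAlgebra R H →ₗ[R] H} (hb : b 1 = 0)
    (hdeg : ∀ w, b (E e w) ∈ HD e dg (wdeg dg w + 1))
    {τ : TensorAlgebra R H →ₗ[R] A.carrier} (hτ : ∀ w, τ (E e w) ∈ A.gr (wdeg dg w + 1)) :
    A.d ∘ₗ defect A e dg b τ = - (defect A e dg b τ ∘ₗ coder e dg b) -
      τ ∘ₗ (coder e dg b ∘ₗ coder e dg b) - cup e A.mul (defect A e dg b τ ∘ₗ sgn e dg) τ +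
      cup e A.mul τ (defect A e dg b τ) := by
  have hSS : ∀ α : TensorAlgebra R H →ₗ[R] A.carrier, (α ∘ₗ sgn e dg) ∘ₗ sgn e dg = α := by
    intro α; ext z; simp
  have hτS : ∀ w, (τ ∘ₗ sgn e dg) (E e w) ∈ A.gr (wdeg dg w + 1) := fun w => by
    rw [LinearMap.comp_apply, sgn_E, map_smul]
    exact Submodule.smul_mem _ _ (hτ w)
  have hSB : (τ ∘ₗ sgn e dg) ∘ₗ coder e dg b = - ((τ ∘ₗ coder e dg b) ∘ₗ sgn e dg) := by
    rw [LinearMap.comp_assoc, sgn_coder e dg hdeg, LinearMap.comp_neg, LinearMap.comp_assoc]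
  have hD : A.d ∘ₗ τ = defect A e dg b τ + τ ∘ₗ coder e dg b + cup e A.mul (τ ∘ₗ sgn e dg) τ := by
    rw [defect]; abel
  have h1 : A.d ∘ₗ defect A e dg b τ = - ((A.d ∘ₗ τ) ∘ₗ coder e dg b) -
      cup e A.mul ((A.d ∘ₗ τ) ∘ₗ sgn e dg) τ + cup e A.mul τ (A.d ∘ₗ τ) := by
    rw [defect, LinearMap.comp_sub, LinearMap.comp_sub, d_cup A hτS, hSS, ← LinearMap.comp_assoc,
      ← LinearMap.comp_assoc, ← LinearMap.comp_assoc, d_comp_d, LinearMap.zero_comp]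
    simp only [Int.cast_one, chi_one, neg_smul, one_smul]
    abel
  rw [h1, hD]
  simp only [LinearMap.add_comp, cup_add_left, cup_add_right, cup_coder e dg A.mul _ _ hb, hSS, hSB,
    cup_sgn, cup_neg_left, cup_assoc e A.mul A.mul_assoc, LinearMap.comp_assoc]
  abel

/-- Linearization in the lowest length. Cup products with `ε` involve it on shorter words only, and
so does `ε ∘ D`, because `D` shortens words; `2 ≤ m` removes `ε` on the single letter `δ(w)`. -/
lemma defect_add {b δ : TensorAlgebra R H →ₗ[R] H} (hb : VanishBelow e 2 b)
    {τ ε : TensorAlgebra R H →ₗ[R] A.carrier} (hτ : τ 1 = 0) {m : ℕ} (hm : 2 ≤ m)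
    (hδ : VanishBelow e m δ) (hε : VanishBelow e m ε) (w : List B) (hw : w.length ≤ m) :
    defect A e dg (b + δ) (τ + ε) (E e w) =
      defect A e dg b τ (E e w) + A.d (ε (E e w)) - τ (ι R (δ (E e w))) := by
  have hδ1 : δ 1 = 0 := hδ [] (by simp; omega)
  have hε1 : ε 1 = 0 := hε [] (by simp; omega)
  have e1 : ε (coder e dg b (E e w)) = 0 := hε.of_mem (TLt_mono hw (coder_mem_TLt hb w))
  have e2 : ε (ι R (δ (E e w))) = 0 := by
    refine hε.of_mem (TLt_mono hm ?_)
    have := ι_mul_mem_TLt (e := e) (δ (E e w)) (mem_TLt (w := []) (n := 1) (by simp))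
    simpa using this
  have e3 := cup_vanish_left A.mul (hε.comp_sgn dg) hτ hw
  have e4 := cup_vanish_left A.mul (hε.comp_sgn dg) hε1 hw
  have e5 := cup_vanish_right (e := e) A.mul (α := τ ∘ₗ sgn e dg) (by simp [hτ]) hε hw
  simp only [defect, coder_add, LinearMap.comp_add, LinearMap.add_comp, cup_add_left,
    cup_add_right, LinearMap.sub_apply, LinearMap.add_apply, LinearMap.comp_apply,
    coder_vanish dg hδ hδ1 w hw, e1, e2, e3, e4, e5]
  abel

/-- The term `τ ∘ D` is harmless because `D` is a derivation of shuffles. In `τ ∪ τ` only the cuts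
`x | y` and `y | x` survive, and these cancel by graded commutativity of `A`. -/
lemma defect_shZero {b : TensorAlgebra R H →ₗ[R] H} (hb : ShZero e dg b)
    (hdeg : ∀ w, b (E e w) ∈ HD e dg (wdeg dg w + 1))
    {τ : TensorAlgebra R H →ₗ[R] A.carrier} (hsh : ShZero e dg τ)
    (hτ : ∀ w, τ (E e w) ∈ A.gr (wdeg dg w + 1)) : ShZero e dg (defect A e dg b τ) := by
  refine ShZero.sub (ShZero.sub (hsh.comp A.d) ⟨by simp, fun x y hx hy => ?_⟩)
    ⟨?_, fun x y hx hy => ?_⟩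
  · have haug : ∀ w : List B, w ≠ [] → aug e (E e w) = 0 := fun w hw => by
      rw [aug, lin_E, if_neg hw]
    rw [LinearMap.comp_apply, coder_sh e dg hb hdeg, map_add, map_smul,
      hsh.shT (by simp) (haug y hy), hsh.shT (haug x hx) (by simp)]
    simp
  · rw [← E_nil e, cup_E]
    simp [hsh.1]
  · have hsh' : ShZero e dg (τ ∘ₗ sgn e dg) := by
      refine ⟨by simp [hsh.1], fun x y hx hy => ?_⟩
      rw [LinearMap.comp_apply, sgn_of_mem (sh_mem_TD e dg x y), map_smul, hsh.2 x y hx hy,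
        smul_zero]
    rw [cup_eq, splT_sh_left e dg (hsh'.compl₁₂_left A.mul τ)]
    rw [spl_eq_right_nil, spl_eq_right_nil]
    · simp only [LinearMap.compl₁₂_apply, LinearMap.comp_apply, sgn_E, map_smul,
        LinearMap.smul_apply, sh_nil_left, sh_nil_right]
      rw [A.mul_comm_chi (hτ y) (hτ x), smul_smul, smul_smul, ← chi_add, ← chi_add]
      push_cast
      -- Shuffle sign, `sgn` and commutation together give the cut `y | x` the opposite of the sign
      -- `(-1)^i` of the cut `x | y`.
      have key : ∀ i j : ZMod 2, j * i + j + (j + 1) * (i + 1) = i + 1 := by decide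
      have hp : ∀ z, ((wdeg dg z : ℤ) : ZMod 2) = par dg z := fun z => rfl
      rw [hp, hp, key, chi_add, chi_one]
      simp
    · intro u v huv hv
      rcases eq_or_ne u [] with rfl | hu
      · simp [hsh.1]
      · simp [hsh.2 x v hx hv]
    · intro u v huv hv
      simp [hsh.2 v y hv hy]

/-- In the lowest length the Bianchi identity reduces to `d(defect(w)) = -τ(b(D w))`. The right side
is, up to sign, the chosen cocycle of the class `b(D w)`, and it is a coboundary, so this class is
zero and both sides vanish. -/
lemma corestriction_vanish {b : TensorAlgebra R A.Cohomology →ₗ[R] A.Cohomology}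
    {e : Module.Basis B R A.Cohomology} (hb : VanishBelow e 2 b)
    (hdeg : ∀ w, b (E e w) ∈ HD e dg (wdeg dg w + 1))
    {τ : TensorAlgebra R A.Cohomology →ₗ[R] A.carrier}
    (hτ : ∀ w, τ (E e w) ∈ A.gr (wdeg dg w + 1)) (hτ1 : τ 1 = 0)
    (hcls : A.ChoosesCocycles (τ ∘ₗ ι R)) {n : ℕ} (hR : VanishBelow e n (defect A e dg b τ)) :
    ∀ w : List B, w.length ≤ n → b (coder e dg b (E e w)) = 0 ∧
      A.d (defect A e dg b τ (E e w)) = 0 := by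
  have hb1 : b 1 = 0 := hb [] (by simp)
  intro w
  induction hk : w.length using Nat.strong_induction_on generalizing w with
  | _ k ih =>
    subst hk
    intro hw
    have h1 := coder_coder_of_vanish e dg hb1 hdeg (n := w.length)
      (fun u hu => (ih _ hu u rfl (by omega)).1) w le_rfl
    have h2 := LinearMap.congr_fun (d_defect hb1 hdeg hτ) (E e w)
    simp only [LinearMap.add_apply, LinearMap.sub_apply, LinearMap.neg_apply,
      LinearMap.comp_apply] at h2
    rw [h1, cup_vanish_left A.mul (hR.comp_sgn dg) hτ1 hw, cup_vanish_right A.mul hτ1 hR hw,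
      hR.of_mem (TLt_mono hw (coder_mem_TLt hb w))] at h2
    simp only [neg_zero, zero_sub, sub_zero, add_zero] at h2
    have h3 : b (coder e dg b (E e w)) = 0 := by
      obtain ⟨hz, hcl⟩ := hcls (b (coder e dg b (E e w)))
      rw [← hcl]
      refine (Submodule.Quotient.mk_eq_zero _).2 ⟨- defect A e dg b τ (E e w), ?_⟩
      rw [map_neg, h2, neg_neg]
      rfl
    refine ⟨h3, ?_⟩
    rw [h2, h3]
    simp

variable (A) in
lemma CDGAlg.proj_eq {i : ℤ} {x : A.carrier} (hx : x ∈ A.gr i) : A.proj i x = x :=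
  DirectSum.decompose_of_mem_same A.gr hx

variable (A) in
lemma CDGAlg.proj_mem (i : ℤ) (x : A.carrier) : A.proj i x ∈ A.gr i :=
  (DirectSum.decompose A.gr x i).2

/-- The obstruction-theoretic step: cocycle values on words of length `n` are written as
representatives of classes plus coboundaries, compatibly with shuffles and degrees. -/
lemma exists_class_add_coboundary [Algebra ℚ R] {Q : TensorAlgebra R H →ₗ[R] A.carrier}
    (hQ : ShZero e dg Q) {k : ℤ} (hdeg : ∀ w, Q (E e w) ∈ A.gr (wdeg dg w + k + 1)) {n : ℕ}
    (hd : ∀ w : List B, w.length = n → A.d (Q (E e w)) = 0)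
    {φ : A.Cohomology →ₗ[R] A.carrier} (hφ : A.ChoosesCocycles φ)
    (hφdeg : ∀ i h, h ∈ A.cohomologyGr i → φ h ∈ A.gr i) :
    ∃ (δ : TensorAlgebra R H →ₗ[R] A.Cohomology) (ε : TensorAlgebra R H →ₗ[R] A.carrier),
      ShZero e dg δ ∧ ShZero e dg ε ∧ VanishBelow e n δ ∧ VanishBelow e n ε ∧
      (∀ w, δ (E e w) ∈ A.cohomologyGr (wdeg dg w + k + 1)) ∧
      (∀ w, ε (E e w) ∈ A.gr (wdeg dg w + k)) ∧
      ∀ w : List B, w.length = n → Q (E e w) = φ (δ (E e w)) + A.d (ε (E e w)) := by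
  have hz : ∀ z, trunc e n Q z ∈ A.cocycles := by
    intro z
    rw [LinearMap.mem_ker, ← LinearMap.comp_apply]
    have : A.d ∘ₗ trunc e n Q = 0 := ext_E (e := e) fun w => by
      rw [LinearMap.comp_apply, trunc_E]
      split_ifs with h
      · rw [hd w h]; rfl
      · simp
    rw [this]; rfl
  let Qz := (trunc e n Q).codRestrict A.cocycles hz
  have hQz : ShZero e dg Qz := by
    have := hQ.trunc n
    exact ⟨Subtype.ext this.1, fun x y hx hy => Subtype.ext (this.2 x y hx hy)⟩
  let δ := A.cls ∘ₗ Qz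
  have hδ : ShZero e dg δ := hQz.comp A.cls
  have hδv : VanishBelow e n δ := fun w hw => by
    have : Qz (E e w) = 0 := Subtype.ext (trunc_vanishBelow n Q w hw)
    change A.cls (Qz (E e w)) = 0
    rw [this, map_zero]
  have hδdeg : ∀ w, δ (E e w) ∈ A.cohomologyGr (wdeg dg w + k + 1) := fun w => by
    refine ⟨Qz (E e w), ?_, rfl⟩
    change trunc e n Q (E e w) ∈ A.gr _
    rw [trunc_E]
    split_ifs
    · exact hdeg w
    · exact zero_mem _
  have hα : ShZero e dg (trunc e n Q - φ ∘ₗ δ) := (hQ.trunc n).sub (hδ.comp φ)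
  have hr : ∀ w, (trunc e n Q - φ ∘ₗ δ) (E e w) ∈ LinearMap.range A.d := fun w => by
    obtain ⟨hz', hcl⟩ := hφ (δ (E e w))
    have : A.cls (Qz (E e w) - ⟨_, hz'⟩) = 0 := by
      rw [map_sub, hcl]; exact sub_self _
    exact (Submodule.Quotient.mk_eq_zero
      ((LinearMap.range A.d).comap A.cocycles.subtype)).1 this
  obtain ⟨β, hβ, hdβ⟩ := exists_lift e dg A.d hα hr
  -- The lift `β` need not be homogeneous. Projecting its values keeps it zero on shuffles by
  -- `ShZero.lin`, and keeps its coboundary because `d` commutes with the projections.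
  let P : ℕ → ℤ → A.carrier →ₗ[R] A.carrier := fun l j => if l = n then A.proj (j + k) else 0
  refine ⟨δ, lin e fun w => P w.length (wdeg dg w) (β (E e w)), hδ, hβ.lin P, hδv,
    fun w hw => ?_, hδdeg, fun w => ?_, fun w hw => ?_⟩
  · rw [lin_E]
    simp only [P, if_neg hw.ne, LinearMap.zero_apply]
  · rw [lin_E]
    simp only [P]
    split_ifs
    · exact A.proj_mem _ _
    · exact zero_mem _
  · rw [lin_E]
    simp only [P, if_pos hw]
    have h1 : A.d (β (E e w)) = Q (E e w) - φ (δ (E e w)) := by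
      rw [← LinearMap.comp_apply, hdβ, LinearMap.sub_apply, trunc_E, if_pos hw]
      rfl
    rw [A.d_proj, h1, map_sub, A.proj_eq (hdeg w), A.proj_eq (hφdeg _ _ (hδdeg w))]
    abel

end Twisting

/-! ### Existence of minimal models by induction on word length. -/

section Existence

open TensorAlgebra

variable {R : Type u} [CommRing R] {A : CDGAlg.{u, v} R} {B : Type*}
  {e : Module.Basis B R A.Cohomology} {dg : B → ℤ}

lemma TD_map_mem {H X : Type*} [AddCommGroup H] [Module R H] [AddCommGroup X] [Module R X]
    {e : Module.Basis B R H} {gr : ℤ → Submodule R X} {k : ℤ} {α : TensorAlgebra R H →ₗ[R] X}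
    (hα : ∀ w, α (E e w) ∈ gr (wdeg dg w + k)) {i : ℤ} {z : TensorAlgebra R H}
    (hz : z ∈ TD e dg i) : α z ∈ gr (i + k) := by
  refine TD_induction hz (fun w hw => hw ▸ hα w) (by simp) (fun x y hx hy => ?_) (fun c x hx => ?_)
  · rw [map_add]; exact add_mem hx hy
  · rw [map_smul]; exact Submodule.smul_mem _ _ hx

lemma shZero_of_vanish {H X : Type*} [AddCommGroup H] [Module R H] [AddCommGroup X] [Module R X]
    {e : Module.Basis B R H} {α : TensorAlgebra R H →ₗ[R] X} (h1 : α 1 = 0)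
    (h : ∀ w : List B, 2 ≤ w.length → α (E e w) = 0) : ShZero e dg α := by
  refine ⟨h1, fun x y hx hy => ?_⟩
  have h2 : 2 ≤ x.length + y.length := by
    have := List.length_pos_iff.2 hx
    have := List.length_pos_iff.2 hy
    omega
  have := sh_mem_TG e dg x y
  revert this
  generalize sh e dg x y = s
  intro hs
  induction hs using Submodule.span_induction with
  | mem z hz => obtain ⟨w, ⟨hw, -⟩, rfl⟩ := hz; exact h w (by omega)
  | zero => simp
  | add a b _ _ ha hb => rw [map_add, ha, hb, add_zero]
  | smul c a _ ha => rw [map_smul, ha, smul_zero]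

/-- A given shuffle product involves words of one length only, so a sufficiently late approximation
decides. -/
lemma shZero_of_approx {H X : Type*} [AddCommGroup H] [Module R H] [AddCommGroup X] [Module R X]
    {e : Module.Basis B R H} {α : TensorAlgebra R H →ₗ[R] X} (n₀ : ℕ)
    (h : ∀ n, n₀ ≤ n → ∃ αn, ShZero e dg αn ∧ VanishBelow e (n + 1) (α - αn)) :
    ShZero e dg α := by
  refine ⟨?_, fun x y hx hy => ?_⟩
  · obtain ⟨αn, h1, h2⟩ := h n₀ le_rfl
    have := h2 [] (by simp)
    simpa [sub_eq_zero, h1.1] using this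
  · obtain ⟨αn, h1, h2⟩ := h (max n₀ (x.length + y.length)) (le_max_left _ _)
    have h3 : (α - αn) (sh e dg x y) = 0 := by
      refine h2.of_mem (Submodule.span_mono ?_ (sh_mem_TG e dg x y))
      rintro _ ⟨w, ⟨hw, -⟩, rfl⟩
      exact ⟨w, by simp only [Set.mem_ofPred_eq]; omega, rfl⟩
    rw [LinearMap.sub_apply, h1.2 x y hx hy, sub_zero] at h3
    exact h3

variable (A e dg) in
/-- The properties of approximate minimal models that are independent of the equations. -/
structure IsPreModel (b : TensorAlgebra R A.Cohomology →ₗ[R] A.Cohomology)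
    (τ : TensorAlgebra R A.Cohomology →ₗ[R] A.carrier) : Prop where
  shb : ShZero e dg b
  shτ : ShZero e dg τ
  degb : ∀ w, b (E e w) ∈ HD e dg (wdeg dg w + 1)
  degτ : ∀ w, τ (E e w) ∈ A.gr (wdeg dg w + 1)
  low : VanishBelow e 2 b
  cls : A.ChoosesCocycles (τ ∘ₗ ι R)

lemma IsPreModel.defect_mem {b : TensorAlgebra R A.Cohomology →ₗ[R] A.Cohomology}
    {τ : TensorAlgebra R A.Cohomology →ₗ[R] A.carrier} (h : IsPreModel A e dg b τ) (w : List B) :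
    defect A e dg b τ (E e w) ∈ A.gr (wdeg dg w + 1 + 1) := by
  rw [defect, LinearMap.sub_apply, LinearMap.sub_apply]
  refine sub_mem (sub_mem (A.d_mem (h.degτ w)) (TD_map_mem h.degτ (coder_mem_TD e dg h.degb w))) ?_
  rw [cup_E]
  refine spl_mem _ fun u v huv => ?_
  rw [LinearMap.comp_apply, sgn_E, map_smul, map_smul, LinearMap.smul_apply]
  refine Submodule.smul_mem _ _ ?_
  convert A.mul_mem (h.degτ u) (h.degτ v) using 2
  rw [← huv, wdeg_append]; ring

lemma choosesCocycles_of_basis {φ : A.Cohomology →ₗ[R] A.carrier}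
    (h : ∀ a, ∃ hz : φ (e a) ∈ A.cocycles, A.cls ⟨φ (e a), hz⟩ = e a) : A.ChoosesCocycles φ := by
  intro x
  have hx := e.mem_span x
  induction hx using Submodule.span_induction with
  | mem x hx => obtain ⟨a, rfl⟩ := hx; exact h a
  | zero =>
    refine ⟨by simp, ?_⟩
    have : (⟨φ 0, by simp⟩ : A.cocycles) = 0 := Subtype.ext (map_zero φ)
    rw [this, map_zero]
  | add x y _ _ hx hy =>
    obtain ⟨h1, h2⟩ := hx
    obtain ⟨h3, h4⟩ := hy
    refine ⟨by rw [map_add]; exact add_mem h1 h3, ?_⟩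
    conv_rhs => rw [← h2, ← h4, ← map_add]
    congr 1
    exact Subtype.ext (map_add φ _ _)
  | smul c x _ hx =>
    obtain ⟨h1, h2⟩ := hx
    refine ⟨by rw [map_smul]; exact Submodule.smul_mem _ _ h1, ?_⟩
    conv_rhs => rw [← h2, ← map_smul]
    congr 1
    exact Subtype.ext (map_smul φ _ _)

lemma E_singleton {H : Type*} [AddCommGroup H] [Module R H] (e : Module.Basis B R H) (a : B) :
    E e [a] = ι R (e a) := by simp

variable (hHD : ∀ i, HD e dg i = A.cohomologyGr (i + 1))

include hHD

/-- On letters `τ` is a choice of homogeneous cocycles, and it is zero elsewhere. The product does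
not have to be put in: it arises as the first correction of `b`, on words of length two. -/
lemma exists_preModel_start : ∃ τ : TensorAlgebra R A.Cohomology →ₗ[R] A.carrier,
    IsPreModel A e dg 0 τ ∧ VanishBelow e 2 (defect A e dg 0 τ) := by
  have hz : ∀ a, ∃ z : A.cocycles, (z : A.carrier) ∈ A.gr (dg a + 1) ∧ A.cls z = e a := by
    intro a
    have := mem_HD e dg a
    rw [hHD] at this
    exact this
  choose z hz1 hz2 using hz
  let τw : List B → A.carrier := fun
    | [a] => z a
    | _ => 0
  have hτ : ∀ w, τw w ∈ A.gr (wdeg dg w + 1) := fun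
    | [] => zero_mem _
    | [a] => by simpa [τw] using hz1 a
    | _ :: _ :: _ => zero_mem _
  have hτ0 : τw [] = 0 := rfl
  have hτ1 : lin e τw 1 = 0 := by rw [← E_nil e, lin_E]
  have hs : ∀ a, lin e τw (ι R (e a)) = z a := fun a => by rw [← E_singleton, lin_E]
  refine ⟨lin e τw, ⟨⟨rfl, fun _ _ _ _ => rfl⟩, shZero_of_vanish hτ1 ?_, fun _ => zero_mem _,
    fun w => by rw [lin_E]; exact hτ w, fun _ _ => rfl, choosesCocycles_of_basis (e := e) fun a => ?_⟩, ?_⟩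
  · rintro (_ | ⟨a, _ | ⟨b, w⟩⟩) hw
    · simp at hw
    · simp at hw
    · rw [lin_E]
  · have h1 := hs a
    refine ⟨by rw [LinearMap.comp_apply, h1]; exact (z a).2, ?_⟩
    exact (congrArg A.cls (Subtype.ext h1)).trans (hz2 a)
  · have hc : VanishBelow e 2 (coder e dg (0 : TensorAlgebra R A.Cohomology →ₗ[R] A.Cohomology)) :=
      fun w hw => coder_vanish dg (fun _ _ => rfl) rfl w hw.le |>.trans (by simp)
    rintro (_ | ⟨a, _ | ⟨b, w⟩⟩) hw
    · rw [defect, LinearMap.sub_apply, cup_E]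
      simp [hτ0, hτ1]
    · have hza : A.d (z a) = 0 := (z a).2
      rw [defect, LinearMap.sub_apply, LinearMap.sub_apply, LinearMap.comp_apply,
        LinearMap.comp_apply, hc _ hw, cup_E, E_singleton, hs, hza]
      simp [spl_cons, hτ0]
    · simp at hw

/-- Write the defect on words of length `n + 1` as `φ(δ) + d ε`. By `defect_add`, adding `δ` to `b`
subtracts `φ(δ)` and adding `-ε` to `τ` subtracts `d ε`. -/
lemma exists_preModel_step [Algebra ℚ R] {n : ℕ} (hn : 1 ≤ n)
    {b : TensorAlgebra R A.Cohomology →ₗ[R] A.Cohomology}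
    {τ : TensorAlgebra R A.Cohomology →ₗ[R] A.carrier} (h : IsPreModel A e dg b τ)
    (hR : VanishBelow e (n + 1) (defect A e dg b τ)) :
    ∃ b' τ', (IsPreModel A e dg b' τ' ∧ VanishBelow e (n + 2) (defect A e dg b' τ')) ∧
      VanishBelow e (n + 1) (b' - b) ∧ VanishBelow e (n + 1) (τ' - τ) := by
  have hcoc := corestriction_vanish h.low h.degb h.degτ h.shτ.1 h.cls hR
  have hφdeg : ∀ i x, x ∈ A.cohomologyGr i → (τ ∘ₗ ι R) x ∈ A.gr i := by
    intro i x hx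
    have h1 := hHD (i - 1)
    rw [sub_add_cancel] at h1
    rw [← h1] at hx
    have := ι_mul_mem_TD hx (mem_TD e dg [])
    have := TD_map_mem h.degτ this
    simpa using this
  obtain ⟨δ, ε, hδ, hε, hδv, hεv, hδd, hεd, hQ⟩ := exists_class_add_coboundary (k := 1) (n := n + 1)
    (defect_shZero h.shb h.degb h.shτ h.degτ) h.defect_mem (fun w hw => (hcoc w hw.le).2) h.cls hφdeg
  have hεv' : VanishBelow e (n + 1) (-ε) := fun w hw => by rw [LinearMap.neg_apply, hεv w hw, neg_zero]
  refine ⟨b + δ, τ + -ε, ⟨⟨h.shb.add hδ, h.shτ.add hε.neg, fun w => ?_, fun w => ?_,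
    h.low.add (hδv.mono (by omega)), ?_⟩, fun w hw => ?_⟩, ?_, ?_⟩
  · refine add_mem (h.degb w) ?_
    rw [hHD]
    exact hδd w
  · exact add_mem (h.degτ w) (neg_mem (hεd w))
  · have : (τ + -ε) ∘ₗ ι R = τ ∘ₗ ι R := e.ext fun a => by
      rw [LinearMap.comp_apply, ← E_singleton, LinearMap.add_apply,
        hεv' _ (by simp; omega), add_zero, E_singleton]
      rfl
    rw [this]
    exact h.cls
  · rw [defect_add h.low h.shτ.1 (by omega) hδv hεv' w (by omega)]
    rcases Nat.lt_succ_iff_lt_or_eq.1 hw with hlt | heq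
    · rw [hR w hlt, hδv w hlt, hεv' w hlt]
      simp
    · rw [hQ w heq]
      simp
  · simpa using hδv
  · simpa using hεv'

/-- Existence of minimal models, in terms of twisting cochains. -/
lemma exists_model [Algebra ℚ R] :
    ∃ b τ, IsPreModel A e dg b τ ∧ defect A e dg b τ = 0 ∧ b ∘ₗ coder e dg b = 0 := by
  obtain ⟨τ₀, h₀, hR₀⟩ := exists_preModel_start hHD
  obtain ⟨b, τ, h⟩ := exists_limit (fun n b τ => IsPreModel A e dg b τ ∧
    VanishBelow e (n + 1) (defect A e dg b τ)) 1 0 τ₀ ⟨h₀, hR₀⟩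
    (fun n b τ hn h => exists_preModel_step hHD hn h.1 h.2)
  have hpre : IsPreModel A e dg b τ := by
    refine ⟨shZero_of_approx 1 fun n hn => ?_, shZero_of_approx 1 fun n hn => ?_, fun w => ?_,
      fun w => ?_, fun w hw => ?_, choosesCocycles_of_basis (e := e) fun a => ?_⟩
    · obtain ⟨bn, τn, hP, h1, h2⟩ := h n hn
      exact ⟨bn, hP.1.shb, h1⟩
    · obtain ⟨bn, τn, hP, h1, h2⟩ := h n hn
      exact ⟨τn, hP.1.shτ, h2⟩
    · obtain ⟨bn, τn, hP, h1, h2⟩ := h (w.length + 1) (by omega)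
      have := h1 w (by omega)
      rw [LinearMap.sub_apply, sub_eq_zero] at this
      rw [this]
      exact hP.1.degb w
    · obtain ⟨bn, τn, hP, h1, h2⟩ := h (w.length + 1) (by omega)
      have := h2 w (by omega)
      rw [LinearMap.sub_apply, sub_eq_zero] at this
      rw [this]
      exact hP.1.degτ w
    · obtain ⟨bn, τn, hP, h1, h2⟩ := h (w.length + 1) (by omega)
      have := h1 w (by omega)
      rw [LinearMap.sub_apply, sub_eq_zero] at this
      rw [this]
      exact hP.1.low w hw
    · obtain ⟨bn, τn, hP, h1, h2⟩ := h 1 le_rfl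
      have := h2 [a] (by simp)
      rw [LinearMap.sub_apply, sub_eq_zero, E_singleton] at this
      obtain ⟨h3, h4⟩ := hP.1.cls (e a)
      refine ⟨by rw [LinearMap.comp_apply, this]; exact h3, ?_⟩
      exact (congrArg A.cls (Subtype.ext this)).trans h4
  have hdef : defect A e dg b τ = 0 := by
    refine ext_E (e := e) fun w => ?_
    obtain ⟨bn, τn, hP, h1, h2⟩ := h (w.length + 1) (by omega)
    have := defect_add (dg := dg) hP.1.low hP.1.shτ.1 (by omega) h1 h2 w (by omega)
    rw [add_sub_cancel, add_sub_cancel] at this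
    rw [this, hP.2 w (by omega), h1 w (by omega), h2 w (by omega)]
    simp
  refine ⟨b, τ, hpre, hdef, ext_E (e := e) fun w => ?_⟩
  exact (corestriction_vanish hpre.low hpre.degb hpre.degτ hpre.shτ.1 hpre.cls
    (n := w.length) (fun _ _ => by rw [hdef]; rfl) w le_rfl).1

end Existence

/-! ### Multiplicative gauge transformations generated by maps that vanish on shuffles. -/

section Gauge

open TensorAlgebra

variable {R : Type u} [CommRing R] [Algebra ℚ R] (A : CDGAlg.{u, v} R)
  {H : Type*} [AddCommGroup H] [Module R H]
  {B : Type*} (e : Module.Basis B R H) (dg : B → ℤ)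

lemma spl_ite_right {Z : Type*} [AddCommMonoid Z] (F : List B → List B → Z) (w : List B) :
    spl (fun u v => if v = [] then F u v else 0) w = F w [] := by
  rw [spl_eq_right_nil (by intro u v _ hv; rw [if_neg hv]), if_pos rfl]

lemma spl_ite_left {Z : Type*} [AddCommMonoid Z] (F : List B → List B → Z) (w : List B) :
    spl (fun u v => if u = [] then F u v else 0) w = F [] w := by
  rw [spl_eq_left_nil (by intro u v _ hv; rw [if_neg hv]), if_pos rfl]

variable (R) in
/-- The inverse of a natural number in a `ℚ`-algebra. -/
def natInv (n : ℕ) : R := algebraMap ℚ R (n : ℚ)⁻¹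

lemma natInv_mul_cast {n : ℕ} (hn : n ≠ 0) : natInv R n * (n : R) = 1 := by
  rw [natInv, ← map_natCast (algebraMap ℚ R), ← map_mul, inv_mul_cancel₀ (by exact_mod_cast hn),
    map_one]

lemma natInv_smul_cast {X : Type*} [AddCommGroup X] [Module R X] {n : ℕ} (hn : n ≠ 0) (x : X) :
    natInv R n • (n : R) • x = x := by
  rw [smul_smul, natInv_mul_cast hn, one_smul]

/-- Auxiliary recursion for `gaugeWord`. -/
def gaugeAux (θ : List B → A.carrier) : (List B → A.carrier) → List B → A.carrier
  | K, [] => K []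
  | K, a :: w => A.mul (K []) (natInv R (w.length + 1) • gaugeAux θ (fun u => θ (a :: u)) w) +
      gaugeAux θ (fun u => K (a :: u)) w

/-- The solution `q` of `|w| q(w) = θ(w) + ∑ θ(u) q(v)`. -/
def gaugeWord (θ : List B → A.carrier) : List B → A.carrier
  | [] => 0
  | a :: w => natInv R (w.length + 1) • gaugeAux A θ (fun u => θ (a :: u)) w

lemma gaugeAux_eq (θ K : List B → A.carrier) (w : List B) :
    gaugeAux A θ K w = K w + spl (fun u v => A.mul (K u) (gaugeWord A θ v)) w := by
  induction w generalizing K with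
  | nil => simp [gaugeAux, gaugeWord]
  | cons a w ih =>
    rw [gaugeAux, spl_cons, ih fun u => K (a :: u), gaugeWord]
    abel

variable {A}

/-- The linear map `q` with `|w| q(w) = θ(w) + ∑ θ(u) q(v)`. -/
def gauge (θ : TensorAlgebra R H →ₗ[R] A.carrier) : TensorAlgebra R H →ₗ[R] A.carrier :=
  lin e (gaugeWord A fun w => θ (E e w))

@[simp] lemma gauge_one (θ : TensorAlgebra R H →ₗ[R] A.carrier) : gauge e θ 1 = 0 := by
  rw [← E_nil e, gauge, lin_E, gaugeWord]

/-- A linear differential equation for `1 + q`, with the length of words as Euler derivation. It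
plays the role of an exponential and needs division by lengths only. -/
lemma gauge_eq {θ : TensorAlgebra R H →ₗ[R] A.carrier} (hθ : θ 1 = 0) (w : List B) :
    (w.length : R) • gauge e θ (E e w) = θ (E e w) + cup e A.mul θ (gauge e θ) (E e w) := by
  cases w with
  | nil => rw [cup_E]; simp [hθ]
  | cons a w =>
    rw [cup_E, spl_cons, E_nil, hθ, map_zero, LinearMap.zero_apply, zero_add]
    simp only [gauge, lin_E]
    rw [gaugeWord, gaugeAux_eq, List.length_cons, smul_comm, natInv_smul_cast (Nat.succ_ne_zero _)]

variable {e dg}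

lemma gauge_mem {θ : TensorAlgebra R H →ₗ[R] A.carrier} (hθ : θ 1 = 0)
    (hdeg : ∀ w, θ (E e w) ∈ A.gr (wdeg dg w)) (w : List B) :
    gauge e θ (E e w) ∈ A.gr (wdeg dg w) := by
  induction hn : w.length using Nat.strong_induction_on generalizing w with
  | _ k ih =>
    subst hn
    rcases eq_or_ne w [] with rfl | hw
    · simp
    rw [← natInv_smul_cast (R := R) (mt List.length_eq_zero_iff.1 hw) (gauge e θ (E e w)),
      gauge_eq e hθ, cup_E]
    refine Submodule.smul_mem _ _ (add_mem (hdeg w) (spl_mem _ fun u v huv => ?_))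
    rcases eq_or_ne u [] with rfl | hu
    · simp [hθ]
    · convert A.mul_mem (hdeg u) (ih _ (length_lt_right huv hu) v rfl) using 2
      rw [← huv, wdeg_append]

/-- On words of length at most `n`, the product terms of the recursion do not see `δ`; only the
division by the length remains. -/
lemma gauge_add {θ δ : TensorAlgebra R H →ₗ[R] A.carrier} (hθ : θ 1 = 0) (hδ1 : δ 1 = 0) {n : ℕ}
    (hδ : VanishBelow e n δ) (w : List B) (hw : w.length ≤ n) :
    gauge e (θ + δ) (E e w) = gauge e θ (E e w) + natInv R w.length • δ (E e w) := by
  induction hn : w.length using Nat.strong_induction_on generalizing w with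
  | _ k ih =>
    subst hn
    rcases eq_or_ne w [] with rfl | hne
    · simp [hδ1]
    have hl := mt List.length_eq_zero_iff.1 hne
    rw [← natInv_smul_cast (R := R) hl (gauge e (θ + δ) (E e w)),
      ← natInv_smul_cast (R := R) hl (gauge e θ (E e w)), ← smul_add,
      gauge_eq e hθ, gauge_eq e (by simp [hθ, hδ1]), cup_add_left, LinearMap.add_apply,
      LinearMap.add_apply, cup_vanish_left A.mul hδ (by simp) hw]
    have : cup e A.mul θ (gauge e (θ + δ)) (E e w) = cup e A.mul θ (gauge e θ) (E e w) := by
      rw [cup_E, cup_E]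
      refine spl_congr fun u v huv => ?_
      rcases eq_or_ne u [] with rfl | hu
      · simp [hθ]
      · have hlt := length_lt_right huv hu
        rw [ih _ hlt v (by omega) rfl, hδ v (by omega)]
        simp
    rw [this]
    congr 1
    abel

omit [Algebra ℚ R] in
/-- The map `α ↦ α + α ∪ q` is compatible with shuffles if `q` is multiplicative. -/
lemma add_cup_sh {α q : TensorAlgebra R H →ₗ[R] A.carrier} {k : ℤ} (hα : ShZero e dg α)
    (hαd : ∀ w, α (E e w) ∈ A.gr (wdeg dg w + k)) (hq1 : q 1 = 0)
    (hqd : ∀ w, q (E e w) ∈ A.gr (wdeg dg w)) {x y : List B} (hx : x ≠ []) (hy : y ≠ [])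
    (hq : ∀ u v, u ≠ [] → v ≠ [] → u.length + v.length < x.length + y.length →
      q (sh e dg u v) = A.mul (q (E e u)) (q (E e v))) :
    (α + cup e A.mul α q) (sh e dg x y) =
      A.mul ((α + cup e A.mul α q) (E e x)) (q (E e y)) +
      chi R ((k : ZMod 2) * par dg x) • A.mul (q (E e x)) ((α + cup e A.mul α q) (E e y)) := by
  simp only [LinearMap.add_apply, hα.2 x y hx hy, zero_add, cup_E]
  rw [cup_eq, splT_sh_left e dg (hα.compl₁₂_left A.mul q)]
  simp only [LinearMap.compl₁₂_apply]
  -- The cut with `v = []` is separate: `q 1 = 0`, but the shuffle of `[]` with `y` is `y`. It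
  -- yields `α(x) q(y)`, the contribution of the summand `α`.
  have e1 : ∀ u v, u ++ v = x → A.mul (α (E e u)) (q (sh e dg v y)) =
      (if v = [] then A.mul (α (E e u)) (q (E e y)) else 0) +
      A.mul (A.mul (α (E e u)) (q (E e v))) (q (E e y)) := by
    intro u v huv
    split_ifs with hv
    · subst hv; simp [hq1]
    · rcases eq_or_ne u [] with rfl | hu
      · simp [hα.1]
      · rw [hq v y hv hy (by have := length_lt_right huv hu; omega), A.mul_assoc, zero_add]
  have e2 : ∀ u v, u ++ v = y → chi R (par dg u * par dg x) • A.mul (α (E e u)) (q (sh e dg x v)) =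
      chi R ((k : ZMod 2) * par dg x) • ((if v = [] then A.mul (q (E e x)) (α (E e u)) else 0) +
      A.mul (q (E e x)) (A.mul (α (E e u)) (q (E e v)))) := by
    intro u v huv
    have key : A.mul (q (E e x)) (α (E e u)) =
        chi R (par dg x * (par dg u + k)) • A.mul (α (E e u)) (q (E e x)) := by
      rw [A.mul_comm_chi (hqd x) (hαd u)]
      push_cast
      rfl
    have key2 : ∀ i j k : ZMod 2, j * i = k * i + i * (j + k) := by decide
    split_ifs with hv
    · subst hv
      simp only [sh_nil_right, E_nil, hq1, map_zero, add_zero]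
      rw [key, smul_smul, ← chi_add, ← key2]
    · rcases eq_or_ne u [] with rfl | hu
      · simp [hα.1]
      · rw [hq x v hx hv (by have := length_lt_right huv hu; omega), zero_add, ← A.mul_assoc,
          ← A.mul_assoc, key, map_smul, LinearMap.smul_apply, smul_smul, ← chi_add, ← key2]
  rw [spl_congr e1, spl_congr e2, spl_add, ← smul_spl, spl_add, spl_ite_right,
    spl_ite_right]
  simp only [map_add, LinearMap.add_apply, map_spl]
  congr 2
  exact (spl_apply _ _ _).symm

omit [Algebra ℚ R] in
/-- The map `α ↦ α + q ∪ α` is compatible with shuffles if `q` is multiplicative. -/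
lemma add_cup_sh' {α q : TensorAlgebra R H →ₗ[R] A.carrier} (hα : ShZero e dg α)
    (hαd : ∀ w, α (E e w) ∈ A.gr (wdeg dg w + 1)) (hq1 : q 1 = 0)
    (hqd : ∀ w, q (E e w) ∈ A.gr (wdeg dg w))
    (hq : ∀ u v, u ≠ [] → v ≠ [] → q (sh e dg u v) = A.mul (q (E e u)) (q (E e v)))
    {x y : List B} (hx : x ≠ []) (hy : y ≠ []) :
    (α + cup e A.mul (q ∘ₗ sgn e dg) α) (sh e dg x y) =
      A.mul ((α + cup e A.mul (q ∘ₗ sgn e dg) α) (E e x)) (q (E e y)) +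
      chi R (par dg x) • A.mul (q (E e x)) ((α + cup e A.mul (q ∘ₗ sgn e dg) α) (E e y)) := by
  simp only [LinearMap.add_apply, hα.2 x y hx hy, zero_add, cup_E]
  rw [cup_eq, splT_sh_right e dg (hα.compl₁₂_right A.mul _)]
  have hs : ∀ u v, sgn e dg (sh e dg u v) = chi R (par dg u + par dg v) • sh e dg u v := by
    intro u v
    rw [sgn_of_mem (sh_mem_TD e dg u v)]
    push_cast
    rfl
  simp only [LinearMap.compl₁₂_apply, LinearMap.comp_apply, hs, map_smul, LinearMap.smul_apply,
    smul_smul, ← chi_add, sgn_E]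
  have e1 : ∀ u v, u ++ v = x → chi R (par dg y * par dg v + (par dg u + par dg y)) •
      A.mul (q (sh e dg u y)) (α (E e v)) =
      (if u = [] then A.mul (α (E e v)) (q (E e y)) else 0) +
      A.mul (chi R (par dg u) • A.mul (q (E e u)) (α (E e v))) (q (E e y)) := by
    intro u v huv
    have key : A.mul (α (E e v)) (q (E e y)) =
        chi R ((par dg v + 1) * par dg y) • A.mul (q (E e y)) (α (E e v)) := by
      rw [A.mul_comm_chi (hαd v) (hqd y)]
      push_cast
      rfl
    have key2 : ∀ i j k : ZMod 2, k * j + (i + k) = i + (j + 1) * k := by decide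
    split_ifs with hu
    · subst hu
      simp only [sh_nil_left, E_nil, hq1, map_zero, LinearMap.zero_apply, smul_zero, add_zero]
      rw [key, key2, par_nil, zero_add]
    · rw [hq u y hu hy, zero_add, A.mul_assoc, map_smul, LinearMap.smul_apply, A.mul_assoc, key,
        map_smul, smul_smul, ← chi_add, ← key2]
  have e2 : ∀ u v, u ++ v = y → chi R (par dg x + par dg u) •
      A.mul (q (sh e dg x u)) (α (E e v)) =
      chi R (par dg x) • ((if u = [] then A.mul (q (E e x)) (α (E e v)) else 0) +
      A.mul (q (E e x)) (chi R (par dg u) • A.mul (q (E e u)) (α (E e v)))) := by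
    intro u v huv
    split_ifs with hu
    · subst hu
      simp [hq1]
    · rw [hq x u hx hu, zero_add, A.mul_assoc, chi_add, mul_smul, map_smul]
  rw [spl_congr e1, spl_congr e2, spl_add, ← smul_spl, spl_add, spl_ite_left,
    spl_ite_left]
  simp only [map_add, LinearMap.add_apply, map_spl]
  congr 2
  exact (spl_apply _ _ _).symm

/-- Multiply by `|x| + |y|`, apply the equation of `gauge_eq`, and use `add_cup_sh` with the
inductive hypothesis. The result is `|x| q(x) q(y) + q(x) |y| q(y)`, and the length is invertible.
-/
lemma gauge_sh {θ : TensorAlgebra R H →ₗ[R] A.carrier} (hθ : ShZero e dg θ)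
    (hdeg : ∀ w, θ (E e w) ∈ A.gr (wdeg dg w)) (x y : List B) (hx : x ≠ []) (hy : y ≠ []) :
    gauge e θ (sh e dg x y) = A.mul (gauge e θ (E e x)) (gauge e θ (E e y)) := by
  induction hn : x.length + y.length using Nat.strong_induction_on generalizing x y with
  | _ k ih =>
    subst hn
    have h1 := add_cup_sh (k := 0) hθ (by simpa using hdeg) (gauge_one e θ) (gauge_mem hθ.1 hdeg)
      hx hy (fun u v hu hv huv => ih _ huv u v hu hv rfl)
    have h2 : ∀ z ∈ TG e dg (x.length + y.length) (wdeg dg x + wdeg dg y),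
        ((x.length + y.length : ℕ) : R) • gauge e θ z = (θ + cup e A.mul θ (gauge e θ)) z := by
      intro z hz
      induction hz using Submodule.span_induction with
      | mem z hz => obtain ⟨w, ⟨hw, -⟩, rfl⟩ := hz; rw [← hw]; exact gauge_eq e hθ.1 w
      | zero => simp
      | add a b _ _ ha hb => rw [map_add, map_add, smul_add, ha, hb]
      | smul c a _ ha => rw [map_smul, map_smul, smul_comm, ha]
    have hl : x.length + y.length ≠ 0 := by
      have := List.length_pos_iff.2 hx
      omega
    rw [← natInv_smul_cast (R := R) hl (gauge e θ (sh e dg x y)), h2 _ (sh_mem_TG e dg x y), h1,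
      LinearMap.add_apply, LinearMap.add_apply, ← gauge_eq e hθ.1, ← gauge_eq e hθ.1]
    simp only [Int.cast_zero, zero_mul, chi_zero, one_smul, map_smul, LinearMap.smul_apply]
    rw [← add_smul, ← Nat.cast_add, natInv_smul_cast hl]

-- Words are a basis, but the empty word is excluded by hypothesis; composing with the projection
-- `p` onto the augmentation ideal removes it from both variables.
omit [Algebra ℚ R] in
lemma shT_of_aug {X : Type*} [AddCommGroup X] [Module R X] {α : TensorAlgebra R H →ₗ[R] X}
    {F : TensorAlgebra R H →ₗ[R] TensorAlgebra R H →ₗ[R] X}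
    (h : ∀ x y, x ≠ [] → y ≠ [] → α (sh e dg x y) = F (E e x) (E e y)) {x y : TensorAlgebra R H}
    (hx : aug e x = 0) (hy : aug e y = 0) : α (shT e dg x y) = F x y := by
  let p : TensorAlgebra R H →ₗ[R] TensorAlgebra R H :=
    LinearMap.id - (Algebra.linearMap R _) ∘ₗ aug e
  have hp : ∀ z, aug e z = 0 → p z = z := fun z hz => by simp [p, hz]
  have key : ((shT e dg).compr₂ α).compl₁₂ p p = F.compl₁₂ p p := by
    refine ext_E (e := e) fun u => ext_E (e := e) fun v => ?_
    have haug : ∀ w : List B, w ≠ [] → p (E e w) = E e w := fun w hw => hp _ (by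
      rw [aug, lin_E, if_neg hw])
    have hnil : p 1 = 0 := by
      have : aug e (1 : TensorAlgebra R H) = 1 := by rw [← E_nil e, aug, lin_E, if_pos rfl]
      simp [p, this]
    rcases eq_or_ne u [] with rfl | hu
    · simp [hnil]
    rcases eq_or_ne v [] with rfl | hv
    · simp [hnil]
    simp only [LinearMap.compl₁₂_apply, haug u hu, haug v hv, LinearMap.compr₂_apply, shT_E,
      h u v hu hv]
  have := LinearMap.congr_fun (LinearMap.congr_fun key x) y
  simpa only [LinearMap.compl₁₂_apply, hp x hx, hp y hy, LinearMap.compr₂_apply] using this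

end Gauge

/-! ### The gauge equation between twisting cochains and its defect. -/

section GaugeDefect

open TensorAlgebra

variable {R : Type u} [CommRing R] (A : CDGAlg.{u, v} R)
  {H : Type*} [AddCommGroup H] [Module R H]
  {B : Type*} (e : Module.Basis B R H) (dg : B → ℤ)

/-- The defect `dq + q ∘ D - τ' - τ' ∪ q + τ + q ∪ τ` of the equation saying that `1 + q` is a
gauge transformation between the twisting cochains `τ` and `τ'`. -/
def gaugeDefect (b : TensorAlgebra R H →ₗ[R] H) (τ q τ' : TensorAlgebra R H →ₗ[R] A.carrier) :
    TensorAlgebra R H →ₗ[R] A.carrier :=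
  A.d ∘ₗ q + q ∘ₗ coder e dg b - (τ' + cup e A.mul τ' q) + (τ + cup e A.mul (q ∘ₗ sgn e dg) τ)

variable {A e dg}

lemma gaugeDefect_add {b : TensorAlgebra R H →ₗ[R] H} (hb : VanishBelow e 2 b)
    {τ q τ' η ζ : TensorAlgebra R H →ₗ[R] A.carrier} (hτ : τ 1 = 0) (hq : q 1 = 0)
    (hτ' : τ' 1 = 0) {m : ℕ} (hm : 1 ≤ m) (hη : VanishBelow e m η) (hζ : VanishBelow e m ζ)
    (w : List B) (hw : w.length ≤ m) :
    gaugeDefect A e dg b τ (q + η) (τ' + ζ) (E e w) =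
      gaugeDefect A e dg b τ q τ' (E e w) + A.d (η (E e w)) - ζ (E e w) := by
  have hη1 : η 1 = 0 := hη [] (by simp; omega)
  have e1 : η (coder e dg b (E e w)) = 0 := hη.of_mem (TLt_mono hw (coder_mem_TLt hb w))
  have e3 := cup_vanish_left A.mul hζ hq hw
  have e4 := cup_vanish_left A.mul hζ hη1 hw
  have e5 := cup_vanish_right A.mul hτ' hη hw
  have e6 := cup_vanish_left A.mul (hη.comp_sgn dg) hτ hw
  simp only [gaugeDefect, LinearMap.comp_add, LinearMap.add_comp, cup_add_left,
    cup_add_right, LinearMap.sub_apply, LinearMap.add_apply, LinearMap.comp_apply, e1, e3, e4, e5,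
    e6]
  abel

/-- Bianchi identity for the gauge equation. Here `τ` is a twisting cochain, while `r` measures how
far `τ'` is from being one; in the application `r` is the failure of `G` to be a morphism. -/
lemma d_gaugeDefect {b : TensorAlgebra R H →ₗ[R] H} (hb : b 1 = 0)
    (hdeg : ∀ w, b (E e w) ∈ HD e dg (wdeg dg w + 1)) (hbb : coder e dg b ∘ₗ coder e dg b = 0)
    {τ q τ' r : TensorAlgebra R H →ₗ[R] A.carrier}
    (hqd : ∀ w, q (E e w) ∈ A.gr (wdeg dg w)) (hτd' : ∀ w, τ' (E e w) ∈ A.gr (wdeg dg w + 1))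
    (hτ : A.d ∘ₗ τ = τ ∘ₗ coder e dg b + cup e A.mul (τ ∘ₗ sgn e dg) τ)
    (hτ' : A.d ∘ₗ τ' = τ' ∘ₗ coder e dg b + cup e A.mul (τ' ∘ₗ sgn e dg) τ' + r) :
    A.d ∘ₗ gaugeDefect A e dg b τ q τ' = gaugeDefect A e dg b τ q τ' ∘ₗ coder e dg b - r -
      cup e A.mul r q + cup e A.mul (τ' ∘ₗ sgn e dg) (gaugeDefect A e dg b τ q τ') +
      cup e A.mul (gaugeDefect A e dg b τ q τ' ∘ₗ sgn e dg) τ := by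
  set Q := gaugeDefect A e dg b τ q τ' with hQ
  have hSS : ∀ α : TensorAlgebra R H →ₗ[R] A.carrier, (α ∘ₗ sgn e dg) ∘ₗ sgn e dg = α := by
    intro α; ext z; simp
  have hqS : ∀ w, (q ∘ₗ sgn e dg) (E e w) ∈ A.gr (wdeg dg w + 0) := fun w => by
    rw [LinearMap.comp_apply, sgn_E, map_smul, add_zero]
    exact Submodule.smul_mem _ _ (hqd w)
  have hSB : ∀ α : TensorAlgebra R H →ₗ[R] A.carrier, (α ∘ₗ sgn e dg) ∘ₗ coder e dg b =
      - ((α ∘ₗ coder e dg b) ∘ₗ sgn e dg) := fun α => by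
    rw [LinearMap.comp_assoc, sgn_coder e dg hdeg, LinearMap.comp_neg, LinearMap.comp_assoc]
  have hD : A.d ∘ₗ q = Q - q ∘ₗ coder e dg b + (τ' + cup e A.mul τ' q) -
      (τ + cup e A.mul (q ∘ₗ sgn e dg) τ) := by
    rw [hQ, gaugeDefect]; abel
  have h1 : A.d ∘ₗ Q = (A.d ∘ₗ q) ∘ₗ coder e dg b - (A.d ∘ₗ τ' + cup e A.mul (A.d ∘ₗ τ') q -
      cup e A.mul (τ' ∘ₗ sgn e dg) (A.d ∘ₗ q)) + (A.d ∘ₗ τ +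
      (cup e A.mul ((A.d ∘ₗ q) ∘ₗ sgn e dg) τ + cup e A.mul q (A.d ∘ₗ τ))) := by
    conv_lhs => rw [hQ, gaugeDefect]
    rw [LinearMap.comp_add, LinearMap.comp_sub, LinearMap.comp_add, LinearMap.comp_add,
      LinearMap.comp_add, d_cup A hqS, hSS, d_cup A hτd', ← LinearMap.comp_assoc,
      ← LinearMap.comp_assoc, ← LinearMap.comp_assoc, d_comp_d, LinearMap.zero_comp]
    simp only [Int.cast_one, chi_one, neg_smul, one_smul, Int.cast_zero, chi_zero]
    abel
  have hqBB : (q ∘ₗ coder e dg b) ∘ₗ coder e dg b = 0 := by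
    rw [LinearMap.comp_assoc, hbb, LinearMap.comp_zero]
  rw [h1, hD, hτ, hτ']
  simp only [LinearMap.add_comp, LinearMap.sub_comp, cup_add_left, cup_add_right, cup_sub_left,
    cup_sub_right, cup_coder e dg A.mul _ _ hb, hSS, hSB, hqBB,
    cup_sgn, cup_neg_left, cup_assoc e A.mul A.mul_assoc]
  abel

/-- Each of the four constituents is a derivation relative to the multiplicative map `q`. Hence the
defect is not zero on shuffles, but its values there involve the defect on strictly shorter words
only. -/
lemma gaugeDefect_sh {b : TensorAlgebra R H →ₗ[R] H} (hb : ShZero e dg b)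
    (hdeg : ∀ w, b (E e w) ∈ HD e dg (wdeg dg w + 1))
    {τ q τ' : TensorAlgebra R H →ₗ[R] A.carrier} (hq1 : q 1 = 0)
    (hqd : ∀ w, q (E e w) ∈ A.gr (wdeg dg w))
    (hq : ∀ u v, u ≠ [] → v ≠ [] → q (sh e dg u v) = A.mul (q (E e u)) (q (E e v)))
    (hτ : ShZero e dg τ) (hτd : ∀ w, τ (E e w) ∈ A.gr (wdeg dg w + 1))
    (hτ' : ShZero e dg τ') (hτd' : ∀ w, τ' (E e w) ∈ A.gr (wdeg dg w + 1)) {x y : List B}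
    (hx : x ≠ []) (hy : y ≠ []) :
    gaugeDefect A e dg b τ q τ' (sh e dg x y) =
      A.mul (gaugeDefect A e dg b τ q τ' (E e x)) (q (E e y)) +
      chi R (par dg x) • A.mul (q (E e x)) (gaugeDefect A e dg b τ q τ' (E e y)) := by
  have haug : ∀ w : List B, w ≠ [] → aug e (E e w) = 0 := fun w hw => by
    rw [aug, lin_E, if_neg hw]
  have hF : ∀ x y, x ≠ [] → y ≠ [] → q (sh e dg x y) = A.mul.compl₁₂ q q (E e x) (E e y) := hq
  rw [gaugeDefect, LinearMap.add_apply, LinearMap.sub_apply, LinearMap.add_apply,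
    add_cup_sh' hτ hτd hq1 hqd hq hx hy,
    add_cup_sh (k := 1) hτ' hτd' hq1 hqd hx hy (fun u v hu hv _ => hq u v hu hv),
    LinearMap.comp_apply, LinearMap.comp_apply, hq x y hx hy, A.leibniz_chi (hqd x),
    coder_sh e dg hb hdeg, map_add, map_smul, shT_of_aug hF (aug_coder e dg b _) (haug y hy),
    shT_of_aug hF (haug x hx) (aug_coder e dg b _)]
  simp only [LinearMap.add_apply, LinearMap.sub_apply, LinearMap.compl₁₂_apply, map_add, map_sub,
    LinearMap.comp_apply, smul_add, smul_sub, Int.cast_one, one_mul]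
  change _ + chi R (par dg x) • _ + _ - _ + _ = _
  abel

end GaugeDefect

/-! ### Lifting a twisting cochain to a morphism into a minimal model. -/

section Extension

open TensorAlgebra

variable {R : Type u} [CommRing R] [Algebra ℚ R] {A : CDGAlg.{u, v} R}
  {H : Type*} [AddCommGroup H] [Module R H]
  {B : Type*} {e : Module.Basis B R H} {dg : B → ℤ}
  {B' : Type*} {e' : Module.Basis B' R A.Cohomology} {dg' : B' → ℤ}
  {b : TensorAlgebra R H →ₗ[R] H} {τ : TensorAlgebra R H →ₗ[R] A.carrier}
  {b' : TensorAlgebra R A.Cohomology →ₗ[R] A.Cohomology}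
  {f : TensorAlgebra R A.Cohomology →ₗ[R] A.carrier}

variable (A e dg b τ) in
/-- A twisting cochain on the bar construction of a minimal `C_∞`-algebra. -/
structure IsTwisting : Prop where
  shb : ShZero e dg b
  shτ : ShZero e dg τ
  degb : ∀ w, b (E e w) ∈ HD e dg (wdeg dg w + 1)
  degτ : ∀ w, τ (E e w) ∈ A.gr (wdeg dg w + 1)
  low : VanishBelow e 2 b
  eq : A.d ∘ₗ τ = τ ∘ₗ coder e dg b + cup e A.mul (τ ∘ₗ sgn e dg) τ
  sq : b ∘ₗ coder e dg b = 0

omit [Algebra ℚ R] in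
lemma IsTwisting.coder_coder (h : IsTwisting A e dg b τ) : coder e dg b ∘ₗ coder e dg b = 0 :=
  CInf.coder_coder e dg h.shb.1 h.degb h.sq

variable (A e dg e' dg' b τ f) in
/-- The defect of the equation for the pair consisting of a morphism `G` and the gauge
transformation generated by `θ`. -/
abbrev extDefect (G : TensorAlgebra R H →ₗ[R] A.Cohomology)
    (θ : TensorAlgebra R H →ₗ[R] A.carrier) : TensorAlgebra R H →ₗ[R] A.carrier :=
  gaugeDefect A e dg b τ (gauge e θ) (f ∘ₗ comap e G)

omit [Algebra ℚ R] in
lemma comp_comap_mem (hf : ∀ w, f (E e' w) ∈ A.gr (wdeg dg' w + 1))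
    {G : TensorAlgebra R H →ₗ[R] A.Cohomology} (hG : G 1 = 0)
    (hGd : ∀ w, G (E e w) ∈ HD e' dg' (wdeg dg w)) (w : List B) :
    (f ∘ₗ comap e G) (E e w) ∈ A.gr (wdeg dg w + 1) :=
  TD_map_mem hf (comap_mem_TD e dg e' dg' hG hGd w)

omit [Algebra ℚ R] in
lemma comp_comap_shZero (hf : ShZero e' dg' f)
    {G : TensorAlgebra R H →ₗ[R] A.Cohomology} (hG : ShZero e dg G)
    (hGd : ∀ w, G (E e w) ∈ HD e' dg' (wdeg dg w)) : ShZero e dg (f ∘ₗ comap e G) :=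
  ⟨by simp [hf.1], fun x y hx hy => by
    rw [LinearMap.comp_apply, comap_sh e dg e' dg' hG hGd, hf.shT (aug_comap e e' hG.1 hx)
      (aug_comap e e' hG.1 hy)]⟩

/-- As in `corestriction_vanish`: in the lowest length `d Q(w) = -r(w)`, and `r(w)` is the chosen
cocycle of the class by which `G` fails to be a morphism. A class represented by a coboundary is
zero. -/
lemma ext_vanish (h : IsTwisting A e dg b τ) (h' : IsTwisting A e' dg' b' f)
    (hcls : A.ChoosesCocycles (f ∘ₗ ι R)) {G : TensorAlgebra R H →ₗ[R] A.Cohomology}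
    {θ : TensorAlgebra R H →ₗ[R] A.carrier} (hG : G 1 = 0)
    (hGd : ∀ w, G (E e w) ∈ HD e' dg' (wdeg dg w)) (hθ : θ 1 = 0)
    (hθd : ∀ w, θ (E e w) ∈ A.gr (wdeg dg w)) {n : ℕ}
    (hQ : VanishBelow e n (extDefect A e dg b τ f G θ)) :
    ∀ w : List B, w.length ≤ n → b' (comap e G (E e w)) = G (coder e dg b (E e w)) ∧
      A.d (extDefect A e dg b τ f G θ (E e w)) = 0 := by
  let r := f ∘ₗ (coder e' dg' b' ∘ₗ comap e G - comap e G ∘ₗ coder e dg b)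
  have hτ' : A.d ∘ₗ (f ∘ₗ comap e G) = (f ∘ₗ comap e G) ∘ₗ coder e dg b +
      cup e A.mul ((f ∘ₗ comap e G) ∘ₗ sgn e dg) (f ∘ₗ comap e G) + r := by
    rw [← LinearMap.comp_assoc, h'.eq, LinearMap.add_comp, cup_comap e e' A.mul _ _ hG,
      show (f ∘ₗ sgn e' dg') ∘ₗ comap e G = f ∘ₗ (sgn e' dg' ∘ₗ comap e G) from rfl,
      sgn_comap e dg e' dg' hG hGd]
    simp only [r, LinearMap.comp_sub, LinearMap.comp_assoc]
    abel
  have hd := d_gaugeDefect h.shb.1 h.degb h.coder_coder (gauge_mem hθ hθd)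
    (comp_comap_mem h'.degτ hG hGd) h.eq hτ'
  intro w
  induction hk : w.length using Nat.strong_induction_on generalizing w with
  | _ k ih =>
    subst hk
    intro hw
    have hN := intertwine_of_vanish e dg h.shb.1 hG (n := w.length)
      (coder_comap e dg e' dg' h'.shb.1 hG hGd) (fun u hu => (ih _ hu u rfl (by omega)).1)
    have hr : ∀ u : List B, u.length ≤ w.length →
        r (E e u) = f (ι R (b' (comap e G (E e u)) - G (coder e dg b (E e u)))) := fun u hu => by
      rw [← hN u hu]; rfl
    have hrv : VanishBelow e w.length r := fun u hu => by
      rw [hr u hu.le, (ih _ hu u rfl (by omega)).1, sub_self, map_zero, map_zero]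
    have h2 := LinearMap.congr_fun hd (E e w)
    simp only [LinearMap.add_apply, LinearMap.sub_apply, LinearMap.comp_apply] at h2
    rw [hQ.of_mem (TLt_mono hw (coder_mem_TLt h.low w)),
      cup_vanish_left A.mul hrv (gauge_one e θ) le_rfl,
      cup_vanish_left A.mul (hQ.comp_sgn dg) h.shτ.1 hw,
      cup_vanish_right A.mul (by simp [h'.shτ.1]) hQ hw, hr w le_rfl] at h2
    simp only [zero_sub, sub_zero, add_zero] at h2
    have h3 : b' (comap e G (E e w)) - G (coder e dg b (E e w)) = 0 := by
      obtain ⟨hz, hcl⟩ := hcls (b' (comap e G (E e w)) - G (coder e dg b (E e w)))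
      rw [← hcl]
      refine (Submodule.Quotient.mk_eq_zero _).2 ⟨- extDefect A e dg b τ f G θ (E e w), ?_⟩
      rw [map_neg, h2, neg_neg]
      rfl
    refine ⟨sub_eq_zero.1 h3, ?_⟩
    rw [h2, h3]
    simp

variable (A e dg e' dg' b τ f) in
/-- Approximate solutions of the extension problem. -/
structure IsPreExt (G : TensorAlgebra R H →ₗ[R] A.Cohomology)
    (θ : TensorAlgebra R H →ₗ[R] A.carrier) : Prop where
  shG : ShZero e dg G
  shθ : ShZero e dg θ
  degG : ∀ w, G (E e w) ∈ HD e' dg' (wdeg dg w)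
  degθ : ∀ w, θ (E e w) ∈ A.gr (wdeg dg w)

/-- The class part of the defect is absorbed by changing `G`, and the coboundary part by changing
the generator `θ` of the gauge transformation. -/
lemma exists_ext_step (hHD : ∀ i, HD e' dg' i = A.cohomologyGr (i + 1))
    (h : IsTwisting A e dg b τ) (h' : IsTwisting A e' dg' b' f)
    (hcls : A.ChoosesCocycles (f ∘ₗ ι R)) {G : TensorAlgebra R H →ₗ[R] A.Cohomology}
    {θ : TensorAlgebra R H →ₗ[R] A.carrier} (hP : IsPreExt A e dg e' dg' G θ) {n : ℕ}
    (hQ : VanishBelow e (n + 1) (extDefect A e dg b τ f G θ)) :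
    ∃ G' θ', (IsPreExt A e dg e' dg' G' θ' ∧ VanishBelow e (n + 2) (extDefect A e dg b τ f G' θ')) ∧
      VanishBelow e (n + 1) (G' - G) ∧ VanishBelow e (n + 1) (θ' - θ) := by
  have hφdeg : ∀ i x, x ∈ A.cohomologyGr i → (f ∘ₗ ι R) x ∈ A.gr i := by
    intro i x hx
    have h1 := hHD (i - 1)
    rw [sub_add_cancel] at h1
    rw [← h1] at hx
    simpa using TD_map_mem h'.degτ (ι_mul_mem_TD hx (mem_TD e' dg' []))
  set Q := extDefect A e dg b τ f G θ
  have hqd := gauge_mem hP.shθ.1 hP.degθ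
  have hτd := comp_comap_mem h'.degτ hP.shG.1 hP.degG
  have hQd : ∀ w, trunc e (n + 1) Q (E e w) ∈ A.gr (wdeg dg w + 0 + 1) := fun w => by
    rw [trunc_E]
    split_ifs
    · rw [add_zero]
      refine add_mem (sub_mem (add_mem (A.d_mem (hqd w)) ?_) (add_mem (hτd w) ?_))
        (add_mem (h.degτ w) ?_)
      · have := TD_map_mem (k := 0) (by simpa using hqd) (coder_mem_TD e dg h.degb w)
        rwa [add_zero] at this
      · rw [cup_E]
        refine spl_mem _ fun u v huv => ?_
        convert A.mul_mem (hτd u) (hqd v) using 2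
        rw [← huv, wdeg_append]; ring
      · rw [cup_E]
        refine spl_mem _ fun u v huv => ?_
        rw [LinearMap.comp_apply, sgn_E, map_smul, map_smul, LinearMap.smul_apply]
        refine Submodule.smul_mem _ _ ?_
        convert A.mul_mem (hqd u) (h.degτ v) using 2
        rw [← huv, wdeg_append]; ring
    · exact zero_mem _
  -- Only the part of lowest length vanishes on shuffles: there `gaugeDefect_sh` expresses the value
  -- through `Q` on shorter words, where `Q` is zero.
  have hQsh : ShZero e dg (trunc e (n + 1) Q) := by
    refine ⟨by rw [← E_nil e, trunc_E]; simp, fun x y hx hy => ?_⟩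
    have := lin_of_mem_TG (fun l _ => if l = n + 1 then LinearMap.id else (0 : A.carrier →ₗ[R] _)) Q
      (sh_mem_TG e dg x y)
    have h2 : trunc e (n + 1) Q = lin e (fun w => (if w.length = n + 1 then LinearMap.id else
        (0 : A.carrier →ₗ[R] _)) (Q (E e w))) := ext_E (e := e) fun w => by
      rw [trunc_E, lin_E]
      split_ifs <;> rfl
    rw [h2, this]
    split_ifs with hl
    · have hx' := List.length_pos_iff.2 hx
      have hy' := List.length_pos_iff.2 hy
      rw [LinearMap.id_apply, gaugeDefect_sh h.shb h.degb (gauge_one e θ) hqd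
        (gauge_sh hP.shθ hP.degθ) h.shτ h.degτ (comp_comap_shZero h'.shτ hP.shG hP.degG) hτd hx hy]
      change A.mul (Q _) _ + _ • A.mul _ (Q _) = 0
      rw [hQ x (by omega), hQ y (by omega)]
      simp
    · rfl
  have hcoc := ext_vanish h h' hcls hP.shG.1 hP.degG hP.shθ.1 hP.degθ hQ
  obtain ⟨δ, ε, hδ, hε, hδv, hεv, hδd, hεd, hQe⟩ := exists_class_add_coboundary (k := 0)
    (n := n + 1) hQsh hQd (fun w hw => by rw [trunc_E, if_pos hw]; exact (hcoc w hw.le).2)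
    hcls hφdeg
  -- The factor `n + 1` compensates the division by the length in `gauge_add`, so that `q` changes
  -- by `-ε`.
  let ε' := -((n + 1 : ℕ) : R) • ε
  have hε' : ShZero e dg ε' := hε.comp (-((n + 1 : ℕ) : R) • LinearMap.id)
  have hεv' : VanishBelow e (n + 1) ε' := fun w hw => by
    simp [ε', hεv w hw]
  refine ⟨G + δ, θ + ε', ⟨⟨hP.shG.add hδ, hP.shθ.add hε', fun w => ?_, fun w => ?_⟩,
    fun w hw => ?_⟩, ?_, ?_⟩
  · refine add_mem (hP.degG w) ?_
    rw [hHD]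
    simpa using hδd w
  · exact add_mem (hP.degθ w) (Submodule.smul_mem _ _ (by simpa using hεd w))
  · have hg := gauge_add hP.shθ.1 hε'.1 hεv'
    have hc := comap_add_vanish hP.shG.1 hδ.1 hδv
    have hη : VanishBelow e (n + 1) (gauge e (θ + ε') - gauge e θ) := fun u hu => by
      rw [LinearMap.sub_apply, hg u hu.le, hεv' u hu]
      simp
    have hζ : VanishBelow e (n + 1) (f ∘ₗ comap e (G + δ) - f ∘ₗ comap e G) := fun u hu => by
      rw [LinearMap.sub_apply, LinearMap.comp_apply, hc u hu.le, hδv u hu]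
      simp
    have key := gaugeDefect_add h.low h.shτ.1 (gauge_one e θ) (τ' := f ∘ₗ comap e G)
      (by simp [h'.shτ.1]) (Nat.le_add_left 1 n) hη hζ w (by omega) (dg := dg)
    rw [add_sub_cancel, add_sub_cancel] at key
    rw [extDefect, key]
    change Q (E e w) + _ - _ = 0
    rcases Nat.lt_succ_iff_lt_or_eq.1 hw with hlt | heq
    · rw [hQ w hlt, hη w hlt, hζ w hlt]
      simp
    · have h1 := hQe w heq
      rw [trunc_E, if_pos heq] at h1
      rw [h1]
      simp only [LinearMap.sub_apply, LinearMap.comp_apply, hc w heq.le, hg w heq.le, heq]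
      simp only [ε', LinearMap.smul_apply, neg_smul, LinearMap.neg_apply, smul_neg, map_add,
        natInv_smul_cast (Nat.succ_ne_zero n), add_sub_cancel_left, map_neg]
      abel
  · simpa using hδv
  · simpa using hεv'

/-- A twisting cochain with values in `A` lifts, up to a gauge transformation, to a morphism into
the minimal model of `A`. -/
lemma exists_ext (hHD : ∀ i, HD e' dg' i = A.cohomologyGr (i + 1))
    (h : IsTwisting A e dg b τ) (h' : IsTwisting A e' dg' b' f)
    (hcls : A.ChoosesCocycles (f ∘ₗ ι R)) : ∃ G : TensorAlgebra R H →ₗ[R] A.Cohomology,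
      ShZero e dg G ∧ (∀ w, G (E e w) ∈ HD e' dg' (wdeg dg w)) ∧
      b' ∘ₗ comap e G = G ∘ₗ coder e dg b ∧
      ∀ a, ∃ y, f (ι R (G (ι R (e a)))) = τ (ι R (e a)) + A.d y := by
  have h0 : VanishBelow e 1 (extDefect A e dg b τ f 0 0) := by
    intro w hw
    obtain rfl := List.length_eq_zero_iff.1 (Nat.lt_one_iff.1 hw)
    simp only [extDefect, gaugeDefect, LinearMap.add_apply, LinearMap.sub_apply, cup_E, spl_nil,
      LinearMap.comp_apply]
    simp [h.shτ.1, h'.shτ.1]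
  obtain ⟨G, θ, hlim⟩ := exists_limit (fun n G θ => IsPreExt A e dg e' dg' G θ ∧
    VanishBelow e (n + 1) (extDefect A e dg b τ f G θ)) 0 0 0
    ⟨⟨⟨rfl, fun _ _ _ _ => rfl⟩, ⟨rfl, fun _ _ _ _ => rfl⟩, fun _ => zero_mem _,
      fun _ => zero_mem _⟩, h0⟩
    (fun n G θ _ hn => exists_ext_step hHD h h' hcls hn.1 hn.2)
  have hP : IsPreExt A e dg e' dg' G θ := by
    refine ⟨shZero_of_approx 0 fun n hn => ?_, shZero_of_approx 0 fun n hn => ?_, fun w => ?_,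
      fun w => ?_⟩
    · obtain ⟨bn, τn, hP, h1, h2⟩ := hlim n hn
      exact ⟨bn, hP.1.shG, h1⟩
    · obtain ⟨bn, τn, hP, h1, h2⟩ := hlim n hn
      exact ⟨τn, hP.1.shθ, h2⟩
    · obtain ⟨bn, τn, hP, h1, h2⟩ := hlim w.length (by omega)
      have := h1 w (by omega)
      rw [LinearMap.sub_apply, sub_eq_zero] at this
      rw [this]
      exact hP.1.degG w
    · obtain ⟨bn, τn, hP, h1, h2⟩ := hlim w.length (by omega)
      have := h2 w (by omega)
      rw [LinearMap.sub_apply, sub_eq_zero] at this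
      rw [this]
      exact hP.1.degθ w
  have hQ : ∀ w, extDefect A e dg b τ f G θ (E e w) = 0 := by
    intro w
    obtain ⟨Gn, θn, hPn, h1, h2⟩ := hlim w.length (by omega)
    have hg := gauge_add hPn.1.shθ.1 (by simp [hPn.1.shθ.1, hP.shθ.1]) h2
    have hc := comap_add_vanish hPn.1.shG.1 (by simp [hPn.1.shG.1, hP.shG.1]) h1
    rw [add_sub_cancel] at hg hc
    have hη : VanishBelow e (w.length + 1) (gauge e θ - gauge e θn) := fun u hu => by
      rw [LinearMap.sub_apply, hg u hu.le, h2 u hu]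
      simp
    have hζ : VanishBelow e (w.length + 1) (f ∘ₗ comap e G - f ∘ₗ comap e Gn) := fun u hu => by
      rw [LinearMap.sub_apply, LinearMap.comp_apply, hc u hu.le, h1 u hu]
      simp
    have key := gaugeDefect_add h.low h.shτ.1 (gauge_one e θn) (τ' := f ∘ₗ comap e Gn)
      (by simp [h'.shτ.1]) (Nat.le_add_left 1 _) hη hζ w (by omega) (dg := dg)
    rw [add_sub_cancel, add_sub_cancel] at key
    rw [extDefect, key, hη w (by omega), hζ w (by omega), map_zero, add_zero, sub_zero]
    exact hPn.2 w (by omega)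
  refine ⟨G, hP.shG, hP.degG, ext_E (e := e) fun w => ?_, fun a => ⟨gauge e θ (ι R (e a)), ?_⟩⟩
  · exact (ext_vanish h h' hcls hP.shG.1 hP.degG hP.shθ.1 hP.degθ (n := w.length)
      (fun u _ => hQ u) w le_rfl).1
  -- On a letter the gauge equation reads `d q(a) - f(G(a)) + τ(a) = 0`, because the coderivation
  -- and all products vanish there.
  · have := hQ [a]
    have hcod : coder e dg b (E e [a]) = 0 := by
      have := coder_vanish dg h.low h.shb.1 [a] (by simp)
      rw [this, h.low [a] (by simp), map_zero]
    have hcom : comap e G (E e [a]) = ι R (G (E e [a])) := by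
      rw [comap_E e hP.shG.1 (by simp)]
      simp [spl_cons, hP.shG.1]
    simp only [extDefect, gaugeDefect, LinearMap.add_apply, LinearMap.sub_apply, cup_E, spl_cons,
      spl_nil, LinearMap.comp_apply, hcod, hcom] at this
    simp only [E_singleton, E_nil, sgn_one, gauge_one, map_zero, h.shτ.1, LinearMap.zero_apply,
      comap_one, h'.shτ.1, add_zero] at this
    rw [sub_add_eq_add_sub, sub_eq_zero] at this
    rw [← this, add_comm]

end Extension

/-! ### Inverting morphisms that are the identity on letters. -/

section Inverse

open TensorAlgebra

variable {R : Type u} [CommRing R] {H X : Type*} [AddCommGroup H] [Module R H]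
  [AddCommGroup X] [Module R X] {B : Type*} (e : Module.Basis B R H) (dg : B → ℤ)

/-- The projection of the tensor algebra onto the words of length one. -/
def cog : TensorAlgebra R H →ₗ[R] H := lin e fun
  | [a] => e a
  | _ => 0

@[simp] lemma cog_one : cog e 1 = 0 := by rw [← E_nil e, cog, lin_E]

@[simp] lemma cog_ι_mul (x : H) (z : TensorAlgebra R H) : cog e (ι R x * z) = aug e z • x := by
  induction z using word_induction (e := e) with
  | hE w =>
    have hh := e.mem_span x
    induction hh using Submodule.span_induction with
    | mem x hx =>
      obtain ⟨a, rfl⟩ := hx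
      rw [← E_cons, cog, lin_E, aug, lin_E]
      cases w <;> simp
    | zero => simp
    | add x y _ _ hx hy => simp only [map_add, add_mul, hx, hy, smul_add]
    | smul c x _ hx => rw [map_smul, smul_mul_assoc, map_smul, hx, smul_comm]
  | hadd x y hx hy => simp only [mul_add, map_add, hx, hy, add_smul]
  | hsmul c x hx => rw [mul_smul_comm, map_smul, hx, map_smul, smul_eq_mul, mul_smul]

@[simp] lemma aug_one : aug e (1 : TensorAlgebra R H) = 1 := by
  rw [← E_nil e, aug, lin_E, if_pos rfl]

@[simp] lemma cog_ι (x : H) : cog e (ι R x) = x := by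
  have := cog_ι_mul e x 1
  simpa using this

lemma aug_E {w : List B} (hw : w ≠ []) : aug e (E e w) = 0 := by rw [aug, lin_E, if_neg hw]

lemma cog_shZero : ShZero e dg (cog e) :=
  shZero_of_vanish (cog_one e) fun w hw => by
    obtain _ | ⟨a, _ | ⟨b, w⟩⟩ := w
    · simp at hw
    · simp at hw
    · rw [E_cons, cog_ι_mul, aug_E e (by simp), zero_smul]

lemma cog_mem (w : List B) : cog e (E e w) ∈ HD e dg (wdeg dg w) := by
  rw [cog, lin_E]
  obtain _ | ⟨a, _ | ⟨b, w⟩⟩ := w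
  · exact zero_mem _
  · simpa using mem_HD e dg a
  · exact zero_mem _

lemma comap_cog : comap e (cog e) = LinearMap.id := by
  refine ext_E (e := e) fun w => ?_
  induction w with
  | nil => simp
  | cons a w ih =>
    rw [comap_E e (cog_one e) (by simp), spl_cons, spl_eq_left_nil]
    · rw [LinearMap.id_apply] at ih
      simp [ih]
    · intro u v _ hu
      rw [E_cons, cog_ι_mul, aug_E e hu]
      simp

lemma cog_coder {b : TensorAlgebra R H →ₗ[R] H} (hb : b 1 = 0) : cog e ∘ₗ coder e dg b = b := by
  refine ext_E (e := e) fun w => ?_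
  cases w with
  | nil => simp [hb]
  | cons a w =>
    rw [LinearMap.comp_apply, E_cons, coder_cons, ← E_cons, headOp_E, map_add, map_smul, cog_ι_mul,
      aug_coder, zero_smul, smul_zero, add_zero, map_spl, spl_eq_right_nil]
    · simp
    · intro u v _ hv
      rw [cog_ι_mul, aug_E e hv, zero_smul]

variable {H' : Type*} [AddCommGroup H'] [Module R H'] {B' : Type*}
  (e' : Module.Basis B' R H') (dg' : B' → ℤ)

lemma aug_comp_comap {G : TensorAlgebra R H →ₗ[R] H'} (hG : G 1 = 0) :
    aug e' ∘ₗ comap e G = aug e := by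
  refine ext_E (e := e) fun w => ?_
  rcases eq_or_ne w [] with rfl | hw
  · simp
  · rw [LinearMap.comp_apply, aug_comap e e' hG hw, aug_E e hw]

lemma cog_comap {G : TensorAlgebra R H →ₗ[R] H'} (hG : G 1 = 0) : cog e' ∘ₗ comap e G = G := by
  refine ext_E (e := e) fun w => ?_
  rcases eq_or_ne w [] with rfl | hw
  · simp [hG]
  rw [LinearMap.comp_apply, comap_E e hG hw, map_spl, spl_eq_right_nil]
  · simp
  · intro u v _ hv
    rw [cog_ι_mul, aug_comap e e' hG hv, zero_smul]

lemma comap_shT {G : TensorAlgebra R H →ₗ[R] H'} (hG : ShZero e dg G)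
    (hdeg : ∀ w, G (E e w) ∈ HD e' dg' (wdeg dg w)) (x y : TensorAlgebra R H) :
    comap e G (shT e dg x y) = shT e' dg' (comap e G x) (comap e G y) := by
  have : (shT e dg).compr₂ (comap e G) = (shT e' dg').compl₁₂ (comap e G) (comap e G) :=
    ext_E (e := e) fun u => ext_E (e := e) fun v => by
      simp only [LinearMap.compr₂_apply, LinearMap.compl₁₂_apply, shT_E]
      exact comap_sh e dg e' dg' hG hdeg u v
  exact LinearMap.congr_fun (LinearMap.congr_fun this x) y

variable {e dg}

/-- `1 - comap G` shortens words if `G` is the identity on letters. -/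
lemma id_sub_comap_mem {G : TensorAlgebra R H →ₗ[R] H} (hG : G 1 = 0) (hι : ∀ x, G (ι R x) = x)
    (w : List B) : E e w - comap e G (E e w) ∈ TLt e w.length := by
  induction hn : w.length using Nat.strong_induction_on generalizing w with
  | _ k ih =>
    subst hn
    cases w with
    | nil => simp
    | cons a w =>
      rw [comap_E e hG (by simp), spl_cons, E_nil, hG, map_zero, zero_mul,
        zero_add]
      have key : spl (fun u v => ι R (G (E e (a :: u))) * comap e G (E e v)) w -
          ι R (e a) * comap e G (E e w) ∈ TLt e (w.length + 1) := by
        have h1 : ι R (e a) * comap e G (E e w) = spl (fun u v => if u = [] then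
            ι R (G (E e (a :: u))) * comap e G (E e v) else 0) w := by
          rw [spl_ite_left]
          simp [hι]
        rw [h1, ← spl_sub]
        refine spl_mem _ fun u v huv => ?_
        split_ifs with hu
        · simp
        · rw [sub_zero]
          have hlt := length_lt_right huv hu
          have h2 := ih v.length (by simp; omega) v rfl
          have h3 : comap e G (E e v) ∈ TLt e (v.length + 1) := by
            have : comap e G (E e v) = E e v - (E e v - comap e G (E e v)) := by simp
            rw [this]
            exact sub_mem (mem_TLt (by simp)) (TLt_mono (by omega) h2)
          exact TLt_mono (by omega) (ι_mul_mem_TLt _ h3)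
      have h4 := ι_mul_mem_TLt (e a) (ih w.length (by simp) w rfl)
      rw [mul_sub] at h4
      rw [E_cons]
      have := sub_mem h4 key
      rwa [sub_sub_sub_cancel_right] at this

lemma pow_mem_TLt {N : TensorAlgebra R H →ₗ[R] TensorAlgebra R H}
    (hN : ∀ w : List B, N (E e w) ∈ TLt e w.length) (k : ℕ) {n : ℕ} {z : TensorAlgebra R H}
    (hz : z ∈ TLt e (n + k)) : (N ^ k) z ∈ TLt e n := by
  induction k generalizing z with
  | zero => simpa using hz
  | succ k ih =>
    rw [pow_succ, Module.End.mul_apply]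
    refine ih ?_
    induction hz using Submodule.span_induction with
    | mem x hx =>
      obtain ⟨w, hw, rfl⟩ := hx
      simp only [Set.mem_ofPred_eq] at hw
      exact TLt_mono (by omega) (hN w)
    | zero => simp
    | add x y _ _ hx hy => rw [map_add]; exact add_mem hx hy
    | smul c x _ hx => rw [map_smul]; exact Submodule.smul_mem _ _ hx

/-- An endomorphism that differs from the identity by a map that shortens words is invertible. -/
lemma exists_inverse {F : TensorAlgebra R H →ₗ[R] TensorAlgebra R H}
    (hF : ∀ w : List B, E e w - F (E e w) ∈ TLt e w.length)
    (hdeg : ∀ w, F (E e w) ∈ TD e dg (wdeg dg w)) :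
    ∃ J : TensorAlgebra R H →ₗ[R] TensorAlgebra R H, F ∘ₗ J = LinearMap.id ∧
      J ∘ₗ F = LinearMap.id ∧ ∀ w, J (E e w) ∈ TD e dg (wdeg dg w) := by
  set N : TensorAlgebra R H →ₗ[R] TensorAlgebra R H := LinearMap.id - F with hN
  replace hF : ∀ w : List B, N (E e w) ∈ TLt e w.length := hF
  -- The geometric series for `F = 1 - N`. It is finite on each word because every application of
  -- `N` lowers the length.
  let J := lin e fun w => ∑ k ∈ Finset.range (w.length + 1), (N ^ k) (E e w)
  have hzero : ∀ (w : List B) (k : ℕ), w.length < k → (N ^ k) (E e w) = 0 := fun w k hk => by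
    have h1 := pow_mem_TLt hF k (n := 0) (z := E e w) (mem_TLt (by omega))
    simpa [TLt] using h1
  have hJ : ∀ (n : ℕ) (w : List B), w.length < n →
      J (E e w) = (∑ k ∈ Finset.range n, N ^ k) (E e w) := fun n w hw => by
    rw [lin_E, LinearMap.sum_apply]
    refine Finset.sum_subset (Finset.range_mono hw) fun k _ hk => hzero w k ?_
    simp at hk
    omega
  have hJ' : ∀ (n : ℕ) {z : TensorAlgebra R H}, z ∈ TLt e n →
      J z = (∑ k ∈ Finset.range n, N ^ k) z := fun n z hz => by
    induction hz using Submodule.span_induction with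
    | mem x hx => obtain ⟨w, hw, rfl⟩ := hx; exact hJ n w hw
    | zero => simp
    | add x y _ _ hx hy => rw [map_add, map_add, hx, hy]
    | smul c x _ hx => rw [map_smul, map_smul, hx]
  have hF1 : F = 1 - N := by rw [hN]; exact (sub_sub_cancel _ _).symm
  refine ⟨J, ext_E (e := e) fun w => ?_, ext_E (e := e) fun w => ?_, fun w => ?_⟩
  · rw [LinearMap.comp_apply, hJ _ w (Nat.lt_succ_self _), ← Module.End.mul_apply, hF1,
      mul_neg_geom_sum, LinearMap.sub_apply, hzero w _ (Nat.lt_succ_self _), sub_zero]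
    rfl
  · have h1 : F (E e w) ∈ TLt e (w.length + 1) := by
      have : F (E e w) = E e w - N (E e w) := by simp [hN]
      rw [this]
      exact sub_mem (mem_TLt (by simp)) (TLt_mono (by omega) (hF w))
    rw [LinearMap.comp_apply, hJ' _ h1, ← Module.End.mul_apply, hF1,
      geom_sum_mul_neg, LinearMap.sub_apply, hzero w _ (Nat.lt_succ_self _), sub_zero]
    rfl
  · have hNd : ∀ {i : ℤ} {z : TensorAlgebra R H}, z ∈ TD e dg i → N z ∈ TD e dg i := fun hz => by
      refine TD_induction hz (fun w hw => ?_) (by simp) (fun x y hx hy => ?_) (fun c x hx => ?_)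
      · rw [← hw]; exact sub_mem (mem_TD e dg w) (hdeg w)
      · rw [map_add]; exact add_mem hx hy
      · rw [map_smul]; exact Submodule.smul_mem _ _ hx
    rw [lin_E]
    refine Submodule.sum_mem _ fun k hk => ?_
    clear hk
    induction k with
    | zero => exact mem_TD e dg w
    | succ k ih => rw [pow_succ', Module.End.mul_apply]; exact hNd ih

/-- Morphisms that are the identity on letters are invertible. -/
lemma exists_inverse_morphism {b b' G : TensorAlgebra R H →ₗ[R] H} (hb : b 1 = 0) (hb' : b' 1 = 0)
    (hG : ShZero e dg G) (hdeg : ∀ w, G (E e w) ∈ HD e dg (wdeg dg w))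
    (hι : ∀ x, G (ι R x) = x) (hGb : b' ∘ₗ comap e G = G ∘ₗ coder e dg b) :
    ∃ h : TensorAlgebra R H →ₗ[R] H, ShZero e dg h ∧ (∀ w, h (E e w) ∈ HD e dg (wdeg dg w)) ∧
      b ∘ₗ comap e h = h ∘ₗ coder e dg b' ∧ h ∘ₗ comap e G = cog e ∧ G ∘ₗ comap e h = cog e := by
  obtain ⟨J, hFJ, hJF, hJd⟩ := exists_inverse (e := e) (dg := dg) (id_sub_comap_mem hG.1 hι)
    (comap_mem_TD e dg e dg hG.1 hdeg)
  have haug : aug e ∘ₗ J = aug e := by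
    have := congrArg (· ∘ₗ J) (aug_comp_comap e e hG.1)
    simpa only [LinearMap.comp_assoc, hFJ, LinearMap.comp_id] using this.symm
  have hJ1 : J 1 = 1 := by
    have := LinearMap.congr_fun hJF 1
    simpa using this
  have hh1 : (cog e ∘ₗ J) 1 = 0 := by simp [hJ1]
  have hhG : (cog e ∘ₗ J) ∘ₗ comap e G = cog e := by
    rw [LinearMap.comp_assoc, hJF, LinearMap.comp_id]
  -- The inverse is again a coalgebra map: the coalgebra map with corestriction `cog ∘ J` is a left
  -- inverse of `comap G`, hence equal to `J`.
  have hcomap : comap e (cog e ∘ₗ J) = J := by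
    have h1 := comap_comp e e hG.1 hh1
    rw [hhG, comap_cog] at h1
    have h2 := congrArg (· ∘ₗ J) h1
    simpa only [LinearMap.comp_assoc, hFJ, LinearMap.comp_id, LinearMap.id_comp] using h2.symm
  have hint : coder e dg b' ∘ₗ comap e G = comap e G ∘ₗ coder e dg b :=
    intertwine e dg hb hG.1 (coder_comap e dg e dg hb' hG.1 hdeg)
      (fun w => LinearMap.congr_fun hGb (E e w))
  have hint' : coder e dg b ∘ₗ J = J ∘ₗ coder e dg b' := by
    have h2 := congrArg (fun z => J ∘ₗ z ∘ₗ J) hint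
    simp only [LinearMap.comp_assoc, hFJ, LinearMap.comp_id] at h2
    rw [h2, ← LinearMap.comp_assoc, hJF, LinearMap.id_comp]
  refine ⟨cog e ∘ₗ J, ⟨hh1, fun x y hx hy => ?_⟩, fun w => ?_, ?_, hhG, ?_⟩
  -- Since `comap G` is multiplicative for shuffles, so is its inverse `J`; then `cog` kills the
  -- shuffle of `J x` and `J y`.
  · have h1 : ∀ z, comap e G (J z) = z := LinearMap.congr_fun hFJ
    have h2 : ∀ z, J (comap e G z) = z := LinearMap.congr_fun hJF
    have h3 : ∀ z, aug e (J z) = aug e z := LinearMap.congr_fun haug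
    rw [LinearMap.comp_apply, ← shT_E, ← h1 (E e x), ← h1 (E e y), ← comap_shT e dg e dg hG hdeg, h2]
    exact (cog_shZero e dg).shT (by rw [h3, aug_E e hx]) (by rw [h3, aug_E e hy])
  · have := TD_map_mem (k := 0) (gr := HD e dg) (α := cog e)
      (by simpa using cog_mem e dg) (hJd w)
    rwa [add_zero] at this
  · rw [hcomap, LinearMap.comp_assoc, ← hint', ← LinearMap.comp_assoc, cog_coder e dg hb]
  · rw [hcomap, ← cog_comap e e hG.1, LinearMap.comp_assoc, hFJ, LinearMap.comp_id]

end Inverse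

/-! ### Décalage: families of multilinear maps as linear maps on the tensor algebra. -/

section Sequences

open TensorAlgebra

variable {R : Type u} [CommRing R] {M X Y Z : Type*} [AddCommGroup M] [Module R M]
  [AddCommGroup X] [Module R X] [AddCommGroup Y] [Module R Y] [AddCommGroup Z] [Module R Z]

variable (R) in
/-- The tensor `a 0 ⊗ ⋯ ⊗ a (n - 1)`. -/
def tens : ℕ → (ℕ → M) → TensorAlgebra R M
  | 0, _ => 1
  | n + 1, a => ι R (a 0) * tens n (fun i => a (i + 1))

@[simp] lemma tens_zero (a : ℕ → M) : tens R 0 a = 1 := rfl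

lemma tens_succ (n : ℕ) (a : ℕ → M) :
    tens R (n + 1) a = ι R (a 0) * tens R n (fun i => a (i + 1)) := rfl

lemma tens_congr {n : ℕ} {a a' : ℕ → M} (h : ∀ i < n, a i = a' i) : tens R n a = tens R n a' := by
  induction n generalizing a a' with
  | zero => rfl
  | succ n ih =>
    rw [tens_succ, tens_succ, h 0 (Nat.succ_pos n), ih fun i hi => h (i + 1) (by omega)]

lemma tens_add (r s : ℕ) (a : ℕ → M) :
    tens R (r + s) a = tens R r a * tens R s (fun i => a (r + i)) := by
  induction r generalizing a with
  | zero => simp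
  | succ r ih =>
    rw [Nat.succ_add, tens_succ, ih, tens_succ, mul_assoc]
    congr 2
    refine tens_congr fun i _ => ?_
    congr 1; omega

lemma tens_eq_tprod (n : ℕ) (a : ℕ → M) :
    tens R n a = TensorAlgebra.tprod R M n (fun i => a i) := by
  rw [tprod_apply]
  induction n generalizing a with
  | zero => rfl
  | succ n ih => rw [tens_succ, ih, List.ofFn_succ, List.prod_cons]; rfl

/-- The exponent `∑ (n - 1 - i) p_i` of the sign of the décalage isomorphism. -/
def kap : ℕ → (ℕ → ℤ) → ℤ
  | 0, _ => 0
  | n + 1, p => n * p 0 + kap n (fun i => p (i + 1))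

lemma kap_succ (n : ℕ) (p : ℕ → ℤ) : kap (n + 1) p = n * p 0 + kap n (fun i => p (i + 1)) := rfl

lemma kap_congr {n : ℕ} {p p' : ℕ → ℤ} (h : ∀ i < n, p i = p' i) : kap n p = kap n p' := by
  induction n generalizing p p' with
  | zero => rfl
  | succ n ih =>
    rw [kap_succ, kap_succ, h 0 (Nat.succ_pos n), ih fun i hi => h (i + 1) (by omega)]

lemma kap_add (r s : ℕ) (p : ℕ → ℤ) :
    kap (r + s) p = kap r p + s * ∑ j ∈ Finset.range r, p j + kap s (fun i => p (r + i)) := by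
  induction r generalizing p with
  | zero => simp [kap]
  | succ r ih =>
    rw [Nat.succ_add, kap_succ, ih, kap_succ, Finset.sum_range_succ']
    have : kap s (fun i => p (r + i + 1)) = kap s (fun i => p (r + 1 + i)) :=
      kap_congr fun i _ => by congr 1; omega
    rw [this]
    push_cast
    ring

lemma kap_eq_sum (n : ℕ) (p : ℕ → ℤ) : kap n p = ∑ i : Fin n, ((n - 1 - i : ℕ) : ℤ) * p i := by
  induction n generalizing p with
  | zero => simp [kap]
  | succ n ih =>
    rw [kap_succ, ih, Fin.sum_univ_succ]
    simp only [Fin.val_zero, Nat.sub_zero, Nat.add_sub_cancel, Fin.val_succ]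
    congr 1
    refine Finset.sum_congr rfl fun i _ => ?_
    congr 2
    omega

section Hat

variable {gr : ℤ → Submodule R M} [DirectSum.Decomposition gr]

lemma signMap_of_mem {p : ℤ} {a : M} (ha : a ∈ gr p) : signMap gr a = chi R (p : ZMod 2) • a := by
  have : DirectSum.decompose gr a = DirectSum.of (fun i => gr i) p ⟨a, ha⟩ :=
    DirectSum.decompose_of_mem gr ha
  rw [← negOnePow_smul, signMap, LinearMap.comp_apply, LinearEquiv.coe_coe,
    DirectSum.decomposeLinearEquiv_apply, this]
  change DirectSum.toModule R ℤ M _ (DirectSum.lof R ℤ (fun i => gr i) p ⟨a, ha⟩) = _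
  rw [DirectSum.toModule_lof]
  rfl

lemma signMap_pow_of_mem {p : ℤ} {a : M} (ha : a ∈ gr p) (k : ℕ) :
    (signMap gr ^ k) a = chi R ((k : ZMod 2) * p) • a := by
  induction k with
  | zero => simp
  | succ k ih =>
    rw [pow_succ, Module.End.mul_apply, signMap_of_mem ha, map_smul, ih, smul_smul, ← chi_add]
    push_cast
    ring_nf

lemma chi_sum {n : ℕ} (c : Fin n → ZMod 2) : ∏ i, chi R (c i) = chi R (∑ i, c i) := by
  induction n with
  | zero => simp
  | succ n ih => rw [Fin.prod_univ_succ, Fin.sum_univ_succ, ih, chi_add]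

lemma suspended_of_mem (f : MultiFamily R M X) (n : ℕ) {p : ℕ → ℤ} {a : ℕ → M}
    (ha : ∀ i, a i ∈ gr (p i)) :
    suspended gr f n (fun i => a i) = chi R (kap n p : ZMod 2) • f n (fun i => a i) := by
  rw [suspended, MultilinearMap.compLinearMap_apply]
  simp only [signMap_pow_of_mem (ha _)]
  rw [MultilinearMap.map_smul_univ, chi_sum, kap_eq_sum]
  push_cast
  rfl

variable (gr) in
/-- The linear map on the tensor algebra assembled from the suspended components of a family. -/
def hat (f : MultiFamily R M X) : TensorAlgebra R M →ₗ[R] X :=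
  DirectSum.toModule R ℕ X (fun n => PiTensorProduct.lift (suspended gr f n)) ∘ₗ
    (TensorAlgebra.equivDirectSum (R := R) (M := M)).toLinearMap

lemma hat_tprod (f : MultiFamily R M X) (n : ℕ) (x : Fin n → M) :
    hat gr f (TensorAlgebra.tprod R M n x) = suspended gr f n x := by
  rw [hat, LinearMap.comp_apply]
  have : (TensorAlgebra.equivDirectSum (R := R) (M := M)).toLinearMap
      (TensorAlgebra.tprod R M n x) = DirectSum.lof R ℕ (fun n => ⨂[R]^n M) n
        (PiTensorProduct.tprod R x) := TensorAlgebra.toDirectSum_tensorPower_tprod x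
  rw [this, DirectSum.toModule_lof, PiTensorProduct.lift.tprod]

lemma hat_tens (f : MultiFamily R M X) (n : ℕ) {p : ℕ → ℤ} {a : ℕ → M}
    (ha : ∀ i, a i ∈ gr (p i)) :
    hat gr f (tens R n a) = chi R (kap n p : ZMod 2) • f n (fun i => a i) := by
  rw [tens_eq_tprod, hat_tprod, suspended_of_mem f n ha]

lemma hat_one {f : MultiFamily R M X} (hf : f 0 = 0) : hat gr f 1 = 0 := by
  have := hat_tprod (gr := gr) f 0 ![]
  rw [suspended, hf] at this
  rw [TensorAlgebra.tprod_apply] at this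
  simpa using this

lemma hat_ι (f : MultiFamily R M X) (x : M) : hat gr f (ι R x) = firstComponent f x := by
  have := hat_tprod (gr := gr) f 1 ![x]
  rw [suspended, TensorAlgebra.tprod_apply] at this
  simp only [List.ofFn_succ, List.ofFn_zero, List.prod_cons, List.prod_nil, mul_one,
    Matrix.cons_val_zero, MultilinearMap.compLinearMap_apply] at this
  rw [this, firstComponent]
  change f 1 _ = f 1 _
  congr 1
  funext i
  fin_cases i
  simp

variable (gr) in
/-- The family whose suspension is a given linear map on the tensor algebra. -/
def unhat (α : TensorAlgebra R M →ₗ[R] X) : MultiFamily R M X :=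
  suspended gr fun n => α.compMultilinearMap (TensorAlgebra.tprod R M n)

lemma unhat_apply (α : TensorAlgebra R M →ₗ[R] X) (n : ℕ) {p : ℕ → ℤ} {a : ℕ → M}
    (ha : ∀ i, a i ∈ gr (p i)) :
    unhat gr α n (fun i => a i) = chi R (kap n p : ZMod 2) • α (tens R n a) := by
  rw [unhat, suspended_of_mem _ n ha, tens_eq_tprod]
  rfl

/-- Suspension and desuspension use the same sign, whose square is one. -/
lemma hat_unhat_tens (α : TensorAlgebra R M →ₗ[R] X) (n : ℕ) {p : ℕ → ℤ} {a : ℕ → M}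
    (ha : ∀ i, a i ∈ gr (p i)) : hat gr (unhat gr α) (tens R n a) = α (tens R n a) := by
  rw [hat_tens _ n ha, unhat_apply α n ha, chi_smul_chi_smul]

lemma unhat_zero {α : TensorAlgebra R M →ₗ[R] X} (hα : α 1 = 0) : unhat gr α 0 = 0 := by
  ext x
  have : TensorAlgebra.tprod R M 0 (fun i => (signMap gr ^ (0 - 1 - (i : ℕ))) (x i)) = 1 := by
    rw [TensorAlgebra.tprod_apply]; simp
  change α (TensorAlgebra.tprod R M 0 (fun i => (signMap gr ^ (0 - 1 - (i : ℕ))) (x i))) = 0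
  rw [this, hα]

end Hat

lemma sum_Icc_one {Z : Type*} [AddCommMonoid Z] (F : ℕ → Z) (n : ℕ) :
    ∑ s ∈ Finset.Icc 1 n, F s = ∑ x ∈ Finset.range n, F (x + 1) := by
  induction n with
  | zero => simp
  | succ n ih => rw [Finset.sum_Icc_succ_top (by omega), ih, Finset.sum_range_succ]

variable {B : Type*} {e : Module.Basis B R M} {dg : B → ℤ}

variable (e) in
/-- The letters of a word, as a sequence of elements. -/
def letters (w : List B) : ℕ → M := fun i => (w[i]?).elim 0 e

variable (dg) in
/-- The degrees of the letters of a word. -/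
def degrees (w : List B) : ℕ → ℤ := fun i => (w[i]?).elim 0 fun b => dg b + 1

lemma tens_letters (w : List B) : tens R w.length (letters e w) = E e w := by
  induction w with
  | nil => rfl
  | cons a w ih =>
    rw [List.length_cons, tens_succ, E_cons, ← ih]
    rfl

lemma sum_degrees (w : List B) :
    ∑ i ∈ Finset.range w.length, degrees dg w i = wdeg dg w + w.length := by
  induction w with
  | nil => simp
  | cons a w ih =>
    rw [List.length_cons, Finset.sum_range_succ']
    change ∑ i ∈ Finset.range w.length, degrees dg w i + (dg a + 1) = _
    rw [ih, wdeg_cons]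
    push_cast
    ring

variable {gr : ℤ → Submodule R M}

/-- Beyond the end of the word the entry is `0`, which is homogeneous of every degree, so the
condition holds for all indices. The `+ 1` in `degrees` undoes the desuspension. -/
lemma letters_mem (hH : ∀ i, HD e dg i = gr (i + 1)) (w : List B) (i : ℕ) :
    letters e w i ∈ gr (degrees dg w i) := by
  rw [letters, degrees]
  cases w[i]? with
  | none => exact zero_mem _
  | some b =>
    change e b ∈ gr (dg b + 1)
    rw [← hH]
    exact mem_HD e dg b

lemma mem_HD_of_mem (hH : ∀ i, HD e dg i = gr (i + 1)) {p : ℤ} {a : M} (ha : a ∈ gr p) :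
    a ∈ HD e dg (p - 1) := by rwa [hH, sub_add_cancel]

lemma tens_mem_TD (hH : ∀ i, HD e dg i = gr (i + 1)) (n : ℕ) {p : ℕ → ℤ} {a : ℕ → M}
    (ha : ∀ i, a i ∈ gr (p i)) : tens R n a ∈ TD e dg (∑ i ∈ Finset.range n, p i - n) := by
  induction n generalizing a p with
  | zero => simpa using mem_TD e dg []
  | succ n ih =>
    rw [tens_succ, Finset.sum_range_succ']
    convert ι_mul_mem_TD (mem_HD_of_mem hH (ha 0)) (ih fun i => ha (i + 1)) using 2
    push_cast
    ring

variable [DirectSum.Decomposition gr]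

lemma hat_E (hH : ∀ i, HD e dg i = gr (i + 1)) (f : MultiFamily R M X) (w : List B) :
    hat gr f (E e w) = chi R (kap w.length (degrees dg w) : ZMod 2) •
      f w.length (fun i => letters e w i) := by
  rw [← tens_letters, hat_tens f _ (letters_mem hH w)]

lemma hat_unhat (hH : ∀ i, HD e dg i = gr (i + 1)) (α : TensorAlgebra R M →ₗ[R] X) :
    hat gr (unhat gr α) = α :=
  ext_E (e := e) fun w => by rw [← tens_letters, hat_unhat_tens α _ (letters_mem hH w)]

lemma hat_mem (hH : ∀ i, HD e dg i = gr (i + 1)) {gr' : ℤ → Submodule R X} {c : ℤ}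
    {f : MultiFamily R M X} (hf : HasShift gr gr' c f) (w : List B) :
    hat gr f (E e w) ∈ gr' (wdeg dg w + c) := by
  rw [hat_E hH]
  refine Submodule.smul_mem _ _ ?_
  convert hf w.length (fun i => degrees dg w i) _ (fun i => letters_mem hH w i) using 2
  rw [Fin.sum_univ_eq_sum_range, sum_degrees]
  ring

lemma unhat_hasShift (hH : ∀ i, HD e dg i = gr (i + 1)) {gr' : ℤ → Submodule R X} {c : ℤ}
    {α : TensorAlgebra R M →ₗ[R] X} (hα : ∀ w, α (E e w) ∈ gr' (wdeg dg w + c)) :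
    HasShift gr gr' c (unhat gr α) := by
  intro n p a ha
  -- Extension by zero turns a finite homogeneous tuple into a homogeneous sequence, the form in
  -- which the tensor formulas are stated.
  let p' : ℕ → ℤ := fun i => if h : i < n then p ⟨i, h⟩ else 0
  let a' : ℕ → M := fun i => if h : i < n then a ⟨i, h⟩ else 0
  have ha' : ∀ i, a' i ∈ gr (p' i) := fun i => by
    by_cases h : i < n
    · simpa [a', p', h] using ha ⟨i, h⟩
    · simp [a', h]
  have h1 : a = fun i : Fin n => a' i := by funext i; simp [a']
  have h2 : p = fun i : Fin n => p' i := by funext i; simp [p']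
  rw [h1, h2, unhat_apply α n ha', Fin.sum_univ_eq_sum_range]
  refine Submodule.smul_mem _ _ ?_
  convert TD_map_mem hα (tens_mem_TD hH n ha') using 2
  ring

omit [DirectSum.Decomposition gr] in
lemma splT_tens (F : TensorAlgebra R M →ₗ[R] TensorAlgebra R M →ₗ[R] Z) (n : ℕ) (a : ℕ → M) :
    splT e F (tens R n a) = ∑ r ∈ Finset.range (n + 1),
      F (tens R r a) (tens R (n - r) (fun i => a (r + i))) := by
  induction n generalizing F a with
  | zero => rw [tens_zero, ← E_nil e, splT_E]; simp
  | succ n ih =>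
    rw [tens_succ, splT_ι_mul, ih, Finset.sum_range_succ' _ (n + 1), add_comm]
    congr 1
    · refine Finset.sum_congr rfl fun r _ => ?_
      change F (ι R (a 0) * tens R r fun i => a (i + 1)) _ = _
      rw [← tens_succ, Nat.add_sub_add_right]
      congr 2
      funext i
      congr 1; omega
    · simp [tens_succ]

omit [DirectSum.Decomposition gr] in
lemma headOp_tens (b : TensorAlgebra R M →ₗ[R] M) (n : ℕ) (a : ℕ → M) :
    headOp e b (tens R n a) = ∑ s ∈ Finset.range (n + 1),
      ι R (b (tens R s a)) * tens R (n - s) (fun i => a (s + i)) := by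
  have := splT_tens (e := e) (headMul b LinearMap.id) n a
  simp only [headMul_apply, LinearMap.id_apply] at this
  exact this

-- The sign is the parity of the desuspended degree `∑ (p_j - 1)` of the first `r` factors, which
-- the coderivation passes.
omit [DirectSum.Decomposition gr] in
lemma coder_tens (hH : ∀ i, HD e dg i = gr (i + 1)) {b : TensorAlgebra R M →ₗ[R] M}
    (n : ℕ) {p : ℕ → ℤ} {a : ℕ → M} (ha : ∀ i, a i ∈ gr (p i)) :
    coder e dg b (tens R n a) = ∑ r ∈ Finset.range n,
      chi R ((∑ j ∈ Finset.range r, p j + r : ℤ) : ZMod 2) •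
        (tens R r a * headOp e b (tens R (n - r) (fun i => a (r + i)))) := by
  induction n generalizing a p with
  | zero => simp
  | succ n ih =>
    rw [tens_succ, coder_ι_mul e dg b (mem_HD_of_mem hH (ha 0)), ih fun i => ha (i + 1),
      Finset.sum_range_succ', Finset.mul_sum, Finset.smul_sum, add_comm]
    congr 1
    · refine Finset.sum_congr rfl fun r _ => ?_
      rw [mul_smul_comm, smul_smul, ← chi_add, Finset.sum_range_succ', tens_succ, mul_assoc,
        Nat.add_sub_add_right]
      have h1 : (fun i => a (r + i + 1)) = fun i => a (r + 1 + i) := by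
        funext i; congr 1; omega
      have h2 : ((p 0 - 1 : ℤ) : ZMod 2) + ((∑ j ∈ Finset.range r, p (j + 1) + r : ℤ) : ZMod 2) =
          ((∑ j ∈ Finset.range r, p (j + 1) + p 0 + (r + 1 : ℕ) : ℤ) : ZMod 2) := by
        have : (-1 : ZMod 2) = 1 := rfl
        push_cast
        rw [sub_eq_add_neg, this]
        ring
      rw [h1, h2]
    · simp [tens_succ]

/-- The signs of the Stasheff identities are those of the coderivation on the suspension. -/
lemma hat_coder_tens (hH : ∀ i, HD e dg i = gr (i + 1)) {m : MultiFamily R M M} (hm0 : m 0 = 0)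
    (hm : HasShift gr gr 2 m) (f : MultiFamily R M X) (n : ℕ) {p : ℕ → ℤ} {a : ℕ → M}
    (ha : ∀ i, a i ∈ gr (p i)) :
    hat gr f (coder e dg (hat gr m) (tens R n a)) =
      chi R (kap n p : ZMod 2) • innerSum f m n p a := by
  rw [coder_tens hH n ha, map_sum, innerSum, Finset.smul_sum]
  refine Finset.sum_congr rfl fun r hr => ?_
  rw [Finset.mem_range] at hr
  -- The summand with an empty argument vanishes since `m 0 = 0`; the remaining ones match `1 ≤ s`
  -- after a shift of the index.
  rw [headOp_tens, Finset.sum_range_succ']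
  simp only [tens_zero, hat_one hm0, map_zero, zero_mul, add_zero]
  rw [Finset.mul_sum, Finset.smul_sum, map_sum, Finset.smul_sum, sum_Icc_one]
  refine Finset.sum_congr rfl fun x hx => ?_
  rw [Finset.mem_range] at hx
  generalize hs : x + 1 = s
  obtain ⟨t, rfl⟩ : ∃ t, n = r + (s + t) := ⟨n - r - s, by omega⟩
  have e1 : r + (s + t) - r - s = t := by omega
  have e2 : r + (s + t) - s + 1 = r + (t + 1) := by omega
  rw [e1, e2]
  -- The degrees after insertion: the operation `m_s` has degree `2 - s`, and later entries move `s
  -- - 1` places.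
  let p' : ℕ → ℤ := fun i => if i < r then p i else
    if i = r then ∑ j ∈ Finset.range s, p (r + j) + 2 - s else p (i + s - 1)
  have hy : m s (fun j => a (r + j)) ∈ gr (∑ j ∈ Finset.range s, p (r + j) + 2 - s) := by
    have := hm s (fun j => p (r + j)) (fun j => a (r + j)) fun j => ha _
    rwa [Fin.sum_univ_eq_sum_range fun j => p (r + j)] at this
  have ha' : ∀ i, insertOp m r s a i ∈ gr (p' i) := fun i => by
    simp only [insertOp, p']
    split_ifs
    · exact ha i
    · exact hy
    · exact ha _
  have hins : tens R (r + (t + 1)) (insertOp m r s a) =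
      tens R r a * (ι R (m s fun j => a (r + j)) * tens R t (fun i => a (r + (s + i)))) := by
    rw [tens_add, tens_succ]
    congr 1
    · exact tens_congr fun i hi => by simp [insertOp, hi]
    · congr 1
      · simp [insertOp]
      · refine tens_congr fun i _ => ?_
        have h1 : ¬ (r + (i + 1) < r) := by omega
        have h2 : ¬ (r + (i + 1) = r) := by omega
        simp only [insertOp, if_neg h1, if_neg h2]
        congr 1; omega
  have hk : kap (r + (t + 1)) p' = kap r p + (t + 1) * ∑ j ∈ Finset.range r, p j +
      (t * (∑ j ∈ Finset.range s, p (r + j) + 2 - s) + kap t fun i => p (r + (s + i))) := by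
    have h0 : ∀ i, i < r → p' i = p i := fun i hi => by simp [p', hi]
    have h3 : p' (r + 0) = ∑ j ∈ Finset.range s, p (r + j) + 2 - s := by simp [p']
    have h4 : ∀ i, p' (r + (i + 1)) = p (r + (s + i)) := fun i => by
      have h1 : ¬ (r + (i + 1) < r) := by omega
      have h2 : ¬ (r + (i + 1) = r) := by omega
      simp only [p', if_neg h1, if_neg h2]
      congr 1; omega
    rw [kap_add, kap_succ, kap_congr h0, h3, kap_congr fun i _ => h4 i,
      Finset.sum_congr rfl fun j hj => h0 j (Finset.mem_range.1 hj)]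
    push_cast
    ring
  have hv := hat_tens (gr := gr) m s (a := fun i => a (r + i)) (p := fun i => p (r + i))
    fun i => ha _
  have hu := hat_tens (gr := gr) f (r + (t + 1)) ha'
  rw [hins, hk] at hu
  rw [hv, map_smul (ι R), smul_mul_assoc, mul_smul_comm, smul_smul, map_smul, hu, smul_smul,
    negOnePow_smul R, smul_smul, ← chi_add, ← chi_add, ← chi_add, kap_add, kap_add]
  congr 2
  have h2 : (2 : ZMod 2) = 0 := rfl
  have hn : ∀ z : ZMod 2, -z = z := by decide
  push_cast
  simp only [sub_eq_add_neg, hn, h2, zero_add, add_zero]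
  generalize (∑ j ∈ Finset.range r, (p j : ZMod 2)) = S
  generalize (∑ j ∈ Finset.range s, (p (r + j) : ZMod 2)) = S'
  generalize (kap r p : ZMod 2) = k1
  generalize ((kap s fun i => p (r + i) : ℤ) : ZMod 2) = k2
  generalize ((kap t fun i => p (r + (s + i)) : ℤ) : ZMod 2) = k3
  generalize (r : ZMod 2) = r
  generalize (s : ZMod 2) = s
  generalize (t : ZMod 2) = t
  -- The two exponents differ by an even number; the coefficient of `h2` is half of the difference.
  linear_combination (S - s * S - s * r - s ^ 2) * h2

end Sequences

/-! ### Sums over compositions, organized by the first block. -/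

section Compositions

/-- The summand is a function of the list of blocks alone, so the first block can be removed without
dependent types and sums over compositions follow the recursion of `spl`. -/
lemma sum_composition {X : Type*} [AddCommMonoid X] {n : ℕ} (hn : n ≠ 0) (Φ : List ℕ → X) :
    ∑ c : Composition n, Φ c.blocks = ∑ k ∈ Finset.range n,
      ∑ c : Composition (n - (k + 1)), Φ ((k + 1) :: c.blocks) := by
  rw [Finset.sum_sigma']
  symm
  refine Finset.sum_bij (fun x hx => (⟨(x.1 + 1) :: x.2.blocks, ?_, ?_⟩ : Composition n)) ?_ ?_ ?_ ?_
  · intro i hi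
    rcases List.mem_cons.1 hi with rfl | hi
    · omega
    · exact x.2.blocks_pos hi
  · have h1 := x.2.blocks_sum
    have h2 := Finset.mem_range.1 (Finset.mem_sigma.1 hx).1
    rw [List.sum_cons]
    omega
  · simp
  · rintro ⟨k, c⟩ h1 ⟨k', c'⟩ h2 h
    simp only [Composition.mk.injEq, List.cons.injEq, Nat.add_right_cancel_iff] at h
    obtain ⟨rfl, h⟩ := h
    congr
    exact Composition.ext h
  · intro c _
    obtain ⟨bs, hpos, hsum⟩ := c
    cases bs with
    | nil => exact absurd hsum.symm (by simpa using hn)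
    | cons b bs =>
      have hb := hpos (List.mem_cons_self)
      rw [List.sum_cons] at hsum
      refine ⟨⟨b - 1, ⟨bs, fun hi => hpos (List.mem_cons_of_mem _ hi), by omega⟩⟩, ?_, ?_⟩
      · simp; omega
      · refine Composition.ext ?_
        simp only [List.cons.injEq, and_true]
        omega
  · intro x hx
    rfl

lemma sum_composition_zero {X : Type*} [AddCommMonoid X] (Φ : List ℕ → X) :
    ∑ c : Composition 0, Φ c.blocks = Φ [] := by
  have h : ∀ c : Composition 0, c.blocks = [] := fun c => by
    by_contra hne
    obtain ⟨b, bs, hb⟩ := List.exists_cons_of_ne_nil hne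
    have h1 := c.blocks_sum
    have h2 := c.blocks_pos (i := b) (by rw [hb]; exact List.mem_cons_self)
    rw [hb, List.sum_cons] at h1
    omega
  rw [Finset.sum_congr rfl fun c _ => by rw [h c], Finset.sum_const, Finset.card_univ,
    composition_card]
  simp

/-- Meant for a dg algebra, which has no operations of arity three or more. -/
lemma sum_composition_of_length {X : Type*} [AddCommMonoid X] {n : ℕ} {Φ : List ℕ → X}
    (h : ∀ ks, 3 ≤ ks.length → Φ ks = 0) :
    ∑ c : Composition (n + 1), Φ c.blocks =
      Φ [n + 1] + ∑ k ∈ Finset.range n, Φ [k + 1, n - k] := by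
  rw [sum_composition (Nat.succ_ne_zero n), Finset.sum_range_succ, add_comm]
  congr 1
  · rw [Nat.sub_self, sum_composition_zero fun ks => Φ ((n + 1) :: ks)]
  · refine Finset.sum_congr rfl fun k hk => ?_
    rw [Finset.mem_range] at hk
    obtain ⟨m, hm⟩ : ∃ m, n - k = m + 1 := ⟨n - k - 1, by omega⟩
    have hm' : n + 1 - (k + 1) = m + 1 := by omega
    change ∑ c : Composition (n + 1 - (k + 1)), _ = _
    rw [hm', hm, sum_composition (Nat.succ_ne_zero m) fun ks => Φ ((k + 1) :: ks),
      Finset.sum_range_succ, Finset.sum_eq_zero, zero_add, Nat.sub_self,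
      sum_composition_zero fun ks => Φ ((k + 1) :: (m + 1) :: ks)]
    intro j hj
    rw [Finset.mem_range] at hj
    rw [sum_composition (by omega) fun ks => Φ ((k + 1) :: (j + 1) :: ks)]
    exact Finset.sum_eq_zero fun _ _ => Finset.sum_eq_zero fun _ _ => h _ (by simp)

end Compositions

/-! ### Signs of the composition formula and of twisting cochains. -/

section Chunks

open TensorAlgebra

variable {R : Type u} [CommRing R] {M X Y : Type*} [AddCommGroup M] [Module R M]
  [AddCommGroup X] [Module R X] [AddCommGroup Y] [Module R Y]

/-- The values of a function on the consecutive blocks of a sequence. -/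
def chunks {α β : Type*} [Zero β] (F : ℕ → (ℕ → α) → β) : List ℕ → (ℕ → α) → ℕ → β
  | [], _, _ => 0
  | k :: _, a, 0 => F k a
  | k :: ks, a, i + 1 => chunks F ks (fun j => a (k + j)) i

lemma chunks_eq {α β : Type*} [Zero β] (F : ℕ → (ℕ → α) → β) (ks : List ℕ) (a : ℕ → α)
    (i : Fin ks.length) : chunks F ks a i = F ks[i] (fun j => a ((ks.take i).sum + j)) := by
  induction ks generalizing a with
  | nil => exact i.elim0
  | cons k ks ih =>
    refine Fin.cases ?_ (fun i => ?_) i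
    · simp [chunks]
    · change chunks F ks (fun j => a (k + j)) i = F ks[i] _
      rw [ih]
      simp [add_assoc]

/-- The exponent of `outerSign`, with an additional contribution `P` to all sums of degrees. -/
def outerExp : List ℕ → ℤ → (ℕ → ℤ) → ℤ
  | [], _, _ => 0
  | k :: ks, P, p => ks.length * ((k : ℤ) - 1) + (1 - k) * P +
      outerExp ks (P + ∑ j ∈ Finset.range k, p j) (fun j => p (k + j))

lemma sum_range_add_eq (k s : ℕ) (p : ℕ → ℤ) : ∑ j ∈ Finset.range (k + s), p j =
    ∑ j ∈ Finset.range k, p j + ∑ j ∈ Finset.range s, p (k + j) := Finset.sum_range_add p k s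

lemma outerExp_eq (ks : List ℕ) (P : ℤ) (p : ℕ → ℤ) :
    outerExp ks P p = ∑ i : Fin ks.length, (((ks.length : ℤ) - 1 - (i : ℕ)) * ((ks[i] : ℤ) - 1) +
      (1 - (ks[i] : ℤ)) * (P + ∑ j ∈ Finset.range (ks.take i).sum, p j)) := by
  induction ks generalizing P p with
  | nil => simp [outerExp]
  | cons k ks ih =>
    rw [outerExp, ih]
    simp only [List.length_cons]
    rw [Fin.sum_univ_succ]
    congr 1
    · simp
    · refine Finset.sum_congr rfl fun i _ => ?_
      simp only [Fin.getElem_fin, Fin.val_succ, List.getElem_cons_succ, List.take_succ_cons,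
        List.sum_cons, sum_range_add_eq]
      push_cast
      ring

lemma outerExp_shift (ks : List ℕ) (P : ℤ) (p : ℕ → ℤ) :
    outerExp ks P p = P * (ks.length - ks.sum) + outerExp ks 0 p := by
  induction ks generalizing P p with
  | nil => simp [outerExp]
  | cons k ks ih =>
    rw [outerExp, outerExp, ih, ih (0 + _)]
    simp only [List.length_cons, List.sum_cons]
    push_cast
    ring

/-- The sum of the exponents `kap` of the blocks. -/
def kapSum : List ℕ → (ℕ → ℤ) → ℤ
  | [], _ => 0
  | k :: ks, p => kap k p + kapSum ks (fun j => p (k + j))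

/-- The degrees of the values of operations of degree `1 - k` on blocks. -/
abbrev chunkDeg : List ℕ → (ℕ → ℤ) → ℕ → ℤ :=
  chunks fun k p => ∑ j ∈ Finset.range k, p j + 1 - k

/-- The sign identity behind composition: suspending each block and then the tensor of the results
agrees with suspending all arguments at once, up to the Koszul sign of `outerSign`. The proof
removes the first block. -/
lemma outerExp_parity (ks : List ℕ) (p : ℕ → ℤ) :
    ((kapSum ks p + kap ks.length (chunkDeg ks p) : ℤ) : ZMod 2) =
      ((kap ks.sum p + outerExp ks 0 p : ℤ) : ZMod 2) := by
  induction ks generalizing p with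
  | nil => simp [kapSum, kap, outerExp]
  | cons k ks ih =>
    have h1 := ih fun j => p (k + j)
    have h2 : kap (k :: ks).length (chunkDeg (k :: ks) p) =
        ks.length * (∑ j ∈ Finset.range k, p j + 1 - k) +
          kap ks.length (chunkDeg ks fun j => p (k + j)) := rfl
    rw [h2, kapSum, outerExp, outerExp_shift, List.sum_cons, kap_add]
    have h3 : (2 : ZMod 2) = 0 := rfl
    push_cast at h1 ⊢
    linear_combination h1 + (ks.length : ZMod 2) * (1 - k) * h3

variable {gr : ℤ → Submodule R M} {gr' : ℤ → Submodule R X}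

/-- The value of a family on the first `k` members of a sequence. -/
abbrev evalSeq (f : MultiFamily R M X) (k : ℕ) (a : ℕ → M) : X := f k (fun i => a i)

lemma chunks_mem {f : MultiFamily R M X} (hf : HasShift gr gr' 1 f) (ks : List ℕ) {p : ℕ → ℤ}
    {a : ℕ → M} (ha : ∀ i, a i ∈ gr (p i)) (i : ℕ) :
    chunks (evalSeq f) ks a i ∈ gr' (chunkDeg ks p i) := by
  induction ks generalizing a p i with
  | nil => exact zero_mem _
  | cons k ks ih =>
    cases i with
    | zero =>
      have := hf k (fun j => p j) (fun j => a j) fun j => ha _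
      rwa [Fin.sum_univ_eq_sum_range fun j => p j] at this
    | succ i => exact ih (fun j => ha _) i

/-- The signs in the composition formula are those of the coalgebra map on suspensions. -/
lemma smul_outerSum (g : MultiFamily R X Y) (f : MultiFamily R M X) (n : ℕ) (p : ℕ → ℤ)
    (a : ℕ → M) : chi R (kap n p : ZMod 2) • outerSum g f n p a =
      ∑ c : Composition n,
        chi R ((kapSum c.blocks p + kap c.blocks.length (chunkDeg c.blocks p) : ℤ) : ZMod 2) •
          evalSeq g c.blocks.length (chunks (evalSeq f) c.blocks a) := by
  rw [outerSum, Finset.smul_sum]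
  refine Finset.sum_congr rfl fun c _ => ?_
  have h1 : outerSign c p = Int.negOnePow (outerExp c.blocks 0 p) := by
    rw [outerExp_eq, outerSign]
    congr 1
    refine Finset.sum_congr rfl fun i _ => ?_
    rw [zero_add]
    rfl
  have h2 : (fun i : Fin c.length => f (c.blocksFun i) (fun j => a (c.sizeUpTo i + j))) =
      fun i : Fin c.blocks.length => chunks (evalSeq f) c.blocks a i :=
    funext fun i => (chunks_eq (evalSeq f) c.blocks a i).symm
  rw [outerExp_parity, c.blocks_sum, h1, negOnePow_smul R, smul_smul, ← chi_add, h2]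
  push_cast
  rfl

variable {B : Type*} {e : Module.Basis B R M} {dg : B → ℤ}

lemma aug_tens_succ (n : ℕ) (a : ℕ → M) : aug e (tens R (n + 1) a) = 0 := by
  rw [tens_succ, aug_ι_mul]

lemma comap_tens {G : TensorAlgebra R M →ₗ[R] X} (hG : G 1 = 0) (n : ℕ) (a : ℕ → M) :
    comap e G (tens R n a) = ∑ c : Composition n,
      tens R c.blocks.length (chunks (fun k a => G (tens R k a)) c.blocks a) := by
  induction n using Nat.strong_induction_on generalizing a with
  | _ n ih =>
    cases n with
    | zero =>
      rw [sum_composition_zero fun ks => tens R ks.length (chunks (fun k a => G (tens R k a)) ks a)]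
      simp
    | succ n =>
      rw [comap_eq e hG, aug_tens_succ, zero_smul, zero_add, splT_tens, Finset.sum_range_succ',
        sum_composition (Nat.succ_ne_zero n)
          fun ks => tens R ks.length (chunks (fun k a => G (tens R k a)) ks a)]
      simp only [headMul_apply, tens_zero, hG, map_zero, zero_mul, add_zero]
      refine Finset.sum_congr rfl fun k _ => ?_
      rw [ih _ (by omega), Finset.mul_sum]
      rfl

lemma tens_chunks_hat [DirectSum.Decomposition gr] (f : MultiFamily R M X) (ks : List ℕ)
    {p : ℕ → ℤ} {a : ℕ → M} (ha : ∀ i, a i ∈ gr (p i)) :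
    tens R ks.length (chunks (fun k a => hat gr f (tens R k a)) ks a) =
      chi R (kapSum ks p : ZMod 2) • tens R ks.length (chunks (evalSeq f) ks a) := by
  induction ks generalizing p a with
  | nil => simp [kapSum]
  | cons k ks ih =>
    rw [List.length_cons, tens_succ, tens_succ]
    change ι R (hat gr f (tens R k a)) *
      tens R ks.length (chunks (fun k a => hat gr f (tens R k a)) ks fun j => a (k + j)) = _ •
      (ι R (f k fun i => a i) * tens R ks.length (chunks (evalSeq f) ks fun j => a (k + j)))
    rw [ih fun j => ha _, hat_tens f k ha, kapSum, map_smul, smul_mul_assoc, mul_smul_comm,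
      smul_smul, ← chi_add]
    push_cast
    rfl

/-- Under décalage the composition formula becomes the corestriction of a composite of coalgebra
maps; it serves both for composites and for the right side of the morphism relation. -/
lemma hat_comap_tens [DirectSum.Decomposition gr] [DirectSum.Decomposition gr']
    (g : MultiFamily R X Y) {f : MultiFamily R M X} (hf0 : f 0 = 0) (hf : HasShift gr gr' 1 f)
    (n : ℕ) {p : ℕ → ℤ} {a : ℕ → M} (ha : ∀ i, a i ∈ gr (p i)) :
    hat gr' g (comap e (hat gr f) (tens R n a)) = chi R (kap n p : ZMod 2) • outerSum g f n p a := by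
  rw [comap_tens (hat_one hf0), smul_outerSum, map_sum]
  refine Finset.sum_congr rfl fun c _ => ?_
  rw [tens_chunks_hat f c.blocks ha, map_smul, hat_tens g _ (chunks_mem hf c.blocks ha), smul_smul,
    ← chi_add]
  push_cast
  rfl

lemma CDGAlg.ops_of_three_le (A : CDGAlg.{u, v} R) {n : ℕ} (hn : 3 ≤ n) : A.ops n = 0 := by
  obtain _ | _ | _ | n := n
  · omega
  · omega
  · omega
  · rfl

/-- Compositions with one block give the term with `d`, those with two blocks give the cup product.
So a morphism into a dg algebra is a twisting cochain. -/
lemma smul_outerSum_ops [DirectSum.Decomposition gr] (hH : ∀ i, HD e dg i = gr (i + 1))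
    (A : CDGAlg.{u, v} R) {f : MultiFamily R M A.carrier}
    (hf0 : f 0 = 0) (n : ℕ) {p : ℕ → ℤ} {a : ℕ → M} (ha : ∀ i, a i ∈ gr (p i)) :
    chi R (kap n p : ZMod 2) • outerSum A.ops f n p a =
      (A.d ∘ₗ hat gr f - cup e A.mul (hat gr f ∘ₗ sgn e dg) (hat gr f)) (tens R n a) := by
  rw [smul_outerSum, LinearMap.sub_apply, cup_eq, splT_tens]
  cases n with
  | zero =>
    rw [sum_composition_zero fun ks => chi R ((kapSum ks p + kap ks.length (chunkDeg ks p) : ℤ) :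
      ZMod 2) • evalSeq A.ops ks.length (chunks (evalSeq f) ks a)]
    simp [hat_one hf0, evalSeq, CDGAlg.ops]
  | succ n =>
    rw [sum_composition_of_length (Φ := fun ks => chi R ((kapSum ks p + kap ks.length
      (chunkDeg ks p) : ℤ) : ZMod 2) • evalSeq A.ops ks.length (chunks (evalSeq f) ks a))
      (fun ks hks => by simp [evalSeq, A.ops_of_three_le hks]), sub_eq_add_neg]
    congr 1
    · have h1 : evalSeq A.ops 1 (chunks (evalSeq f) [n + 1] a) = A.d (f (n + 1) fun i => a i) := rfl
      change chi R _ • evalSeq A.ops 1 (chunks (evalSeq f) [n + 1] a) = _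
      rw [h1, LinearMap.comp_apply, hat_tens f _ ha, map_smul]
      simp [kapSum, kap]
    · rw [Finset.sum_range_succ, Finset.sum_range_succ', Nat.sub_self]
      simp only [LinearMap.compl₁₂_apply, LinearMap.comp_apply, tens_zero, sgn_one, hat_one hf0,
        map_zero, LinearMap.zero_apply, add_zero]
      rw [← Finset.sum_neg_distrib]
      refine Finset.sum_congr rfl fun k hk => ?_
      rw [Finset.mem_range] at hk
      have h1 : evalSeq A.ops 2 (chunks (evalSeq f) [k + 1, n - k] a) =
        A.mul (f (k + 1) fun i => a i) (f (n - k) fun i => a (k + 1 + i)) := rfl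
      change chi R _ • evalSeq A.ops 2 (chunks (evalSeq f) [k + 1, n - k] a) = _
      rw [h1, sgn_of_mem (tens_mem_TD hH _ ha), map_smul, hat_tens f _ ha, hat_tens f _ fun i => ha _,
        Nat.add_sub_add_right, map_smul, map_smul, map_smul, LinearMap.smul_apply,
        LinearMap.smul_apply, smul_smul, smul_smul, ← neg_one_smul R, smul_smul, ← chi_one R,
        ← chi_add, ← chi_add, ← chi_add]
      congr 2
      have h2 : kap 2 (chunkDeg [k + 1, n - k] p) =
          (1 : ℤ) * (∑ j ∈ Finset.range (k + 1), p j + 1 - (k + 1 : ℕ)) + (0 + 0) := by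
        simp [kap, chunks]
      change ((kapSum [k + 1, n - k] p + kap 2 _ : ℤ) : ZMod 2) = _
      rw [h2, kapSum, kapSum, kapSum]
      push_cast
      ring

end Chunks

/-! ### Shuffle permutations, decomposed by their first letter. -/

section InsertPerm

/-- The permutation with value `j` at `0` whose other values are given by `σ`. -/
def insertPerm {n : ℕ} (j : Fin (n + 1)) (σ : Equiv.Perm (Fin n)) : Equiv.Perm (Fin (n + 1)) :=
  (finSuccEquiv' 0).trans ((Equiv.optionCongr σ).trans (finSuccEquiv' j).symm)

variable {n : ℕ}

@[simp] lemma insertPerm_zero (j : Fin (n + 1)) (σ : Equiv.Perm (Fin n)) :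
    insertPerm j σ 0 = j := by
  simp [insertPerm]

@[simp] lemma insertPerm_succ (j : Fin (n + 1)) (σ : Equiv.Perm (Fin n)) (i : Fin n) :
    insertPerm j σ i.succ = j.succAbove (σ i) := by
  have : finSuccEquiv' 0 i.succ = some i := by
    rw [← Fin.succAbove_zero]; exact finSuccEquiv'_succAbove 0 i
  simp [insertPerm, this]

lemma insertPerm_bijective :
    Function.Bijective fun x : Fin (n + 1) × Equiv.Perm (Fin n) => insertPerm x.1 x.2 := by
  rw [Fintype.bijective_iff_injective_and_card]
  refine ⟨?_, by simp [Fintype.card_perm, Nat.factorial_succ]⟩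
  rintro ⟨j, σ⟩ ⟨j', σ'⟩ h
  have h0 : j = j' := by
    have := Equiv.congr_fun h 0
    simpa using this
  subst h0
  congr
  ext i
  have := Equiv.congr_fun h i.succ
  simp only [insertPerm_succ] at this
  rw [Fin.succAbove_right_injective this]

lemma val_succAbove (j : Fin (n + 1)) (x : Fin n) :
    ((j.succAbove x : Fin (n + 1)) : ℕ) = if (x : ℕ) < j then (x : ℕ) else x + 1 := by
  rw [Fin.succAbove]
  simp only [Fin.lt_def, Fin.val_castSucc]
  split_ifs <;> simp

/-- A shuffle starts with the first letter of one of its two groups, which has index `0` or `k`; the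
remaining letters form a shuffle in which that group is shorter by one. This matches the recursion
of `sh`. -/
lemma isShuffle_insertPerm {k : ℕ} (hk : k ≤ n + 1) (j : Fin (n + 1)) (σ : Equiv.Perm (Fin n)) :
    IsShuffle k (insertPerm j σ) ↔
      ((j : ℕ) = 0 ∧ 0 < k ∧ IsShuffle (k - 1) σ) ∨ ((j : ℕ) = k ∧ IsShuffle k σ) := by
  constructor
  · intro h
    -- Otherwise the first letter of the group of `j` would have to stand to the left of position
    -- `0`.
    have hmin : (j : ℕ) = 0 ∧ 0 < k ∨ (j : ℕ) = k := by
      by_contra hne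
      rcases lt_or_ge (j : ℕ) k with hj | hj
      · have h1 := h ((insertPerm j σ).symm 0) 0
        simp only [Equiv.apply_symm_apply, insertPerm_zero] at h1
        have := h1 (by rw [Fin.lt_def, Fin.val_zero]; omega) (Or.inl hj)
        exact absurd this (Fin.not_lt_zero _)
      · have h1 := h ((insertPerm j σ).symm ⟨k, by omega⟩) 0
        simp only [Equiv.apply_symm_apply, insertPerm_zero] at h1
        have := h1 (by rw [Fin.lt_def]; change k < (j : ℕ); omega) (Or.inr le_rfl)
        exact absurd this (Fin.not_lt_zero _)
    rcases hmin with ⟨hj, hk0⟩ | hj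
    · refine Or.inl ⟨hj, hk0, fun a b hab hc => ?_⟩
      have := h a.succ b.succ
      simp only [insertPerm_succ, Fin.lt_def, val_succAbove, hj, Fin.val_succ] at this hab ⊢
      simp only [Nat.not_lt_zero, if_false] at this
      have := this (by omega) (by omega)
      omega
    · refine Or.inr ⟨hj, fun a b hab hc => ?_⟩
      have := h a.succ b.succ
      simp only [insertPerm_succ, Fin.lt_def, val_succAbove, hj, Fin.val_succ] at this hab ⊢
      have := this (by split_ifs <;> omega) (by split_ifs <;> omega)
      omega
  · intro h a b
    refine Fin.cases ?_ (fun a => ?_) a <;> refine Fin.cases ?_ (fun b => ?_) b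
    · intro h1; exact absurd h1 (lt_irrefl _)
    · intro _ _; exact Fin.succ_pos _
    · intro h1 h2
      exfalso
      simp only [insertPerm_succ, insertPerm_zero, Fin.lt_def, val_succAbove] at h1 h2
      rcases h with ⟨hj, hk0, -⟩ | ⟨hj, -⟩
      · omega
      · omega
    · intro h1 h2
      simp only [insertPerm_succ, Fin.lt_def, val_succAbove] at h1 h2
      rw [Fin.succ_lt_succ_iff]
      rcases h with ⟨hj, hk0, hs⟩ | ⟨hj, hs⟩
      · refine hs a b ?_ ?_
        · rw [Fin.lt_def]; simp only [hj, Nat.not_lt_zero, if_false] at h1; omega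
        · simp only [hj, Nat.not_lt_zero, if_false] at h2; omega
      · refine hs a b ?_ ?_
        · rw [Fin.lt_def]; split_ifs at h1 <;> omega
        · split_ifs at h2 <;> omega

lemma prod_negOnePow {ι : Type*} (s : Finset ι) (f : ι → ℤ) :
    ∏ i ∈ s, Int.negOnePow (f i) = Int.negOnePow (∑ i ∈ s, f i) := by
  induction s using Finset.cons_induction with
  | empty => simp
  | cons a s ha ih => rw [Finset.prod_cons, Finset.sum_cons, ih, Int.negOnePow_add]

/-- The exponent of `shuffleSign`. -/
def shuffleExp (p : ℕ → ℤ) (σ : Equiv.Perm (Fin n)) : ℤ :=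
  ∑ i : Fin n, ∑ j : Fin n, if i < j ∧ σ j < σ i then 1 + p (σ i) * p (σ j) else 0

lemma shuffleSign_eq (p : ℕ → ℤ) (σ : Equiv.Perm (Fin n)) :
    shuffleSign (fun i : Fin n => p i) σ = Int.negOnePow (shuffleExp p σ) := by
  rw [shuffleSign, shuffleExp, ← prod_negOnePow]
  refine Finset.prod_congr rfl fun i _ => ?_
  rw [← prod_negOnePow]
  refine Finset.prod_congr rfl fun j _ => ?_
  split_ifs
  · rfl
  · simp

/-- The sequence without its member with index `j`. -/
def skip {α : Type*} (j : ℕ) (a : ℕ → α) : ℕ → α := fun i => if i < j then a i else a (i + 1)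

lemma skip_apply {α : Type*} (j : Fin (n + 1)) (a : ℕ → α) (x : Fin n) :
    a (j.succAbove x : Fin (n + 1)) = skip j a x := by
  rw [val_succAbove, skip]
  split_ifs <;> rfl

/-- The inversions that involve position `0` are those with the letters of index below `j`; each
contributes `1 + p_j p_x`. -/
lemma shuffleExp_insertPerm (p : ℕ → ℤ) (j : Fin (n + 1)) (σ : Equiv.Perm (Fin n)) :
    shuffleExp p (insertPerm j σ) =
      (j + p j * ∑ x ∈ Finset.range j, p x) + shuffleExp (skip j p) σ := by
  rw [shuffleExp, Fin.sum_univ_succ]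
  congr 1
  · rw [Fin.sum_univ_succ]
    simp only [lt_irrefl, false_and, if_false, zero_add, Fin.succ_pos, true_and, insertPerm_zero,
      insertPerm_succ]
    rw [Equiv.sum_comp σ fun x => if j.succAbove x < j then
      1 + p j * p (j.succAbove x : Fin (n + 1)) else 0]
    have h1 : ∀ x : Fin n, (if j.succAbove x < j then 1 + p j * p (j.succAbove x : Fin (n + 1))
        else 0) = if (x : ℕ) < j then 1 + p j * p x else 0 := fun x => by
      simp only [Fin.lt_def, val_succAbove]
      split_ifs <;> first | rfl | omega
    rw [Finset.sum_congr rfl fun x _ => h1 x,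
      Fin.sum_univ_eq_sum_range fun x => if x < (j : ℕ) then 1 + p j * p x else 0,
      ← Finset.sum_filter]
    have h2 : (Finset.range n).filter (fun x => x < (j : ℕ)) = Finset.range j := by
      ext x
      simp only [Finset.mem_filter, Finset.mem_range]
      omega
    rw [h2, Finset.sum_add_distrib, Finset.mul_sum]
    simp
  · refine Finset.sum_congr rfl fun a _ => ?_
    rw [Fin.sum_univ_succ]
    simp only [Fin.not_lt_zero, false_and, if_false, zero_add, Fin.succ_lt_succ_iff,
      insertPerm_succ, Fin.succAbove_lt_succAbove_iff, skip_apply]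

end InsertPerm

/-! ### Shuffle sums over permutations agree with the shuffle product of the tensor algebra. -/

section Shuffles

open TensorAlgebra

variable {R : Type u} [CommRing R] {M X : Type*} [AddCommGroup M] [Module R M]
  [AddCommGroup X] [Module R X] {B : Type*} {e : Module.Basis B R M} {dg : B → ℤ}
  {gr : ℤ → Submodule R M}

/-- The exponent `kap` for the permuted sequence of degrees. -/
def kapPerm {n : ℕ} (p : ℕ → ℤ) (σ : Equiv.Perm (Fin n)) : ℤ :=
  ∑ i : Fin n, ((n - 1 - i : ℕ) : ℤ) * p (σ i)

lemma kapPerm_insertPerm {n : ℕ} (p : ℕ → ℤ) (j : Fin (n + 1)) (σ : Equiv.Perm (Fin n)) :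
    kapPerm p (insertPerm j σ) = n * p j + kapPerm (skip j p) σ := by
  rw [kapPerm, Fin.sum_univ_succ]
  simp only [insertPerm_zero, insertPerm_succ, Fin.val_zero, Nat.sub_zero, Nat.add_sub_cancel,
    Fin.val_succ, skip_apply]
  congr 1
  refine Finset.sum_congr rfl fun i _ => ?_
  congr 2
  omega

variable (R) in
/-- The tensor of the permuted sequence. -/
def tensPerm {n : ℕ} (a : ℕ → M) (σ : Equiv.Perm (Fin n)) : TensorAlgebra R M :=
  TensorAlgebra.tprod R M n fun i => a (σ i)

lemma tensPerm_insertPerm {n : ℕ} (a : ℕ → M) (j : Fin (n + 1)) (σ : Equiv.Perm (Fin n)) :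
    tensPerm R a (insertPerm j σ) = ι R (a j) * tensPerm R (skip j a) σ := by
  rw [tensPerm, tensPerm, tprod_apply, tprod_apply, List.ofFn_succ, List.prod_cons]
  simp only [insertPerm_zero, insertPerm_succ, skip_apply]

lemma skip_mem {p : ℕ → ℤ} {a : ℕ → M} (ha : ∀ i, a i ∈ gr (p i)) (j i : ℕ) :
    skip j a i ∈ gr (skip j p i) := by
  rw [skip, skip]
  split_ifs
  · exact ha _
  · exact ha _

lemma tens_skip (k : ℕ) (a : ℕ → M) : tens R k (skip k a) = tens R k a :=
  tens_congr fun i hi => by simp [skip, hi]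

lemma skip_add {α : Type*} (k : ℕ) (a : ℕ → α) :
    (fun i => skip k a (k + i)) = fun i => a (k + i + 1) := by
  funext i
  simp [skip]

variable (R) in
open Classical in
/-- The sum over shuffles. -/
def shuffleSum (n k : ℕ) (p : ℕ → ℤ) (a : ℕ → M) : TensorAlgebra R M :=
  ∑ σ : Equiv.Perm (Fin n), if IsShuffle k σ then
    chi R ((shuffleExp p σ + kapPerm p σ : ℤ) : ZMod 2) • tensPerm R a σ else 0

-- Grouping the permutations by their first letter leaves two cases by `isShuffle_insertPerm`;
-- `hterm` evaluates the sum with a fixed first letter.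
open Classical in
lemma shuffleSum_succ (n k : ℕ) (hk : k ≤ n + 1) (p : ℕ → ℤ) (a : ℕ → M) :
    shuffleSum R (n + 1) k p a =
      (if 0 < k then chi R ((n * p 0 : ℤ) : ZMod 2) •
        (ι R (a 0) * shuffleSum R n (k - 1) (skip 0 p) (skip 0 a)) else 0) +
      if k ≤ n then chi R ((k + p k * ∑ x ∈ Finset.range k, p x + n * p k : ℤ) : ZMod 2) •
        (ι R (a k) * shuffleSum R n k (skip k p) (skip k a)) else 0 := by
  have hterm : ∀ (j : Fin (n + 1)) (l : ℕ),
      ∑ σ : Equiv.Perm (Fin n), (if IsShuffle l σ then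
        chi R ((shuffleExp p (insertPerm j σ) + kapPerm p (insertPerm j σ) : ℤ) : ZMod 2) •
          tensPerm R a (insertPerm j σ) else 0) =
      chi R ((j + p j * ∑ x ∈ Finset.range j, p x + n * p j : ℤ) : ZMod 2) •
        (ι R (a j) * shuffleSum R n l (skip j p) (skip j a)) := by
    intro j l
    rw [shuffleSum, Finset.mul_sum Finset.univ, Finset.smul_sum]
    refine Finset.sum_congr rfl fun σ _ => ?_
    split_ifs
    · rw [tensPerm_insertPerm, kapPerm_insertPerm, shuffleExp_insertPerm, mul_smul_comm, smul_smul,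
        ← chi_add]
      congr 2
      push_cast
      ring
    · simp
  rw [shuffleSum, ← insertPerm_bijective.sum_comp, Fintype.sum_prod_type]
  have hsplit : ∀ (j : Fin (n + 1)) (σ : Equiv.Perm (Fin n)) (x : TensorAlgebra R M),
      (if IsShuffle k (insertPerm j σ) then x else 0) =
      (if (j : ℕ) = 0 ∧ 0 < k then (if IsShuffle (k - 1) σ then x else 0) else 0) +
      if (j : ℕ) = k then (if IsShuffle k σ then x else 0) else 0 := by
    intro j σ x
    by_cases h1 : (j : ℕ) = 0 ∧ 0 < k
    · have h2 : ¬ (j : ℕ) = k := by omega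
      simp only [isShuffle_insertPerm hk, h1.1, h1.2, true_and, if_true, (show ¬ 0 = k by omega),
        false_and, or_false, if_false, add_zero, and_self]
    · by_cases h2 : (j : ℕ) = k
      · rw [if_neg h1, if_pos h2, zero_add]
        refine if_congr ?_ rfl rfl
        rw [isShuffle_insertPerm hk]
        constructor
        · rintro (⟨h3, h4, -⟩ | h3)
          · exact absurd ⟨h3, h4⟩ h1
          · exact h3.2
        · exact fun h3 => Or.inr ⟨h2, h3⟩
      · rw [if_neg h1, if_neg h2, if_neg, zero_add]
        rw [isShuffle_insertPerm hk]
        tauto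
  simp only [hsplit, Finset.sum_add_distrib]
  congr 1
  · by_cases h : 0 < k
    · simp only [h, and_true, if_true]
      rw [Finset.sum_eq_single (0 : Fin (n + 1))]
      · simp only [Fin.val_zero, if_true]
        rw [hterm 0 (k - 1)]
        simp
      · intro j _ hj
        have : ¬ (j : ℕ) = 0 := fun h => hj (Fin.ext h)
        simp [this]
      · simp
    · simp [h]
  · split_ifs with h
    · rw [Finset.sum_eq_single (⟨k, by omega⟩ : Fin (n + 1))]
      · simp only [if_true]
        rw [hterm ⟨k, by omega⟩ k]
      · intro j _ hj
        have : ¬ (j : ℕ) = k := fun h => hj (Fin.ext h)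
        simp [this]
      · simp
    · refine Finset.sum_eq_zero fun j _ => ?_
      have : ¬ (j : ℕ) = k := by omega
      simp [this]

/-- Both sides obey the same recursion in the first letter. Signature times Koszul sign on `M`
becomes the Koszul sign of the desuspension once the décalage signs before and after permuting are
included. -/
lemma shuffleSum_eq (hH : ∀ i, HD e dg i = gr (i + 1)) (n k : ℕ) (hk : k ≤ n) {p : ℕ → ℤ}
    {a : ℕ → M} (ha : ∀ i, a i ∈ gr (p i)) :
    shuffleSum R n k p a = chi R (kap n p : ZMod 2) •
      shT e dg (tens R k a) (tens R (n - k) fun i => a (k + i)) := by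
  induction n generalizing k p a with
  | zero =>
    obtain rfl : k = 0 := by omega
    have h1 : ∀ σ : Equiv.Perm (Fin 0), IsShuffle 0 σ := fun σ i => i.elim0
    simp [shuffleSum, h1, shuffleExp, kapPerm, tensPerm, tprod_apply, kap]
  | succ n ih =>
    rw [shuffleSum_succ n k hk, ih (k - 1) (by omega) (skip_mem ha 0)]
    have h0 : ∀ c : ℕ → M, skip 0 c = fun i => c (i + 1) := fun c => by
      funext i; simp [skip]
    have h0' : skip 0 p = fun i => p (i + 1) := by
      funext i; simp [skip]
    rcases Nat.eq_zero_or_pos k with rfl | hk0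
    · rw [ih 0 (Nat.zero_le _) (skip_mem ha 0)]
      simp only [lt_irrefl, if_false, Nat.zero_le, if_true, zero_add, tens_zero, shT_one_left,
        Nat.sub_zero, tens_succ, h0, h0']
      rw [mul_smul_comm, smul_smul, ← chi_add, kap_succ]
      simp
    obtain ⟨k, rfl⟩ : ∃ k', k = k' + 1 := ⟨k - 1, by omega⟩
    rw [if_pos hk0, h0, h0', Nat.add_sub_cancel, Nat.add_sub_add_right]
    by_cases hkn : k + 1 ≤ n
    · obtain ⟨m, rfl⟩ : ∃ m, n = k + 1 + m := ⟨n - (k + 1), by omega⟩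
      rw [if_pos hkn, ih (k + 1) hkn (skip_mem ha (k + 1)), tens_skip, skip_add]
      have e1 : k + 1 + m - k = m + 1 := by omega
      have e2 : k + 1 + m - (k + 1) = m := by omega
      have e3 : (fun i => a (k + i + 1)) = fun i => a (k + 1 + i) := by
        funext i; congr 1; omega
      have e4 : (fun i => a (k + 1 + i + 1)) = fun i => a (k + 1 + (i + 1)) := rfl
      rw [e1, e2, e3, e4, tens_succ m, tens_succ k, Nat.add_zero,
        shT_ι_mul_ι_mul e dg (mem_HD_of_mem hH (ha 0)) (mem_HD_of_mem hH (ha (k + 1)))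
          (tens_mem_TD hH k fun i => ha (i + 1)), smul_add, mul_smul_comm, mul_smul_comm, smul_smul,
        smul_smul, smul_smul, ← chi_add, ← chi_add, ← chi_add]
      congr 3
      · rw [kap_succ]; push_cast; rfl
      · have h1 : kap (k + 1 + m + 1) p = kap (k + 1) p +
            (m + 1) * ∑ j ∈ Finset.range (k + 1), p j +
            (m * p (k + 1) + kap m fun i => p (k + 1 + (i + 1))) := by
          rw [add_assoc, kap_add, kap_succ]
          push_cast
          rfl
        have h2 : kap (k + 1 + m) (skip (k + 1) p) = kap (k + 1) p +
            m * ∑ j ∈ Finset.range (k + 1), p j + kap m fun i => p (k + 1 + (i + 1)) := by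
          rw [kap_add, skip_add, kap_congr fun i hi => show skip (k + 1) p i = p i by
            simp [skip, hi], Finset.sum_congr rfl fun j hj => show skip (k + 1) p j = p j by
            simp [skip, Finset.mem_range.1 hj]]
          rfl
        rw [h1, h2, Finset.sum_range_succ']
        have h3 : (2 : ZMod 2) = 0 := rfl
        push_cast
        generalize (∑ j ∈ Finset.range k, (p (j + 1) : ZMod 2)) = S
        linear_combination (p (k + 1) : ZMod 2) * (k + 1) * h3
    · obtain rfl : k = n := by omega
      rw [if_neg hkn, Nat.sub_self, tens_zero, shT_one_right, add_zero, tens_zero, shT_one_right,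
        tens_succ, kap_succ, mul_smul_comm, smul_smul, ← chi_add]
      push_cast
      rfl

variable [DirectSum.Decomposition gr]

lemma hat_shuffleSum (f : MultiFamily R M X) (n k : ℕ) {p : ℕ → ℤ} {a : ℕ → M}
    (ha : ∀ i, a i ∈ gr (p i)) : hat gr f (shuffleSum R n k p a) =
      open Classical in ∑ σ : Equiv.Perm (Fin n) with IsShuffle k σ,
        shuffleSign (fun i : Fin n => p i) σ • f n (fun i => a (σ i)) := by
  classical
  rw [shuffleSum, map_sum, Finset.sum_filter]
  refine Finset.sum_congr rfl fun σ _ => ?_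
  split_ifs
  · let a' : ℕ → M := fun i => if h : i < n then a (σ ⟨i, h⟩) else 0
    let p' : ℕ → ℤ := fun i => if h : i < n then p (σ ⟨i, h⟩) else 0
    have ha' : ∀ i, a' i ∈ gr (p' i) := fun i => by
      by_cases h : i < n
      · simpa [a', p', h] using ha _
      · simp [a', h]
    have h1 : (fun i : Fin n => a (σ i)) = fun i : Fin n => a' i := by funext i; simp [a']
    have h2 : kapPerm p σ = kap n p' := by
      rw [kap_eq_sum, kapPerm]
      refine Finset.sum_congr rfl fun i _ => ?_
      simp [p']
    rw [map_smul, tensPerm, h1, ← tens_eq_tprod, hat_tens f n ha', smul_smul, ← chi_add,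
      shuffleSign_eq, negOnePow_smul R, h2]
    congr 2
    push_cast
    have h3 : ∀ x : ZMod 2, x + x = 0 := by decide
    rw [add_assoc, h3, add_zero]
  · simp

lemma vanishesOnShuffles_of_shZero (hH : ∀ i, HD e dg i = gr (i + 1)) {f : MultiFamily R M X}
    (hf : ShZero e dg (hat gr f)) : VanishesOnShuffles gr f := by
  intro n k hk hkn p a ha
  let p' : ℕ → ℤ := fun i => if h : i < n then p ⟨i, h⟩ else 0
  let a' : ℕ → M := fun i => if h : i < n then a ⟨i, h⟩ else 0
  have ha' : ∀ i, a' i ∈ gr (p' i) := fun i => by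
    by_cases h : i < n
    · simpa [a', p', h] using ha ⟨i, h⟩
    · simp [a', h]
  have h1 : a = fun i : Fin n => a' i := by funext i; simp [a']
  have h2 : p = fun i : Fin n => p' i := by funext i; simp [p']
  have key := hat_shuffleSum f n k ha'
  obtain ⟨k, rfl⟩ : ∃ k', k = k' + 1 := ⟨k - 1, by omega⟩
  obtain ⟨m, hm⟩ : ∃ m, n - (k + 1) = m + 1 := ⟨n - (k + 1) - 1, by omega⟩
  rw [shuffleSum_eq hH n (k + 1) hkn.le ha', map_smul, hm,
    hf.shT (aug_tens_succ _ _) (aug_tens_succ _ _), smul_zero] at key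
  rw [h1, h2]
  exact key.symm

lemma shZero_hat (hH : ∀ i, HD e dg i = gr (i + 1)) {f : MultiFamily R M X} (hf0 : f 0 = 0)
    (hf : VanishesOnShuffles gr f) : ShZero e dg (hat gr f) := by
  refine ⟨hat_one hf0, fun x y hx hy => ?_⟩
  have hx' := List.length_pos_iff.2 hx
  have hy' := List.length_pos_iff.2 hy
  have ha := letters_mem hH (x ++ y)
  have h1 := hat_shuffleSum f (x ++ y).length x.length ha
  have h2 : tens R x.length (letters e (x ++ y)) = E e x := by
    rw [← tens_letters]
    refine tens_congr fun i hi => ?_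
    rw [letters, letters, List.getElem?_append_left hi]
  have h3 : (tens R ((x ++ y).length - x.length) fun i => letters e (x ++ y) (x.length + i)) =
      E e y := by
    rw [List.length_append, Nat.add_sub_cancel_left, ← tens_letters]
    refine tens_congr fun i _ => ?_
    rw [letters, letters, List.getElem?_append_right (Nat.le_add_right _ _),
      Nat.add_sub_cancel_left]
  have h4 := hf (x ++ y).length x.length hx' (by rw [List.length_append]; omega) _ _
    fun i => ha i
  rw [h4, shuffleSum_eq hH _ _ (by simp) ha, h2, h3, shT_E, map_smul] at h1
  rw [← chi_smul_chi_smul R (kap (x ++ y).length (degrees dg (x ++ y)) : ZMod 2)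
    (hat gr f (sh e dg x y)), h1, smul_zero]

end Shuffles

/-! ### Homogeneous bases. -/

section Bases

variable {R : Type u} [CommRing R] {M : Type v} [AddCommGroup M] [Module R M]

/-- Basis vectors receive their degree minus one, that is, their degree in the desuspension; hence
the shift in the conclusion. -/
lemma exists_homogeneous_basis {gr : ℤ → Submodule R M} (hgr : DirectSum.IsInternal gr)
    (hfree : ∀ i, Module.Free R (gr i)) :
    ∃ (B : Type v) (e : Module.Basis B R M) (dg : B → ℤ), ∀ i, HD e dg i = gr (i + 1) := by
  let v := fun i => Module.Free.chooseBasis R (gr i)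
  refine ⟨Σ i, Module.Free.ChooseBasisIndex R (gr i), hgr.collectedBasis v, fun b => b.1 - 1, fun i => le_antisymm ?_ fun x hx => ?_⟩
  · refine Submodule.span_le.2 ?_
    rintro _ ⟨b, hb, rfl⟩
    have := hgr.collectedBasis_mem v b
    simp only [Set.mem_ofPred_eq] at hb
    rwa [show b.1 = i + 1 by omega] at this
  · have h1 : (⟨x, hx⟩ : gr (i + 1)) ∈ Submodule.span R (Set.range (v (i + 1))) :=
      (v (i + 1)).mem_span _
    have h2 := Submodule.mem_map_of_mem (f := (gr (i + 1)).subtype) h1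
    rw [Submodule.map_span] at h2
    refine Submodule.span_mono ?_ h2
    rintro _ ⟨_, ⟨a, rfl⟩, rfl⟩
    refine ⟨⟨i + 1, a⟩, by simp, ?_⟩
    rw [hgr.collectedBasis_coe]
    rfl

end Bases

/-! ### Dictionary between `C_∞` structures and maps on the tensor algebra. -/

section Translation

open TensorAlgebra

variable {R : Type u} [CommRing R] {M X Y : Type*} [AddCommGroup M] [Module R M]
  [AddCommGroup X] [Module R X] [AddCommGroup Y] [Module R Y]
  {B : Type*} {e : Module.Basis B R M} {dg : B → ℤ}
  {gr : ℤ → Submodule R M} [DirectSum.Decomposition gr] {gr' : ℤ → Submodule R X}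

lemma chi_smul_injective (i : ZMod 2) {x y : X} (h : chi R i • x = chi R i • y) : x = y := by
  rw [← chi_smul_chi_smul R i x, h, chi_smul_chi_smul]

lemma shZero_unhat (hH : ∀ i, HD e dg i = gr (i + 1)) {α : TensorAlgebra R M →ₗ[R] X}
    (hα : ShZero e dg α) : VanishesOnShuffles gr (unhat gr α) :=
  vanishesOnShuffles_of_shZero hH (by rwa [hat_unhat hH])

lemma hat_mem_HD (hH : ∀ i, HD e dg i = gr (i + 1)) {m : MultiFamily R M M}
    (hm : HasShift gr gr 2 m) (w : List B) : hat gr m (E e w) ∈ HD e dg (wdeg dg w + 1) := by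
  rw [hH]
  convert hat_mem hH hm w using 2
  ring

/-- By `hat_coder_tens` the value on a word is a sign times a Stasheff sum. -/
lemma IsAInfAlgebra.hat_coder (hH : ∀ i, HD e dg i = gr (i + 1)) {m : MultiFamily R M M}
    (hm : IsAInfAlgebra gr m) : hat gr m ∘ₗ coder e dg (hat gr m) = 0 := by
  refine ext_E (e := e) fun w => ?_
  cases w with
  | nil => simp
  | cons a w =>
    rw [LinearMap.comp_apply, ← tens_letters,
      hat_coder_tens hH hm.zero hm.degree m _ (letters_mem hH _),
      hm.stasheff (a :: w).length (by simp) _ _ (letters_mem hH _), smul_zero]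
    rfl

lemma isCInfAlgebra_unhat (hH : ∀ i, HD e dg i = gr (i + 1)) {b : TensorAlgebra R M →ₗ[R] M}
    (hb : ShZero e dg b) (hdeg : ∀ w, b (E e w) ∈ HD e dg (wdeg dg w + 1))
    (hbb : b ∘ₗ coder e dg b = 0) : IsCInfAlgebra gr (unhat gr b) := by
  have hd : HasShift gr gr 2 (unhat gr b) := unhat_hasShift hH fun w => by
    have := hdeg w
    rw [hH] at this
    convert this using 2
    ring
  refine ⟨⟨unhat_zero hb.1, hd, fun n hn p a ha => ?_⟩, shZero_unhat hH hb⟩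
  refine chi_smul_injective (R := R) (kap n p : ZMod 2) ?_
  rw [← hat_coder_tens hH (unhat_zero hb.1) hd _ n ha, hat_unhat hH, ← LinearMap.comp_apply, hbb]
  simp

lemma isCInfMorphism_unhat [DirectSum.Decomposition gr'] (hH : ∀ i, HD e dg i = gr (i + 1))
    {m : MultiFamily R M M} (hm0 : m 0 = 0) (hm : HasShift gr gr 2 m) {m' : MultiFamily R X X}
    {G : TensorAlgebra R M →ₗ[R] X} (hG : ShZero e dg G)
    (hdeg : ∀ w, G (E e w) ∈ gr' (wdeg dg w + 1))
    (hGb : hat gr' m' ∘ₗ comap e G = G ∘ₗ coder e dg (hat gr m)) :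
    IsCInfMorphism gr gr' m m' (unhat gr G) := by
  have hd : HasShift gr gr' 1 (unhat gr G) := unhat_hasShift hH hdeg
  refine ⟨⟨unhat_zero hG.1, hd, fun n hn p a ha => ?_⟩, shZero_unhat hH hG⟩
  refine chi_smul_injective (R := R) (kap n p : ZMod 2) ?_
  rw [← hat_coder_tens hH hm0 hm _ n ha, hat_unhat hH,
    ← hat_comap_tens (e := e) (gr' := gr') m' (unhat_zero hG.1) hd n ha, hat_unhat hH]
  exact (LinearMap.congr_fun hGb (tens R n a)).symm

lemma firstComponent_unhat (hH : ∀ i, HD e dg i = gr (i + 1)) (α : TensorAlgebra R M →ₗ[R] X) :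
    firstComponent (unhat gr α) = α ∘ₗ ι R := by
  ext x
  rw [← hat_ι (gr := gr), hat_unhat hH]
  rfl

lemma hat_linearFamily_id (hH : ∀ i, HD e dg i = gr (i + 1)) :
    hat gr (linearFamily (LinearMap.id : M →ₗ[R] M)) = cog e := by
  refine ext_E (e := e) fun w => ?_
  obtain _ | ⟨a, _ | ⟨b, w⟩⟩ := w
  · rw [E_nil, cog_one, hat_one rfl]
  · rw [E_singleton, hat_ι, cog_ι]
    rfl
  · rw [hat_E hH, E_cons, cog_ι_mul, aug_E e (by simp), zero_smul]
    change _ • (0 : M) = 0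
    rw [smul_zero]

lemma isComposite_id [DirectSum.Decomposition gr'] (hH : ∀ i, HD e dg i = gr (i + 1))
    {G : TensorAlgebra R M →ₗ[R] X} (hG1 : G 1 = 0) (hdeg : ∀ w, G (E e w) ∈ gr' (wdeg dg w + 1))
    {h : TensorAlgebra R X →ₗ[R] M} (hh : hat gr' (unhat gr' h) = h)
    (hGh : h ∘ₗ comap e G = cog e) :
    IsComposite gr (unhat gr' h) (unhat gr G) (linearFamily LinearMap.id) := by
  intro n hn p a ha
  refine chi_smul_injective (R := R) (kap n p : ZMod 2) ?_
  rw [← hat_tens (gr := gr) _ n ha, hat_linearFamily_id hH,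
    ← hat_comap_tens (e := e) (gr' := gr') _ (unhat_zero hG1) (unhat_hasShift hH hdeg) n ha,
    hat_unhat hH, hh, ← hGh]
  rfl

variable (A : CDGAlg.{u, v} R)

/-- The two sides of the morphism relation, multiplied by the same décalage sign, are the two sides
of the twisting cochain equation. -/
lemma twisting_eq_of_relation (hH : ∀ i, HD e dg i = gr (i + 1)) {m : MultiFamily R M M}
    {f : MultiFamily R M A.carrier} (hm : IsAInfAlgebra gr m)
    (hf : IsAInfMorphism gr A.gr m A.ops f) :
    A.d ∘ₗ hat gr f = hat gr f ∘ₗ coder e dg (hat gr m) +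
      cup e A.mul (hat gr f ∘ₗ sgn e dg) (hat gr f) := by
  rw [← sub_eq_iff_eq_add]
  refine ext_E (e := e) fun w => ?_
  cases w with
  | nil => rw [LinearMap.sub_apply, cup_E]; simp [hat_one hf.zero]
  | cons a w =>
    have ha := letters_mem hH (a :: w)
    rw [← tens_letters, ← smul_outerSum_ops hH A hf.zero _ ha, LinearMap.comp_apply,
      hat_coder_tens hH hm.zero hm.degree f _ ha, hf.relation (a :: w).length (by simp) _ _ ha]

lemma isCInfMorphism_ops_unhat (hH : ∀ i, HD e dg i = gr (i + 1))
    {m : MultiFamily R M M} (hm0 : m 0 = 0) (hm : HasShift gr gr 2 m)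
    {τ : TensorAlgebra R M →ₗ[R] A.carrier} (hτ : ShZero e dg τ)
    (hdeg : ∀ w, τ (E e w) ∈ A.gr (wdeg dg w + 1))
    (heq : A.d ∘ₗ τ = τ ∘ₗ coder e dg (hat gr m) + cup e A.mul (τ ∘ₗ sgn e dg) τ) :
    IsCInfMorphism gr A.gr m A.ops (unhat gr τ) := by
  have hd : HasShift gr A.gr 1 (unhat gr τ) := unhat_hasShift hH hdeg
  refine ⟨⟨unhat_zero hτ.1, hd, fun n hn p a ha => ?_⟩, shZero_unhat hH hτ⟩
  refine chi_smul_injective (R := R) (kap n p : ZMod 2) ?_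
  rw [← hat_coder_tens hH hm0 hm _ n ha, smul_outerSum_ops hH A (unhat_zero hτ.1) n ha,
    hat_unhat hH, heq, add_sub_cancel_right]
  rfl

end Translation

/-! ### Minimal models as twisting cochains. -/

section Models

open TensorAlgebra

variable {R : Type u} [CommRing R] {A : CDGAlg.{u, v} R} {B : Type*}
  {e : Module.Basis B R A.Cohomology} {dg : B → ℤ}

lemma CDGAlg.leibniz_signMap (A : CDGAlg.{u, v} R) (a b : A.carrier) :
    A.d (A.mul a b) = A.mul (A.d a) b + A.mul (signMap A.gr a) (A.d b) := by
  induction a using DirectSum.Decomposition.inductionOn A.gr with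
  | zero => simp
  | @homogeneous j x =>
    rw [A.leibniz_chi x.2, signMap_of_mem x.2, map_smul, LinearMap.smul_apply]
  | add x y hx hy => simp only [map_add, LinearMap.add_apply, hx, hy]; abel

lemma signMap_signMap {M : Type*} [AddCommGroup M] [Module R M] (gr : ℤ → Submodule R M)
    [DirectSum.Decomposition gr] (a : M) : signMap gr (signMap gr a) = a := by
  induction a using DirectSum.Decomposition.inductionOn gr with
  | zero => simp
  | homogeneous x =>
    rw [signMap_of_mem x.2, map_smul, signMap_of_mem x.2, chi_smul_chi_smul]
  | add x y hx hy => simp only [map_add, hx, hy]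

lemma CDGAlg.d_signMap (A : CDGAlg.{u, v} R) (a : A.carrier) :
    A.d (signMap A.gr a) = - signMap A.gr (A.d a) := by
  induction a using DirectSum.Decomposition.inductionOn A.gr with
  | zero => simp
  | @homogeneous j x =>
    rw [signMap_of_mem x.2, map_smul, signMap_of_mem (A.d_mem x.2)]
    push_cast
    rw [chi_add, chi_one]
    simp
  | add x y hx hy => simp only [map_add, hx, hy]; abel

lemma CDGAlg.cls_eq_cls (A : CDGAlg.{u, v} R) {x y : A.cocycles} :
    A.cls x = A.cls y ↔ ∃ z, A.d z = (x : A.carrier) - y := by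
  rw [Submodule.mkQ_apply, Submodule.mkQ_apply, Submodule.Quotient.eq]
  rfl

lemma CDGAlg.cls_mul_congr (A : CDGAlg.{u, v} R) {x x' y y' : A.cocycles} (hx : A.cls x = A.cls x')
    (hy : A.cls y = A.cls y') : A.cls ⟨A.mul x y, A.mul_mem_cocycles x y⟩ =
      A.cls ⟨A.mul x' y', A.mul_mem_cocycles x' y'⟩ := by
  obtain ⟨z, hz⟩ := A.cls_eq_cls.1 hx
  obtain ⟨z', hz'⟩ := A.cls_eq_cls.1 hy
  -- From `x y - x' y' = (x - x') y + x' (y - y')`; `signMap` absorbs the sign of the Leibniz rule.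
  refine A.cls_eq_cls.2 ⟨A.mul z y + A.mul (signMap A.gr x') z', ?_⟩
  have h1 : A.d y = 0 := y.2
  have h2 : A.d x' = 0 := x'.2
  rw [map_add, A.leibniz_signMap, A.leibniz_signMap, hz, hz', h1, A.d_signMap, h2, signMap_signMap]
  simp only [map_zero, neg_zero, LinearMap.zero_apply, add_zero, zero_add, map_sub,
    LinearMap.sub_apply]
  abel

lemma CDGAlg.isQuasiIso_of_choosesCocycles (A : CDGAlg.{u, v} R)
    {φ : A.Cohomology →ₗ[R] A.carrier} (hφ : A.ChoosesCocycles φ) : IsQuasiIso 0 A.d φ := by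
  refine ⟨fun x => ?_, fun x _ hx => ?_, fun z hz => ?_⟩
  · obtain ⟨h, -⟩ := hφ x
    have h' : A.d (φ x) = 0 := h
    simp [h']
  · obtain ⟨y', hy⟩ := hx
    obtain ⟨h, hc⟩ := hφ x
    refine ⟨0, ?_⟩
    rw [← hc, LinearMap.zero_apply, ← map_zero A.cls]
    refine A.cls_eq_cls.2 ⟨y', ?_⟩
    simp [hy]
  · obtain ⟨h, hc⟩ := hφ (A.cls ⟨z, hz⟩)
    obtain ⟨y, hy⟩ := A.cls_eq_cls.1 hc.symm
    refine ⟨A.cls ⟨z, hz⟩, y, rfl, ?_⟩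
    rw [hy]
    simp

variable (hHD : ∀ i, HD e dg i = A.cohomologyGr (i + 1))

include hHD

lemma CDGAlg.IsMinimalModel.isTwisting {m : MultiFamily R A.Cohomology A.Cohomology}
    {f : MultiFamily R A.Cohomology A.carrier} (h : A.IsMinimalModel m f) :
    IsTwisting A e dg (hat A.cohomologyGr m) (hat A.cohomologyGr f) where
  shb := shZero_hat hHD h.algebra.zero h.algebra.shuffle
  shτ := shZero_hat hHD h.morphism.zero h.morphism.shuffle
  degb := hat_mem_HD hHD h.algebra.degree
  degτ := hat_mem hHD h.morphism.degree
  low := by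
    rintro (_ | ⟨a, _ | ⟨b, w⟩⟩) hw
    · exact hat_one h.algebra.zero
    · rw [hat_E hHD]
      change _ • m 1 _ = 0
      rw [h.minimal]
      simp
    · simp at hw
  eq := twisting_eq_of_relation A hHD h.algebra.toIsAInfAlgebra h.morphism.toIsAInfMorphism
  sq := h.algebra.toIsAInfAlgebra.hat_coder hHD

omit hHD in
lemma CDGAlg.IsMinimalModel.choosesCocycles {m : MultiFamily R A.Cohomology A.Cohomology}
    {f : MultiFamily R A.Cohomology A.carrier} (h : A.IsMinimalModel m f) :
    A.ChoosesCocycles (hat A.cohomologyGr f ∘ₗ ι R) := by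
  have : hat A.cohomologyGr f ∘ₗ ι R = firstComponent f := LinearMap.ext fun x => hat_ι f x
  rw [this]
  exact h.first

/-- The binary operation of the model given by a twisting cochain is the product. -/
lemma product_of_twisting {b : TensorAlgebra R A.Cohomology →ₗ[R] A.Cohomology}
    {τ : TensorAlgebra R A.Cohomology →ₗ[R] A.carrier} (h : IsTwisting A e dg b τ)
    (hcls : A.ChoosesCocycles (τ ∘ₗ ι R)) (x y : A.cocycles) :
    unhat A.cohomologyGr b 2 ![A.cls x, A.cls y] =
      A.cls ⟨A.mul x y, A.mul_mem_cocycles x y⟩ := by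
  let φ : A.Cohomology →ₗ[R] A.cocycles := (τ ∘ₗ ι R).codRestrict A.cocycles fun h => (hcls h).1
  have hφ : ∀ h, A.cls (φ h) = h := fun h => (hcls h).2
  let mul' : A.cocycles →ₗ[R] A.cocycles →ₗ[R] A.Cohomology :=
    LinearMap.mk₂ R (fun x y => A.cls ⟨A.mul x y, A.mul_mem_cocycles x y⟩)
      (fun x x' y => by rw [← map_add]; congr 1; exact Subtype.ext (by simp))
      (fun c x y => by rw [← map_smul]; congr 1; exact Subtype.ext (by simp))
      (fun x y y' => by rw [← map_add]; congr 1; exact Subtype.ext (by simp))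
      (fun c x y => by rw [← map_smul]; congr 1; exact Subtype.ext (by simp))
  -- Both sides are bilinear, so the comparison reduces to two basis elements.
  have key : ∀ h k, unhat A.cohomologyGr b 2 ![h, k] = mul' (φ h) (φ k) := by
    let m2 : A.Cohomology →ₗ[R] A.Cohomology →ₗ[R] A.Cohomology :=
      LinearMap.mk₂ R (fun h k => b (ι R (signMap A.cohomologyGr h) * ι R k))
        (by intros; simp [add_mul]) (by intros; simp) (by intros; simp [mul_add]) (by intros; simp)
    have h1 : ∀ h k, unhat A.cohomologyGr b 2 ![h, k] = m2 h k := by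
      intro h k
      change b (TensorAlgebra.tprod R _ 2 _) = _
      rw [TensorAlgebra.tprod_apply]
      simp [m2]
    have h2 : m2 = mul'.compl₁₂ φ φ := by
      refine e.ext fun i => e.ext fun j => ?_
      have hi : e i ∈ A.cohomologyGr (dg i + 1) := by rw [← hHD]; exact mem_HD e dg i
      -- On two letters the twisting equation is `d τ(ij) = τ(b(ij)) + (-1)^{|i|} τ(i) τ(j)`. After
      -- multiplication by the décalage sign it says that `m_2` and the product of representatives
      -- are cohomologous.
      have h3 := LinearMap.congr_fun h.eq (E e [i, j])
      have hc : coder e dg b (E e [i, j]) = ι R (b (E e [i, j])) := by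
        rw [coder_vanish dg h.low h.shb.1 _ (by simp)]
      rw [LinearMap.add_apply, LinearMap.comp_apply, LinearMap.comp_apply, hc, cup_E] at h3
      simp only [spl_cons, spl_nil, LinearMap.comp_apply, sgn_E, map_smul, E_nil, h.shτ.1, map_zero, smul_zero,
        LinearMap.smul_apply, LinearMap.zero_apply, zero_add, add_zero, E_singleton] at h3
      change b (ι R (signMap A.cohomologyGr (e i)) * ι R (e j)) = _
      rw [signMap_of_mem hi, map_smul, smul_mul_assoc, map_smul, ← hφ (b _)]
      have h4 : ι R (e i) * ι R (e j) = E e [i, j] := by simp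
      rw [h4, ← map_smul]
      refine A.cls_eq_cls.2 ⟨chi R ((dg i + 1 : ℤ) : ZMod 2) • τ (E e [i, j]), ?_⟩
      rw [map_smul, h3, smul_add]
      change _ = _ • τ (ι R _) - A.mul (τ (ι R (e i))) (τ (ι R (e j)))
      rw [sub_eq_add_neg]
      congr 1
      have h5 : par dg [i] = (dg i : ZMod 2) := by simp
      rw [h5, smul_smul, ← chi_add]
      push_cast
      have h6 : ∀ z : ZMod 2, z + 1 + z = 1 := by decide
      rw [h6]
      simp
    intro h k
    rw [h1, h2]
    rfl
  rw [key]
  exact A.cls_mul_congr (hφ _) (hφ _)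

lemma exists_minimalModel [Algebra ℚ R] : ∃ (m : MultiFamily R A.Cohomology A.Cohomology)
    (f : MultiFamily R A.Cohomology A.carrier), A.IsMinimalModel m f := by
  obtain ⟨b, τ, h, hdef, hbb⟩ := exists_model hHD
  have heq : A.d ∘ₗ τ = τ ∘ₗ coder e dg b + cup e A.mul (τ ∘ₗ sgn e dg) τ := by
    rw [defect, sub_sub, sub_eq_zero] at hdef
    exact hdef
  have htw : IsTwisting A e dg b τ := ⟨h.shb, h.shτ, h.degb, h.degτ, h.low, heq, hbb⟩
  have halg := isCInfAlgebra_unhat hHD h.shb h.degb hbb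
  have hone : unhat A.cohomologyGr b 1 = 0 := by
    ext x
    have h1 : firstComponent (unhat A.cohomologyGr b) = 0 := by
      rw [firstComponent_unhat hHD]
      refine e.ext fun a => ?_
      rw [LinearMap.comp_apply, ← E_singleton, h.low _ (by simp)]
      rfl
    have h2 := LinearMap.congr_fun h1 (x 0)
    rw [firstComponent] at h2
    refine Eq.trans ?_ h2
    change unhat A.cohomologyGr b 1 x = unhat A.cohomologyGr b 1 _
    congr 1
    funext i
    fin_cases i
    rfl
  have hfirst : firstComponent (unhat A.cohomologyGr b) = 0 := by
    ext x
    change unhat A.cohomologyGr b 1 _ = 0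
    rw [hone]
    rfl
  refine ⟨unhat A.cohomologyGr b, unhat A.cohomologyGr τ, ⟨halg, hone,
    product_of_twisting hHD htw h.cls, ?_, ?_, ?_⟩⟩
  · exact isCInfMorphism_ops_unhat A hHD halg.zero halg.degree h.shτ h.degτ
      (by rw [hat_unhat hHD]; exact heq)
  · rw [hfirst, firstComponent_unhat hHD]
    exact A.isQuasiIso_of_choosesCocycles h.cls
  · rw [firstComponent_unhat hHD]
    exact h.cls

end Models

/-! ### Extension of maps of commutative dg algebras to minimal models. -/

section Morphisms

open TensorAlgebra

variable {R : Type u} [CommRing R] [Algebra ℚ R] {A : CDGAlg.{u, v} R} {A' : CDGAlg.{u, w} R}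
  {B B' : Type*} {e : Module.Basis B R A.Cohomology} {dg : B → ℤ}
  {e' : Module.Basis B' R A'.Cohomology} {dg' : B' → ℤ}

/-- Because `g` is a multiplicative chain map, `g ∘ f` is a twisting cochain with values in `A'`, to
which `exists_ext` applies. Its last clause makes `f'(G(a))` and `g(f(a))` cohomologous, which
identifies the linear part. -/
lemma exists_morphism_hat (hHD : ∀ i, HD e dg i = A.cohomologyGr (i + 1))
    (hHD' : ∀ i, HD e' dg' i = A'.cohomologyGr (i + 1)) (g : CDGAlg.Hom A A')
    {m : MultiFamily R A.Cohomology A.Cohomology} {f : MultiFamily R A.Cohomology A.carrier}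
    {m' : MultiFamily R A'.Cohomology A'.Cohomology} {f' : MultiFamily R A'.Cohomology A'.carrier}
    (h : A.IsMinimalModel m f) (h' : A'.IsMinimalModel m' f') :
    ∃ G : TensorAlgebra R A.Cohomology →ₗ[R] A'.Cohomology, ShZero e dg G ∧
      (∀ w, G (E e w) ∈ HD e' dg' (wdeg dg w)) ∧
      hat A'.cohomologyGr m' ∘ₗ comap e G = G ∘ₗ coder e dg (hat A.cohomologyGr m) ∧
      G ∘ₗ ι R = g.cohomologyMap := by
  have ht := h.isTwisting hHD
  have htw : IsTwisting A' e dg (hat A.cohomologyGr m) (g.toFun ∘ₗ hat A.cohomologyGr f) := by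
    refine ⟨ht.shb, ht.shτ.comp _, ht.degb, fun w => g.map_mem (ht.degτ w), ht.low, ?_, ht.sq⟩
    have h1 : A'.d ∘ₗ g.toFun = g.toFun ∘ₗ A.d := LinearMap.ext fun x => (g.map_d x).symm
    rw [← LinearMap.comp_assoc, h1, LinearMap.comp_assoc, ht.eq]
    refine ext_E (e := e) fun w => ?_
    rw [LinearMap.comp_apply, LinearMap.add_apply, LinearMap.add_apply, map_add, cup_E, cup_E,
      map_spl]
    congr 1
    exact spl_congr fun u v _ => g.map_mul _ _
  have hcls' := h'.choosesCocycles
  obtain ⟨G, hsh, hdeg, hG, hlin⟩ := exists_ext hHD' htw (h'.isTwisting hHD') hcls'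
  refine ⟨G, hsh, hdeg, hG, e.ext fun a => ?_⟩
  obtain ⟨y, hy⟩ := hlin a
  obtain ⟨hz, hc⟩ := h.choosesCocycles (e a)
  obtain ⟨hz', hc'⟩ := hcls' (G (ι R (e a)))
  have h2 : g.cohomologyMap (e a) = A'.cls ⟨g.toFun (hat A.cohomologyGr f (ι R (e a))), by
      have hz0 : A.d (hat A.cohomologyGr f (ι R (e a))) = 0 := hz
      rw [LinearMap.mem_ker, ← g.map_d, hz0, map_zero]⟩ := by
    conv_lhs => rw [← hc]
    rfl
  rw [h2]
  refine hc'.symm.trans (A'.cls_eq_cls.2 ⟨y, ?_⟩)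
  change _ = hat A'.cohomologyGr f' (ι R (G (ι R _))) - g.toFun (hat A.cohomologyGr f (ι R (e a)))
  rw [hy]
  simp

end Morphisms

/-! ### Existence, functoriality and uniqueness for free cohomology. -/

section Conclusions

open TensorAlgebra

variable {R : Type u} [CommRing R] [Algebra ℚ R] {A : CDGAlg.{u, v} R} {A' : CDGAlg.{u, w} R}

/-- The identity of a commutative dg algebra. -/
def CDGAlg.Hom.id (A : CDGAlg.{u, v} R) : CDGAlg.Hom A A where
  toFun := LinearMap.id
  map_mem h := h
  map_d _ := rfl
  map_mul _ _ := rfl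

omit [Algebra ℚ R] in
lemma CDGAlg.Hom.cohomologyMap_id (A : CDGAlg.{u, v} R) :
    (CDGAlg.Hom.id A).cohomologyMap = LinearMap.id := by
  refine LinearMap.ext fun x => ?_
  obtain ⟨z, rfl⟩ := Submodule.mkQ_surjective _ x
  rfl

theorem exists_minimalModel_of_free (hA : ∀ i : ℤ, Module.Free R (A.cohomologyGr i)) :
    ∃ (m : MultiFamily R A.Cohomology A.Cohomology) (f : MultiFamily R A.Cohomology A.carrier),
      A.IsMinimalModel m f := by
  obtain ⟨B, e, dg, hHD⟩ := exists_homogeneous_basis A.cohomology_isInternal hA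
  exact exists_minimalModel hHD

theorem exists_morphism_of_free (hA : ∀ i : ℤ, Module.Free R (A.cohomologyGr i))
    (hA' : ∀ i : ℤ, Module.Free R (A'.cohomologyGr i)) (g : CDGAlg.Hom A A')
    {m : MultiFamily R A.Cohomology A.Cohomology} {f : MultiFamily R A.Cohomology A.carrier}
    {m' : MultiFamily R A'.Cohomology A'.Cohomology} {f' : MultiFamily R A'.Cohomology A'.carrier}
    (h : A.IsMinimalModel m f) (h' : A'.IsMinimalModel m' f') :
    ∃ G : MultiFamily R A.Cohomology A'.Cohomology,
      IsCInfMorphism A.cohomologyGr A'.cohomologyGr m m' G ∧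
        firstComponent G = g.cohomologyMap := by
  obtain ⟨B, e, dg, hHD⟩ := exists_homogeneous_basis A.cohomology_isInternal hA
  obtain ⟨B', e', dg', hHD'⟩ := exists_homogeneous_basis A'.cohomology_isInternal hA'
  obtain ⟨G, hsh, hdeg, hG, hlin⟩ := exists_morphism_hat hHD hHD' g h h'
  refine ⟨unhat A.cohomologyGr G, isCInfMorphism_unhat hHD h.algebra.zero h.algebra.degree hsh
    (fun w => ?_) hG, ?_⟩
  · rw [← hHD']
    exact hdeg w
  · rw [firstComponent_unhat hHD, hlin]

/-- Lift the identity of `A`. The resulting morphism is the identity on letters, hence invertible by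
`exists_inverse_morphism`. -/
theorem exists_isomorphism_of_free (hA : ∀ i : ℤ, Module.Free R (A.cohomologyGr i))
    {m m' : MultiFamily R A.Cohomology A.Cohomology}
    {f f' : MultiFamily R A.Cohomology A.carrier}
    (h : A.IsMinimalModel m f) (h' : A.IsMinimalModel m' f') :
    ∃ G : MultiFamily R A.Cohomology A.Cohomology,
      IsCInfIso A.cohomologyGr A.cohomologyGr m m' G ∧ firstComponent G = LinearMap.id := by
  obtain ⟨B, e, dg, hHD⟩ := exists_homogeneous_basis A.cohomology_isInternal hA
  obtain ⟨G, hsh, hdeg, hG, hlin⟩ := exists_morphism_hat hHD hHD (CDGAlg.Hom.id A) h h'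
  rw [CDGAlg.Hom.cohomologyMap_id] at hlin
  have hb := (h.isTwisting hHD).low
  obtain ⟨k, ksh, kdeg, hk, hkG, hGk⟩ := exists_inverse_morphism
    (h.isTwisting hHD).shb.1 (h'.isTwisting hHD).shb.1 hsh hdeg (LinearMap.congr_fun hlin) hG
  have hdeg' : ∀ w, G (E e w) ∈ A.cohomologyGr (wdeg dg w + 1) := fun w => by
    rw [← hHD]
    exact hdeg w
  have kdeg' : ∀ w, k (E e w) ∈ A.cohomologyGr (wdeg dg w + 1) := fun w => by
    rw [← hHD]
    exact kdeg w
  refine ⟨unhat A.cohomologyGr G, ⟨isCInfMorphism_unhat hHD h.algebra.zero h.algebra.degree hsh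
    hdeg' hG, unhat A.cohomologyGr k, isCInfMorphism_unhat hHD h'.algebra.zero h'.algebra.degree ksh
    kdeg' hk, isComposite_id hHD hsh.1 hdeg' (hat_unhat hHD k) hkG,
    isComposite_id hHD ksh.1 kdeg' (hat_unhat hHD G) hGk⟩, ?_⟩
  rw [firstComponent_unhat hHD, hlin]

end Conclusions

/-! ### The bar construction, transported to the tensor algebra. -/

section BarWords

open TensorAlgebra

variable {R : Type u} [CommRing R] {M X Y : Type*} [AddCommGroup M] [Module R M]
  [AddCommGroup X] [Module R X] [AddCommGroup Y] [Module R Y]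

lemma ext_tens {f g : TensorAlgebra R M →ₗ[R] X} (h : ∀ n a, f (tens R n a) = g (tens R n a)) :
    f = g := by
  have key : f ∘ₗ (ofDirectSum (R := R) (M := M)).toLinearMap =
      g ∘ₗ (ofDirectSum (R := R) (M := M)).toLinearMap := by
    refine DirectSum.linearMap_ext _ fun n => PiTensorProduct.ext (MultilinearMap.ext fun x => ?_)
    have h1 : ofDirectSum (DirectSum.lof R ℕ (fun n => ⨂[R]^n M) n (PiTensorProduct.tprod R x)) =
        tens R n (fun i => if h : i < n then x ⟨i, h⟩ else 0) := by
      rw [tens_eq_tprod]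
      refine (ofDirectSum_of_tprod x).trans ?_
      congr 1
      funext i
      simp
    change f (ofDirectSum (DirectSum.lof R ℕ (fun n => ⨂[R]^n M) n (PiTensorProduct.tprod R x))) =
      g (ofDirectSum (DirectSum.lof R ℕ (fun n => ⨂[R]^n M) n (PiTensorProduct.tprod R x)))
    rw [h1, h]
  refine LinearMap.ext fun x => ?_
  have := LinearMap.congr_fun key (toDirectSum x)
  simpa using this

lemma ofDirectSum_tensorAlong {n : ℕ} (c : Composition n) (F : ℕ → MultiFamily R M X)
    (a : ℕ → M) : ofDirectSum (tensorAlong c (fun j => F j (c.blocksFun j))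
      (PiTensorProduct.tprod R fun i => a i)) =
    tens R c.blocks.length (fun i => chunks (evalSeq (F i)) c.blocks a i) := by
  rw [tensorAlong, LinearMap.comp_apply, PiTensorProduct.lift.tprod, tens_eq_tprod]
  refine (ofDirectSum_of_tprod (R := R) _).trans ?_
  congr 1
  funext i
  rw [chunks_eq]
  rfl

/-- A block of size other than one contributes a zero factor, so only the composition into ones
remains. This evaluates the identity factors to the right of the marked block. -/
lemma tens_chunks_id (n : ℕ) (a : ℕ → M) :
    ∑ c : Composition n, tens R c.blocks.length
      (chunks (evalSeq (linearFamily (LinearMap.id : M →ₗ[R] M))) c.blocks a) = tens R n a := by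
  induction n generalizing a with
  | zero =>
    rw [sum_composition_zero fun ks => tens R ks.length
      (chunks (evalSeq (linearFamily (LinearMap.id : M →ₗ[R] M))) ks a)]
    rfl
  | succ n ih =>
    rw [sum_composition (Nat.succ_ne_zero n) fun ks => tens R ks.length
      (chunks (evalSeq (linearFamily (LinearMap.id : M →ₗ[R] M))) ks a), Finset.sum_range_succ',
      Finset.sum_eq_zero, zero_add]
    · simp only [List.length_cons, tens_succ]
      change ∑ c : Composition (n + 1 - (0 + 1)), ι R (a 0) * tens R c.blocks.length (chunks _ c.blocks
        fun j => a (0 + 1 + j)) = _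
      rw [← Finset.mul_sum, show n + 1 - (0 + 1) = n by omega, ih]
      congr 2
      funext i
      congr 1
      omega
    · intro k _
      refine Finset.sum_eq_zero fun c _ => ?_
      rw [List.length_cons, tens_succ]
      change ι R (0 : M) * _ = 0
      simp

/-- The sum over all positions of the tensors that apply `b` at the position, `f` to its left and
`g` to its right. -/
def markSum (f b g : MultiFamily R M X) : List ℕ → (ℕ → M) → TensorAlgebra R X
  | [], _ => 0
  | k :: ks, a => ι R (evalSeq b k a) * tens R ks.length (chunks (evalSeq g) ks fun j => a (k + j)) +
      ι R (evalSeq f k a) * markSum f b g ks (fun j => a (k + j))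

lemma markSum_eq (f b g : MultiFamily R M X) (ks : List ℕ) (a : ℕ → M) :
    ∑ i ∈ Finset.range ks.length, tens R ks.length (fun j =>
      chunks (evalSeq (if j < i then f else if j = i then b else g)) ks a j) =
      markSum f b g ks a := by
  induction ks generalizing a with
  | nil => rfl
  | cons k ks ih =>
    rw [List.length_cons, Finset.sum_range_succ', markSum, ← ih, Finset.mul_sum, add_comm]
    congr 1
    refine Finset.sum_congr rfl fun i _ => ?_
    rw [tens_succ]
    congr 1
    refine tens_congr fun j _ => ?_
    simp only [Nat.add_lt_add_iff_right, Nat.add_right_cancel_iff]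
    rfl

lemma tens_hat_eq {gr : ℤ → Submodule R M} [DirectSum.Decomposition gr] (f : MultiFamily R M X)
    (k : ℕ) (a : ℕ → M) : evalSeq (suspended gr f) k a = hat gr f (tens R k a) := by
  rw [tens_eq_tprod, hat_tprod]

variable {gr : ℤ → Submodule R M} [DirectSum.Decomposition gr]

variable (gr) in
/-- The differential of the bar construction, on the tensor algebra. -/
def barT (m : MultiFamily R M M) : TensorAlgebra R M →ₗ[R] TensorAlgebra R M :=
  ofDirectSum.toLinearMap ∘ₗ barDifferential gr m ∘ₗ toDirectSum.toLinearMap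

lemma toDirectSum_tens (n : ℕ) (a : ℕ → M) : toDirectSum (tens R n a) =
    DirectSum.lof R ℕ (fun n => ⨂[R]^n M) n (PiTensorProduct.tprod R fun i => a i) := by
  rw [tens_eq_tprod, toDirectSum_tensorPower_tprod]
  rfl

lemma barT_tens (m : MultiFamily R M M) (n : ℕ) (a : ℕ → M) :
    barT gr m (tens R n a) = ∑ c : Composition n,
      markSum (linearFamily (-signMap gr)) (suspended gr m) (linearFamily LinearMap.id)
        c.blocks a := by
  change ofDirectSum (barDifferential gr m (toDirectSum (tens R n a))) = _
  rw [toDirectSum_tens, barDifferential, DirectSum.toModule_lof]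
  simp only [LinearMap.sum_apply, map_sum]
  refine Finset.sum_congr rfl fun c _ => ?_
  rw [← markSum_eq, ← Fin.sum_univ_eq_sum_range fun i => tens R c.blocks.length (fun j =>
      chunks (evalSeq (if j < i then linearFamily (-signMap gr) else
        if j = i then suspended gr m else linearFamily LinearMap.id)) c.blocks a j)]
  refine Finset.sum_congr rfl fun i _ => ?_
  rw [← ofDirectSum_tensorAlong c (fun j => if j < i then linearFamily (-signMap gr) else
        if j = i then suspended gr m else linearFamily LinearMap.id) a]
  congr 3
  funext j
  simp only [Fin.lt_def, Fin.ext_iff]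
  split_ifs <;> rfl

@[simp] lemma barT_one (m : MultiFamily R M M) : barT gr m 1 = 0 := by
  rw [← tens_zero (R := R) (fun _ : ℕ => (0 : M)), barT_tens,
    sum_composition_zero fun ks => markSum (linearFamily (-signMap gr)) (suspended gr m)
      (linearFamily LinearMap.id) ks _]
  rfl

/-- The operation is applied to the first block or passes the first letter. No basis is used, since
the formula is also needed on `A`. -/
lemma barT_tens_succ (m : MultiFamily R M M) (n : ℕ) (a : ℕ → M) :
    barT gr m (tens R (n + 1) a) = ∑ k ∈ Finset.range (n + 1),
      ι R (hat gr m (tens R (k + 1) a)) * tens R (n - k) (fun i => a (k + 1 + i)) -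
      ι R (signMap gr (a 0)) * barT gr m (tens R n fun i => a (i + 1)) := by
  rw [barT_tens, sum_composition (Nat.succ_ne_zero n) fun ks => markSum
    (linearFamily (-signMap gr)) (suspended gr m) (linearFamily LinearMap.id) ks a]
  simp only [markSum, Finset.sum_add_distrib, ← Finset.mul_sum, tens_chunks_id, tens_hat_eq]
  rw [sub_eq_add_neg]
  congr 1
  · exact Finset.sum_congr rfl fun k _ => by rw [show n.succ - (k + 1) = n - k by omega]
  rw [Finset.sum_range_succ', Finset.sum_eq_zero, zero_add, barT_tens]
  · change ι R (-signMap gr (a 0)) * _ = _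
    rw [map_neg, neg_mul]
    have h : (fun j => a (0 + 1 + j)) = fun i => a (i + 1) := by funext i; congr 1; omega
    rw [h]
    rfl
  · intro k _
    change ι R (0 : M) * _ = 0
    simp

/-- On a free graded module, the bar differential is the coderivation assembled from the
suspended operations. -/
lemma barT_eq_coder {B : Type*} {e : Module.Basis B R M} {dg : B → ℤ}
    (hH : ∀ i, HD e dg i = gr (i + 1)) {m : MultiFamily R M M} (hm : m 0 = 0) :
    barT gr m = coder e dg (hat gr m) := by
  refine ext_E (e := e) fun w => ?_
  induction w with
  | nil => simp
  | cons a w ih =>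
    have ha : e a ∈ gr (dg a + 1) := by rw [← hH]; exact mem_HD e dg a
    rw [E_cons, coder_cons, ← E_cons, ← tens_letters, List.length_cons, barT_tens_succ, headOp_tens,
      Finset.sum_range_succ' _ (w.length + 1), tens_zero, hat_one hm, map_zero, zero_mul, add_zero,
      sub_eq_add_neg]
    simp only [Nat.add_sub_add_right]
    congr 1
    have h1 : (fun i => letters e (a :: w) (i + 1)) = letters e w := rfl
    have h2 : letters e (a :: w) 0 = e a := rfl
    rw [h1, h2, tens_letters, ih, signMap_of_mem ha]
    push_cast
    rw [chi_add, chi_one, map_smul]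
    simp

lemma barMap_eq_comap {B : Type*} (e : Module.Basis B R M)
    {f : MultiFamily R M X} (hf : f 0 = 0) :
    ofDirectSum.toLinearMap ∘ₗ barMap gr f ∘ₗ toDirectSum.toLinearMap = comap e (hat gr f) := by
  refine ext_tens fun n a => ?_
  rw [comap_tens (hat_one hf)]
  change ofDirectSum (barMap gr f (toDirectSum (tens R n a))) = _
  rw [toDirectSum_tens, barMap, DirectSum.toModule_lof]
  simp only [LinearMap.sum_apply, map_sum]
  refine Finset.sum_congr rfl fun c _ => ?_
  rw [ofDirectSum_tensorAlong c (fun _ => suspended gr f) a]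
  congr 1
  have : evalSeq (suspended gr f) = fun k a => hat gr f (tens R k a) := by
    funext k a
    exact tens_hat_eq f k a
  rw [this]

lemma IsQuasiIso.of_equiv {M' N N' : Type*} [AddCommGroup M'] [Module R M'] [AddCommGroup N]
    [Module R N] [AddCommGroup N'] [Module R N'] {d : M →ₗ[R] M} {d' : M' →ₗ[R] M'}
    {F : M →ₗ[R] M'} (φ : M ≃ₗ[R] N) (φ' : M' ≃ₗ[R] N')
    (h : IsQuasiIso (φ.toLinearMap ∘ₗ d ∘ₗ φ.symm.toLinearMap)
      (φ'.toLinearMap ∘ₗ d' ∘ₗ φ'.symm.toLinearMap) (φ'.toLinearMap ∘ₗ F ∘ₗ φ.symm.toLinearMap)) :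
    IsQuasiIso d d' F := by
  refine ⟨fun x => ?_, fun x hx hy => ?_, fun z hz => ?_⟩
  · have := h.comm (φ x)
    simpa using this
  · obtain ⟨y', hy⟩ := hy
    obtain ⟨y, hy⟩ := h.injective (φ x) (by simp [hx]) ⟨φ' y', by simp [hy]⟩
    refine ⟨φ.symm y, ?_⟩
    simpa using hy
  · obtain ⟨x, y, hx, hxy⟩ := h.surjective (φ' z) (by simp [hz])
    refine ⟨φ.symm x, φ'.symm y, by simpa using hx, φ'.injective ?_⟩
    simpa using hxy

end BarWords

/-! ### A comparison principle for filtered complexes. -/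

section FilteredComplexes

variable {R : Type u} [CommRing R] {M M' : Type*} [AddCommGroup M] [Module R M]
  [AddCommGroup M'] [Module R M']

/-- A chain map is a homology isomorphism if, up to terms of lower filtration, the differential of
the source vanishes and the map is the inclusion of a strong deformation retract. -/
lemma isQuasiIso_of_filtration {d : M →ₗ[R] M} {d' : M' →ₗ[R] M'} {Φ : M →ₗ[R] M'}
    {F : ℕ → Submodule R M} {F' : ℕ → Submodule R M'} {φ : M →ₗ[R] M'} {ψ : M' →ₗ[R] M}
    {δ S : M' →ₗ[R] M'} (hF0 : F 0 = ⊥) (hF'0 : F' 0 = ⊥) (hF : ∀ x, ∃ n, x ∈ F n)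
    (hF' : ∀ y, ∃ n, y ∈ F' n) (hmono : Monotone F) (hmono' : Monotone F')
    (hd : ∀ n, ∀ x ∈ F (n + 1), d x ∈ F n) (hd' : ∀ n, ∀ y ∈ F' (n + 1), d' y - δ y ∈ F' n)
    (hΦ : ∀ n, ∀ x ∈ F (n + 1), Φ x - φ x ∈ F' n) (hφ : ∀ n, ∀ x ∈ F n, φ x ∈ F' n)
    (hψ : ∀ n, ∀ y ∈ F' n, ψ y ∈ F n) (hS : ∀ n, ∀ y ∈ F' n, S y ∈ F' n)
    (hψδ : ∀ y, ψ (δ y) = 0) (hψφ : ∀ x, ψ (φ x) = x)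
    (hom : ∀ y, δ (S y) + S (δ y) = y - φ (ψ y)) (comm : ∀ x, Φ (d x) = d' (Φ x))
    (hdd : ∀ y, d' (d' y) = 0) : IsQuasiIso d d' Φ := by
  -- Acyclicity of the mapping cone: a pair with `Φ x = d' y` is a boundary. By induction it
  -- suffices to lower the filtration by subtracting a boundary.
  have key : ∀ n x y, x ∈ F n → y ∈ F' n → Φ x = d' y →
      ∃ x' y', x = d x' ∧ y = Φ x' + d' y' := by
    intro n
    induction n with
    | zero =>
      intro x y hx hy _
      rw [hF0, Submodule.mem_bot] at hx
      rw [hF'0, Submodule.mem_bot] at hy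
      exact ⟨0, 0, by simp [hx], by simp [hy]⟩
    | succ n ih =>
      intro x y hx hy hxy
      have h1 : φ x - δ y ∈ F' n := by
        have := sub_mem (hd' n y hy) (hΦ n x hx)
        rw [hxy] at this
        convert this using 1
        abel
      -- The leading part of `Φ x = d' y` is `φ x = δ y`; applying `ψ`, which kills `δ` and inverts
      -- `φ`, shows that `x` has lower filtration.
      have hxn : x ∈ F n := by
        have := hψ n _ h1
        rwa [map_sub, hψδ, hψφ, sub_zero] at this
      have h2 : S (δ y) ∈ F' n := by
        have := hS n _ (sub_mem (hφ n x hxn) h1)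
        rwa [sub_sub_cancel] at this
      -- The boundary defined by `ψ y` and `S y` cancels the leading part of `y`, by the homotopy
      -- formula `hom`.
      have h3 : y - Φ (ψ y) - d' (S y) ∈ F' n := by
        have := sub_mem (sub_mem h2 (hΦ n _ (hψ _ y hy))) (hd' n _ (hS _ y hy))
        rw [eq_sub_of_add_eq' (hom y)] at this
        convert this using 1
        abel
      obtain ⟨x', y', hx', hy'⟩ := ih (x - d (ψ y)) _ (sub_mem hxn (hd n _ (hψ _ y hy))) h3 (by
        rw [map_sub, map_sub, map_sub, comm, hxy, hdd, sub_zero])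
      refine ⟨ψ y + x', S y + y', ?_, ?_⟩
      · rw [map_add, ← hx']
        abel
      · rw [map_add, map_add, add_add_add_comm, ← hy']
        abel
  have key' : ∀ x y, Φ x = d' y → ∃ x' y', x = d x' ∧ y = Φ x' + d' y' := fun x y h => by
    obtain ⟨n, hn⟩ := hF x
    obtain ⟨k, hk⟩ := hF' y
    exact key (max n k) x y (hmono (le_max_left n k) hn) (hmono' (le_max_right n k) hk) h
  refine ⟨comm, fun x _ hx => ?_, fun z hz => ?_⟩
  · obtain ⟨y', hy'⟩ := hx
    obtain ⟨x', -, h, -⟩ := key' x y' hy'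
    exact ⟨x', h⟩
  · obtain ⟨x', y', h, h'⟩ := key' 0 z (by rw [map_zero, hz])
    exact ⟨x', y', h.symm, h'⟩

end FilteredComplexes

/-! ### The length filtration and the tensor trick. -/

section Length

open TensorAlgebra

variable {R : Type u} [CommRing R] {M X : Type*} [AddCommGroup M] [Module R M]
  [AddCommGroup X] [Module R X]

variable (R M) in
/-- The tensors of length less than `n`. -/
def lenLT (n : ℕ) : Submodule R (TensorAlgebra R M) :=
  Submodule.span R {z | ∃ k < n, ∃ a, tens R k a = z}

lemma tens_mem_lenLT {k n : ℕ} (h : k < n) (a : ℕ → M) : tens R k a ∈ lenLT R M n :=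
  Submodule.subset_span ⟨k, h, a, rfl⟩

lemma map_mem_of_lenLT {n : ℕ} {f : TensorAlgebra R M →ₗ[R] X} {S : Submodule R X}
    (h : ∀ k < n, ∀ a, f (tens R k a) ∈ S) {z : TensorAlgebra R M} (hz : z ∈ lenLT R M n) :
    f z ∈ S := by
  have : lenLT R M n ≤ S.comap f := Submodule.span_le.2 (by
    rintro _ ⟨k, hk, a, rfl⟩
    exact h k hk a)
  exact this hz

lemma lenLT_zero : lenLT R M 0 = ⊥ := by simp [lenLT]

lemma lenLT_mono : Monotone (lenLT R M) := fun _ _ h =>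
  Submodule.span_mono fun _ ⟨k, hk, a, ha⟩ => ⟨k, hk.trans_le h, a, ha⟩

/-- The sequence `x, b 0, b 1, …`. -/
def seqCons {α : Type*} (x : α) (b : ℕ → α) : ℕ → α
  | 0 => x
  | i + 1 => b i

lemma ι_mul_tens (x : M) (n : ℕ) (b : ℕ → M) :
    ι R x * tens R n b = tens R (n + 1) (seqCons x b) := rfl

lemma ι_mul_mem_lenLT (x : M) {n : ℕ} {z : TensorAlgebra R M} (hz : z ∈ lenLT R M n) :
    ι R x * z ∈ lenLT R M (n + 1) := by
  refine map_mem_of_lenLT (f := LinearMap.mulLeft R (ι R x)) (fun k hk a => ?_) hz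
  rw [LinearMap.mulLeft_apply, ι_mul_tens]
  exact tens_mem_lenLT (by omega) _

lemma exists_mem_lenLT (z : TensorAlgebra R M) : ∃ n, z ∈ lenLT R M n := by
  have h : (⨆ n, lenLT R M n).mkQ = 0 := ext_tens fun n a => by
    rw [LinearMap.zero_apply, Submodule.mkQ_apply, Submodule.Quotient.mk_eq_zero]
    exact Submodule.mem_iSup_of_mem (n + 1) (tens_mem_lenLT n.lt_succ_self a)
  have hz : z ∈ ⨆ n, lenLT R M n := by
    rw [← Submodule.Quotient.mk_eq_zero, ← Submodule.mkQ_apply, h, LinearMap.zero_apply]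
  exact (Submodule.mem_iSup_of_directed _ lenLT_mono.directed_le).1 hz

lemma ext_head {f g : TensorAlgebra R M →ₗ[R] X} (h1 : f 1 = g 1)
    (h : ∀ x z, f z = g z → f (ι R x * z) = g (ι R x * z)) : f = g := by
  refine ext_tens fun n a => ?_
  induction n generalizing a with
  | zero => exact h1
  | succ n ih => exact h _ _ (ih _)

lemma map_tens (γ : M →ₗ[R] X) (n : ℕ) (a : ℕ → M) :
    TensorAlgebra.lift R (ι R ∘ₗ γ) (tens R n a) = tens R n (fun i => γ (a i)) := by
  induction n generalizing a with
  | zero => simp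
  | succ n ih => rw [tens_succ, tens_succ, map_mul, ih]; simp

lemma map_mem_lenLT (γ : M →ₗ[R] X) {n : ℕ} {z : TensorAlgebra R M} (hz : z ∈ lenLT R M n) :
    TensorAlgebra.lift R (ι R ∘ₗ γ) z ∈ lenLT R X n := by
  refine map_mem_of_lenLT (f := (TensorAlgebra.lift R (ι R ∘ₗ γ)).toLinearMap) (fun k hk a => ?_) hz
  rw [AlgHom.toLinearMap_apply, map_tens]
  exact tens_mem_lenLT hk _

/-- The action of a letter that defines `skew`. -/
def skewAction (β γ σ : M →ₗ[R] M) :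
    M →ₗ[R] Module.End R (TensorAlgebra R M × TensorAlgebra R M) :=
  LinearMap.mk₂ R (fun x p => (ι R (γ x) * p.1, ι R (β x) * p.1 - ι R (σ x) * p.2))
    (fun x y p => by simp [add_mul]; abel)
    (fun c x p => by simp [smul_sub])
    (fun x p q => by simp [mul_add]; abel)
    (fun c x p => by simp [smul_sub])

/-- The map `∑ (-σ) ⊗ ⋯ ⊗ (-σ) ⊗ β ⊗ γ ⊗ ⋯ ⊗ γ` on the tensor algebra. -/
def skew (β γ σ : M →ₗ[R] M) : TensorAlgebra R M →ₗ[R] TensorAlgebra R M :=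
  LinearMap.snd R _ _ ∘ₗ LinearMap.applyₗ (R := R) ((1, 0) : TensorAlgebra R M × TensorAlgebra R M) ∘ₗ
    (TensorAlgebra.lift R (skewAction β γ σ)).toLinearMap

variable (β γ σ : M →ₗ[R] M)

@[simp] lemma skew_one : skew β γ σ 1 = 0 := by simp [skew]

/-- As `skew` is not an algebra map, it is obtained from an action on pairs: the first component
tracks `γ ⊗ ⋯ ⊗ γ`, and the second uses it in this recursion. -/
lemma skew_ι_mul (x : M) (z : TensorAlgebra R M) : skew β γ σ (ι R x * z) =
    ι R (β x) * TensorAlgebra.lift R (ι R ∘ₗ γ) z - ι R (σ x) * skew β γ σ z := by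
  have h : LinearMap.fst R _ _ ∘ₗ
      LinearMap.applyₗ (R := R) ((1, 0) : TensorAlgebra R M × TensorAlgebra R M) ∘ₗ
      (TensorAlgebra.lift R (skewAction β γ σ)).toLinearMap =
      (TensorAlgebra.lift R (ι R ∘ₗ γ)).toLinearMap := by
    refine ext_head (by simp) fun x z hz => ?_
    simp only [LinearMap.comp_apply, AlgHom.toLinearMap_apply, LinearMap.applyₗ_apply_apply,
      LinearMap.fst_apply] at hz ⊢
    rw [map_mul, map_mul, Module.End.mul_apply, lift_ι_apply, lift_ι_apply, ← hz]
    rfl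
  have hz := LinearMap.congr_fun h z
  simp only [LinearMap.comp_apply, AlgHom.toLinearMap_apply, LinearMap.applyₗ_apply_apply,
    LinearMap.fst_apply] at hz
  rw [← hz]
  simp only [skew, LinearMap.comp_apply, AlgHom.toLinearMap_apply, LinearMap.applyₗ_apply_apply,
    LinearMap.snd_apply]
  rw [map_mul, Module.End.mul_apply, lift_ι_apply]
  rfl

lemma skew_mem_lenLT {n : ℕ} {z : TensorAlgebra R M} (hz : z ∈ lenLT R M n) :
    skew β γ σ z ∈ lenLT R M n := by
  refine map_mem_of_lenLT (fun k hk a => ?_) hz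
  refine lenLT_mono hk ?_
  clear hk hz
  induction k generalizing a with
  | zero => simp
  | succ k ih =>
    rw [tens_succ, skew_ι_mul]
    exact sub_mem (ι_mul_mem_lenLT _ (map_mem_lenLT γ (tens_mem_lenLT (by omega) _)))
      (ι_mul_mem_lenLT _ (ih _))

variable {β γ σ}

/-- The tensor trick: a contraction of a complex extends to its tensor algebra. -/
lemma skew_homotopy {d s π : M →ₗ[R] M} (hσ : ∀ x, σ (σ x) = x) (hdσ : ∀ x, d (σ x) = -σ (d x))
    (hdπ : ∀ x, d (π x) = 0) (hπd : ∀ x, π (d x) = 0)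
    (hs : ∀ x, d (s x) + s (d x) = x - π x) (z : TensorAlgebra R M) :
    skew d LinearMap.id σ (skew s π σ z) + skew s π σ (skew d LinearMap.id σ z) =
      z - TensorAlgebra.lift R (ι R ∘ₗ π) z := by
  have hid : TensorAlgebra.lift R (ι R ∘ₗ (LinearMap.id : M →ₗ[R] M)) = AlgHom.id R _ := by
    ext x; simp
  -- The extended differential kills tensors of values of `π`, and the extended `π` kills its
  -- boundaries. Together with `σ² = 1` and `dσ = -σd`, this removes the mixed terms in the
  -- induction.
  have h1 : skew d LinearMap.id σ ∘ₗ (TensorAlgebra.lift R (ι R ∘ₗ π)).toLinearMap = 0 := by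
    refine ext_head (by simp) fun x z hz => ?_
    simp only [LinearMap.comp_apply, AlgHom.toLinearMap_apply, LinearMap.zero_apply] at hz ⊢
    rw [map_mul, lift_ι_apply, LinearMap.comp_apply, skew_ι_mul, hz, hdπ]
    simp
  have h2 : (TensorAlgebra.lift R (ι R ∘ₗ π)).toLinearMap ∘ₗ skew d LinearMap.id σ = 0 := by
    refine ext_head (by simp) fun x z hz => ?_
    simp only [LinearMap.comp_apply, AlgHom.toLinearMap_apply, LinearMap.zero_apply] at hz ⊢
    rw [skew_ι_mul, map_sub, map_mul, map_mul, hz]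
    simp [hπd]
  have h : skew d LinearMap.id σ ∘ₗ skew s π σ + skew s π σ ∘ₗ skew d LinearMap.id σ =
      LinearMap.id - (TensorAlgebra.lift R (ι R ∘ₗ π)).toLinearMap := by
    refine ext_head (by simp) fun x z hz => ?_
    have h1z := LinearMap.congr_fun h1 z
    have h2z := LinearMap.congr_fun h2 z
    simp only [LinearMap.comp_apply, AlgHom.toLinearMap_apply, LinearMap.zero_apply,
      LinearMap.add_apply, LinearMap.sub_apply, LinearMap.id_apply] at hz h1z h2z ⊢
    rw [skew_ι_mul, skew_ι_mul, map_sub, map_sub, skew_ι_mul, skew_ι_mul, skew_ι_mul, skew_ι_mul,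
      h1z, h2z, hid, map_mul, lift_ι_apply, LinearMap.comp_apply, hσ, hdσ]
    simp only [AlgHom.id_apply, mul_zero, map_neg, neg_mul]
    have e1 := congrArg (fun y => ι R y * TensorAlgebra.lift R (ι R ∘ₗ π) z) (hs x)
    have e2 := congrArg (fun y => ι R x * y) hz
    simp only [map_add, map_sub, add_mul, sub_mul, mul_add, mul_sub] at e1 e2
    have e3 := congrArg₂ (· + ·) e1 e2
    rw [← sub_eq_zero] at e3 ⊢
    refine Eq.trans ?_ e3
    abel
  exact LinearMap.congr_fun h z

end Length

/-! ### The bar differential of a dg algebra, without a basis. -/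

section BarOfAlgebra

open TensorAlgebra

variable {R : Type u} [CommRing R] (A : CDGAlg.{u, v} R)

lemma CDGAlg.hat_ops_one (a : ℕ → A.carrier) : hat A.gr A.ops (tens R 1 a) = A.d (a 0) := by
  rw [← tens_hat_eq]
  change A.d ((signMap A.gr ^ 0) (a 0)) = _
  rw [pow_zero, Module.End.one_apply]

lemma CDGAlg.hat_ops_two (a : ℕ → A.carrier) :
    hat A.gr A.ops (tens R 2 a) = A.mul (signMap A.gr (a 0)) (a 1) := by
  rw [← tens_hat_eq]
  change A.mul ((signMap A.gr ^ 1) (a 0)) ((signMap A.gr ^ 0) (a 1)) = _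
  rw [pow_zero, pow_one, Module.End.one_apply]

lemma CDGAlg.hat_ops_of_three_le {n : ℕ} (hn : 3 ≤ n) (a : ℕ → A.carrier) :
    hat A.gr A.ops (tens R n a) = 0 := by
  rw [← tens_hat_eq, evalSeq, suspended, A.ops_of_three_le hn]
  rfl

lemma CDGAlg.signMap_mul (a b : A.carrier) :
    signMap A.gr (A.mul a b) = A.mul (signMap A.gr a) (signMap A.gr b) := by
  induction a using DirectSum.Decomposition.inductionOn A.gr with
  | zero => simp
  | @homogeneous i x =>
    induction b using DirectSum.Decomposition.inductionOn A.gr with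
    | zero => simp
    | @homogeneous j y =>
      rw [signMap_of_mem (A.mul_mem x.2 y.2), signMap_of_mem x.2, signMap_of_mem y.2, map_smul,
        map_smul, LinearMap.smul_apply, smul_smul, ← chi_add, add_comm]
      push_cast
      rfl
    | add x y hx hy => simp only [map_add, hx, hy]
  | add x y hx hy => simp only [map_add, LinearMap.add_apply, hx, hy]

/-- The part of the bar differential that multiplies the first letter `a` with the second. -/
def barHead (a : A.carrier) : TensorAlgebra R A.carrier →ₗ[R] TensorAlgebra R A.carrier :=
  barT A.gr A.ops ∘ₗ LinearMap.mulLeft R (ι R a) - LinearMap.mulLeft R (ι R (A.d a)) +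
    LinearMap.mulLeft R (ι R (signMap A.gr a)) ∘ₗ barT A.gr A.ops

lemma barT_ι_mul (a : A.carrier) (z : TensorAlgebra R A.carrier) :
    barT A.gr A.ops (ι R a * z) =
      ι R (A.d a) * z + barHead A a z - ι R (signMap A.gr a) * barT A.gr A.ops z := by
  simp only [barHead, LinearMap.add_apply, LinearMap.sub_apply, LinearMap.comp_apply,
    LinearMap.mulLeft_apply]
  abel

@[simp] lemma barHead_one (a : A.carrier) : barHead A a 1 = 0 := by
  have h := barT_tens_succ (gr := A.gr) A.ops 0 (fun _ => a)
  rw [tens_succ, Finset.sum_range_one, A.hat_ops_one] at h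
  simp only [tens_zero, mul_one, barT_one, mul_zero, sub_zero] at h
  simp [barHead, h]

lemma barHead_ι_mul (a c : A.carrier) (z : TensorAlgebra R A.carrier) :
    barHead A a (ι R c * z) = ι R (A.mul (signMap A.gr a) c) * z := by
  have h : barHead A a ∘ₗ LinearMap.mulLeft R (ι R c) =
      LinearMap.mulLeft R (ι R (A.mul (signMap A.gr a) c)) := by
    refine ext_tens fun n b => ?_
    have h1 := barT_tens_succ (gr := A.gr) A.ops (n + 1) (seqCons a (seqCons c b))
    rw [Finset.sum_range_succ', Finset.sum_range_succ', Finset.sum_eq_zero fun k _ => by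
      rw [A.hat_ops_of_three_le (by omega), map_zero, zero_mul], zero_add, zero_add,
      A.hat_ops_one, A.hat_ops_two] at h1
    rw [LinearMap.comp_apply, LinearMap.mulLeft_apply, LinearMap.mulLeft_apply, ι_mul_tens]
    have h2 := barT_ι_mul A a (tens R (n + 1) (seqCons c b))
    rw [ι_mul_tens, h1] at h2
    have e1 : (fun i => seqCons a (seqCons c b) (1 + i)) = seqCons c b := by
      funext i; rw [add_comm]; rfl
    have e2 : (fun i => seqCons a (seqCons c b) (1 + 1 + i)) = b := by
      funext i; rw [add_comm]; rfl
    have e3 : (fun i => seqCons a (seqCons c b) (i + 1)) = seqCons c b := rfl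
    rw [e1, e2, e3] at h2
    simp only [Nat.add_sub_cancel, Nat.sub_zero] at h2
    change ι R (A.mul (signMap A.gr a) c) * _ + ι R (A.d a) * _ - ι R (signMap A.gr a) * _ = _ at h2
    rw [sub_left_inj, add_comm, add_right_inj] at h2
    exact h2.symm
  exact LinearMap.congr_fun h z

/-- Associativity of the product, in the form used for the square of the bar differential. -/
lemma barHead_barHead (a c : A.carrier) (z : TensorAlgebra R A.carrier) :
    barHead A (A.mul (signMap A.gr a) c) z = barHead A (signMap A.gr a) (barHead A c z) := by
  have h : barHead A (A.mul (signMap A.gr a) c) = barHead A (signMap A.gr a) ∘ₗ barHead A c := by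
    refine ext_head (by simp) fun x z _ => ?_
    rw [LinearMap.comp_apply, barHead_ι_mul, barHead_ι_mul, barHead_ι_mul, A.signMap_mul,
      signMap_signMap, A.mul_assoc]
  exact LinearMap.congr_fun h z

lemma barT_barHead (a : A.carrier) (z : TensorAlgebra R A.carrier) :
    barT A.gr A.ops (barHead A a z) =
      barHead A (signMap A.gr a) (barT A.gr A.ops z) - barHead A (A.d a) z := by
  have h : barT A.gr A.ops ∘ₗ barHead A a =
      barHead A (signMap A.gr a) ∘ₗ barT A.gr A.ops - barHead A (A.d a) := by
    refine ext_head (by simp) fun c z _ => ?_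
    rw [LinearMap.comp_apply, LinearMap.sub_apply, LinearMap.comp_apply, barHead_ι_mul, barT_ι_mul,
      barT_ι_mul, barHead_ι_mul, map_sub, map_add, barHead_ι_mul, barHead_ι_mul, barHead_barHead,
      A.leibniz_signMap, A.signMap_mul, A.d_signMap]
    simp only [signMap_signMap, map_add, map_neg, LinearMap.neg_apply, add_mul, neg_mul]
    abel
  exact LinearMap.congr_fun h z

/-- Since `A` need not be free, the criterion for coderivations on words is not available. The
induction on the first letter uses `d² = 0` and `barT_barHead`, which contains the Leibniz rule and
associativity. -/
lemma barT_barT (z : TensorAlgebra R A.carrier) :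
    barT A.gr A.ops (barT A.gr A.ops z) = 0 := by
  have h : barT A.gr A.ops ∘ₗ barT A.gr A.ops = 0 := by
    refine ext_head (by simp) fun a z hz => ?_
    rw [LinearMap.comp_apply, LinearMap.zero_apply] at hz ⊢
    rw [barT_ι_mul, map_sub, map_add, barT_ι_mul, barT_ι_mul, barT_barHead, hz, A.d_d, A.d_signMap]
    simp only [map_neg, neg_mul, map_zero, zero_mul, mul_zero]
    abel
  exact LinearMap.congr_fun h z

variable {B : Type*} {H : Type*} [AddCommGroup H] [Module R H]

/-- The twisting cochain equation is the corestriction of the statement that the induced coalgebra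
map is a chain map; `intertwine` passes from the corestriction to the full map. -/
lemma IsTwisting.barT_comap {A : CDGAlg.{u, v} R} {e : Module.Basis B R A.Cohomology} {dg : B → ℤ}
    {b : TensorAlgebra R A.Cohomology →ₗ[R] A.Cohomology}
    {τ : TensorAlgebra R A.Cohomology →ₗ[R] A.carrier} (h : IsTwisting A e dg b τ) :
    barT A.gr A.ops ∘ₗ comap e τ = comap e τ ∘ₗ coder e dg b := by
  have hτ := h.shτ.1
  have hsgn : ∀ u, signMap A.gr (τ (E e u)) = -(chi R (par dg u) • τ (E e u)) := fun u => by
    rw [signMap_of_mem (h.degτ u)]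
    push_cast
    rw [chi_add, chi_one]
    simp [par]
  have hhead : ∀ (x : A.carrier) (v : List B), barHead A x (comap e τ (E e v)) =
      spl (fun v₁ v₂ => ι R (A.mul (signMap A.gr x) (τ (E e v₁))) * comap e τ (E e v₂)) v := by
    intro x v
    rcases eq_or_ne v [] with rfl | hv
    · simp [hτ]
    · rw [comap_E e hτ hv, map_spl]
      exact spl_congr fun _ _ _ => barHead_ι_mul A _ _ _
  refine intertwine e dg h.shb.1 hτ (M := fun u => τ (coder e dg b (E e u))) (fun w => ?_)
    fun w => rfl
  rcases eq_or_ne w [] with rfl | hw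
  · simp [hτ]
  have hcod : ∀ u, ι R (τ (coder e dg b (E e u))) = ι R (A.d (τ (E e u))) +
      spl (fun u₁ u₂ => ι R (A.mul (signMap A.gr (τ (E e u₁))) (τ (E e u₂)))) u := fun u => by
    have h1 := LinearMap.congr_fun h.eq (E e u)
    rw [LinearMap.add_apply, LinearMap.comp_apply, LinearMap.comp_apply, cup_E] at h1
    rw [h1, map_add, add_assoc, left_eq_add, map_spl, ← spl_add]
    refine spl_eq_zero fun u₁ u₂ _ => ?_
    rw [hsgn, LinearMap.comp_apply, sgn_E, ← map_add, map_smul, map_neg, LinearMap.neg_apply,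
      add_neg_cancel, map_zero]
  -- Multiplying the first two blocks of a decomposition is regrouped as a product inside a single
  -- first block.
  have hassoc := spl_assoc (fun u v₁ v₂ =>
    ι R (A.mul (signMap A.gr (τ (E e u))) (τ (E e v₁))) * comap e τ (E e v₂)) w
  rw [comap_E e hτ hw, map_spl]
  calc spl (fun u v => barT A.gr A.ops (ι R (τ (E e u)) * comap e τ (E e v))) w
      = spl (fun u v => ι R (A.d (τ (E e u))) * comap e τ (E e v)) w +
        spl (fun u v => barHead A (τ (E e u)) (comap e τ (E e v))) w +
        spl (fun u v => chi R (par dg u) •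
          (ι R (τ (E e u)) * barT A.gr A.ops (comap e τ (E e v)))) w := by
        rw [← spl_add, ← spl_add]
        refine spl_congr fun u v _ => ?_
        rw [barT_ι_mul, hsgn, map_neg, neg_mul, sub_neg_eq_add, map_smul, smul_mul_assoc]
    _ = _ := by
        congr 1
        simp only [hhead]
        rw [hassoc, ← spl_add]
        refine spl_congr fun u v _ => ?_
        rw [hcod, add_mul]
        congr 1
        exact (map_spl (LinearMap.mulRight R (comap e τ (E e v))) _ _).symm

end BarOfAlgebra

/-! ### Leading terms with respect to tensor length. -/

section LeadingTerms

open TensorAlgebra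

variable {R : Type u} [CommRing R] {M X : Type*} [AddCommGroup M] [Module R M]
  [AddCommGroup X] [Module R X] {gr : ℤ → Submodule R M} [DirectSum.Decomposition gr]

/-- Operations of arity at least two shorten tensors, so only the tensor differential of `m_1`
preserves length. -/
lemma barT_sub_skew_mem (m : MultiFamily R M M) (n : ℕ) {z : TensorAlgebra R M}
    (hz : z ∈ lenLT R M (n + 1)) :
    barT gr m z - skew (firstComponent m) LinearMap.id (signMap gr) z ∈ lenLT R M n := by
  have hid : TensorAlgebra.lift R (ι R ∘ₗ (LinearMap.id : M →ₗ[R] M)) = AlgHom.id R _ := by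
    ext x; simp
  refine map_mem_of_lenLT (f := barT gr m - skew (firstComponent m) LinearMap.id (signMap gr))
    (fun k hk a => lenLT_mono (Nat.le_of_lt_succ hk) ?_) hz
  clear hk hz
  rw [LinearMap.sub_apply]
  induction k generalizing a with
  | zero => simp
  | succ k ih =>
    have h1 : hat gr m (tens R (0 + 1) a) = firstComponent m (a 0) := by
      rw [← hat_ι (gr := gr), zero_add, tens_succ, tens_zero, mul_one]
    have h2 : (fun i => a (0 + 1 + i)) = fun i => a (i + 1) := by
      funext i; congr 1; omega
    have h3 : ∑ j ∈ Finset.range k, ι R (hat gr m (tens R (j + 1 + 1) a)) *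
        tens R (k - (j + 1)) (fun i => a (j + 1 + 1 + i)) ∈ lenLT R M (k + 1) :=
      Submodule.sum_mem _ fun j hj => by
        rw [Finset.mem_range] at hj
        exact ι_mul_mem_lenLT _ (tens_mem_lenLT (by omega) _)
    have h4 := sub_mem h3 (ι_mul_mem_lenLT (signMap gr (a 0)) (ih fun i => a (i + 1)))
    convert h4 using 1
    rw [barT_tens_succ, Finset.sum_range_succ', h1, h2, Nat.sub_zero, tens_succ, skew_ι_mul, hid,
      AlgHom.id_apply, mul_sub]
    abel

variable {B : Type*} (e : Module.Basis B R M)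

lemma comap_tens_succ {G : TensorAlgebra R M →ₗ[R] X} (hG : G 1 = 0) (n : ℕ) (a : ℕ → M) :
    comap e G (tens R (n + 1) a) = ∑ k ∈ Finset.range (n + 1), ι R (G (tens R (k + 1) a)) *
      comap e G (tens R (n - k) (fun i => a (k + 1 + i))) := by
  rw [comap_eq e hG, aug_tens_succ, zero_smul, zero_add, splT_tens, Finset.sum_range_succ']
  simp only [headMul_apply, tens_zero, hG, map_zero, zero_mul, add_zero, Nat.add_sub_add_right]

lemma comap_tens_mem_lenLT {G : TensorAlgebra R M →ₗ[R] X} (hG : G 1 = 0) (n : ℕ) (a : ℕ → M) :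
    comap e G (tens R n a) ∈ lenLT R X (n + 1) := by
  induction n using Nat.strong_induction_on generalizing a with
  | _ n ih =>
    cases n with
    | zero =>
      rw [tens_zero, comap_one, ← tens_zero (R := R) fun _ : ℕ => (0 : X)]
      exact tens_mem_lenLT (by omega) _
    | succ n =>
      rw [comap_tens_succ e hG]
      exact Submodule.sum_mem _ fun k _ =>
        ι_mul_mem_lenLT _ (lenLT_mono (by omega) (ih (n - k) (by omega) _))

/-- A block of size at least two shortens the tensor; the remaining term applies the linear part of
`G` to every letter. -/
lemma comap_sub_map_mem {G : TensorAlgebra R M →ₗ[R] X} (hG : G 1 = 0) (n : ℕ)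
    {z : TensorAlgebra R M} (hz : z ∈ lenLT R M (n + 1)) :
    comap e G z - TensorAlgebra.lift R (ι R ∘ₗ (G ∘ₗ ι R)) z ∈ lenLT R X n := by
  refine map_mem_of_lenLT
    (f := comap e G - (TensorAlgebra.lift R (ι R ∘ₗ (G ∘ₗ ι R))).toLinearMap)
    (fun k hk a => lenLT_mono (Nat.le_of_lt_succ hk) ?_) hz
  clear hk hz
  rw [LinearMap.sub_apply, AlgHom.toLinearMap_apply]
  induction k generalizing a with
  | zero => simp
  | succ k ih =>
    have h1 : G (tens R (0 + 1) a) = G (ι R (a 0)) := by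
      rw [zero_add, tens_succ, tens_zero, mul_one]
    have h2 : (fun i => a (0 + 1 + i)) = fun i => a (i + 1) := by
      funext i; congr 1; omega
    have h3 : ∑ j ∈ Finset.range k, ι R (G (tens R (j + 1 + 1) a)) *
        comap e G (tens R (k - (j + 1)) (fun i => a (j + 1 + 1 + i))) ∈ lenLT R X (k + 1) :=
      Submodule.sum_mem _ fun j hj => by
        rw [Finset.mem_range] at hj
        exact ι_mul_mem_lenLT _ (lenLT_mono (by omega) (comap_tens_mem_lenLT e hG _ _))
    have h4 := add_mem h3 (ι_mul_mem_lenLT (G (ι R (a 0))) (ih fun i => a (i + 1)))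
    convert h4 using 1
    rw [comap_tens_succ e hG, Finset.sum_range_succ', h1, h2, Nat.sub_zero, tens_succ, map_mul,
      lift_ι_apply, mul_sub]
    simp only [LinearMap.comp_apply]
    abel

end LeadingTerms

/-! ### Homology isomorphism of bar constructions. -/

section BarQuasiIso

open TensorAlgebra

variable {R : Type u} [CommRing R] {A : CDGAlg.{u, v} R}

/-- If the coboundaries form a projective module, then a complex contracts onto its cohomology,
embedded by any choice of cocycles. -/
lemma CDGAlg.exists_contraction (A : CDGAlg.{u, v} R)
    (hproj : Module.Projective R (LinearMap.range A.d))
    {φ : A.Cohomology →ₗ[R] A.carrier} (hφ : A.ChoosesCocycles φ) :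
    ∃ (q : A.carrier →ₗ[R] A.Cohomology) (s : A.carrier →ₗ[R] A.carrier),
      (∀ h, q (φ h) = h) ∧ (∀ a, q (A.d a) = 0) ∧ (∀ a, A.d (s a) + s (A.d a) = a - φ (q a)) := by
  -- Projectivity of the coboundaries gives a section of `d` onto its image; `ρ = j ∘ d` then splits
  -- off the cocycles.
  obtain ⟨j, hj⟩ := Module.projective_lifting_property A.d.rangeRestrict LinearMap.id
    A.d.surjective_rangeRestrict
  have hdj : ∀ y, A.d (j y) = y := fun y => congrArg Subtype.val (LinearMap.congr_fun hj y)
  let ρ : A.carrier →ₗ[R] A.carrier := j ∘ₗ A.d.rangeRestrict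
  have hdρ : ∀ a, A.d (ρ a) = A.d a := fun a => hdj _
  have hρ : ∀ a, A.d a = 0 → ρ a = 0 := fun a ha => by
    have : A.d.rangeRestrict a = 0 := Subtype.ext ha
    rw [LinearMap.comp_apply, this, map_zero]
  let z : A.carrier →ₗ[R] A.cocycles := (LinearMap.id - ρ).codRestrict A.cocycles fun a => by
    rw [LinearMap.mem_ker, LinearMap.sub_apply, map_sub, hdρ, LinearMap.id_apply, sub_self]
  have hz : ∀ a, (z a : A.carrier) = a - ρ a := fun a => rfl
  let q : A.carrier →ₗ[R] A.Cohomology := A.cls ∘ₗ z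
  have hφd : ∀ h, A.d (φ h) = 0 := fun h => (hφ h).1
  have hqd : ∀ a, q (A.d a) = 0 := fun a => by
    have : q (A.d a) = A.cls 0 := A.cls_eq_cls.2 ⟨a, by
      rw [hz, hρ _ (A.d_d a)]; simp⟩
    rw [this, map_zero]
  have hqφ : ∀ h, q (φ h) = h := fun h => by
    obtain ⟨h1, h2⟩ := hφ h
    refine Eq.trans ?_ h2
    change A.cls (z (φ h)) = _
    congr 1
    refine Subtype.ext ?_
    rw [hz, hρ _ (hφd h), sub_zero]
  -- The cocycle part of `a` minus the chosen representative of its class is a coboundary, and `j`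
  -- supplies a primitive linearly in `a`: this is `s`.
  let κ : A.carrier →ₗ[R] A.carrier := LinearMap.id - ρ - φ ∘ₗ q
  have hrange : ∀ a, κ a ∈ LinearMap.range A.d := fun a => by
    obtain ⟨h1, h2⟩ := hφ (q a)
    obtain ⟨y, hy⟩ := A.cls_eq_cls.1 h2.symm
    exact ⟨y, by rw [hy, hz]; rfl⟩
  refine ⟨q, j ∘ₗ κ.codRestrict _ hrange, hqφ, hqd, fun a => ?_⟩
  have h1 : κ.codRestrict (LinearMap.range A.d) hrange (A.d a) =
      A.d.rangeRestrict a := Subtype.ext (by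
    change A.d a - ρ (A.d a) - φ (q (A.d a)) = A.d a
    rw [hρ _ (A.d_d a), hqd, map_zero, sub_zero, sub_zero])
  rw [LinearMap.comp_apply, LinearMap.comp_apply, h1, hdj]
  change a - ρ a - φ (q a) + ρ a = _
  abel

/-- Apply `isQuasiIso_of_filtration` to the length filtration. By minimality the source has zero
leading differential; the contraction of `A` onto `H(A)`, extended by the tensor trick, provides `ψ`
and `S`. -/
theorem isBarQuasiIso_of_projective (hA : ∀ i : ℤ, Module.Free R (A.cohomologyGr i))
    (hproj : Module.Projective R (LinearMap.range A.d))
    {m : MultiFamily R A.Cohomology A.Cohomology} {f : MultiFamily R A.Cohomology A.carrier}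
    (h : A.IsMinimalModel m f) : IsBarQuasiIso A.cohomologyGr A.gr m A.ops f := by
  obtain ⟨B, e, dg, hHD⟩ := exists_homogeneous_basis A.cohomology_isInternal hA
  obtain ⟨q, s, hqf, hqd, hs⟩ := A.exists_contraction hproj h.first
  have hfd : ∀ x, A.d (firstComponent f x) = 0 := fun x => (h.first x).1
  have htw := h.isTwisting hHD
  have hfirst : hat A.cohomologyGr f ∘ₗ ι R = firstComponent f :=
    LinearMap.ext fun x => hat_ι f x
  have hm1 : firstComponent m = 0 := by
    ext x
    change m 1 _ = 0
    rw [h.minimal]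
    rfl
  have hops : firstComponent A.ops = A.d := rfl
  have hskew : ∀ z, skew (0 : A.Cohomology →ₗ[R] A.Cohomology) LinearMap.id
      (signMap A.cohomologyGr) z = 0 := fun z => by
    have : skew (0 : A.Cohomology →ₗ[R] A.Cohomology) LinearMap.id
        (signMap A.cohomologyGr) = 0 := ext_head (by simp) fun x z hz => by
      rw [skew_ι_mul, hz]; simp
    rw [this, LinearMap.zero_apply]
  let Φ := (TensorAlgebra.lift R (ι R ∘ₗ firstComponent f)).toLinearMap
  let Ψ := (TensorAlgebra.lift R (ι R ∘ₗ q)).toLinearMap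
  have hΨΦ : Ψ ∘ₗ Φ = LinearMap.id := ext_head (by simp [Ψ, Φ]) fun x z hz => by
    simp only [LinearMap.comp_apply, AlgHom.toLinearMap_apply, LinearMap.id_apply, Ψ, Φ] at hz ⊢
    rw [map_mul, map_mul, hz]
    simp [hqf]
  have hΦΨ : Φ ∘ₗ Ψ = (TensorAlgebra.lift R (ι R ∘ₗ (firstComponent f ∘ₗ q))).toLinearMap :=
    ext_head (by simp [Ψ, Φ]) fun x z hz => by
      simp only [LinearMap.comp_apply, AlgHom.toLinearMap_apply, Ψ, Φ] at hz ⊢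
      rw [map_mul, map_mul, hz]
      simp
  have hΨd : Ψ ∘ₗ skew A.d LinearMap.id (signMap A.gr) = 0 :=
    ext_head (by simp) fun x z hz => by
      simp only [LinearMap.comp_apply, AlgHom.toLinearMap_apply, LinearMap.zero_apply, Ψ] at hz ⊢
      rw [skew_ι_mul, map_sub, map_mul, map_mul, hz]
      simp [hqd]
  refine IsQuasiIso.of_equiv (equivDirectSum (R := R)).symm.toLinearEquiv
    (equivDirectSum (R := R)).symm.toLinearEquiv ?_
  change IsQuasiIso (barT A.cohomologyGr m) (barT A.gr A.ops)
    (ofDirectSum.toLinearMap ∘ₗ barMap A.cohomologyGr f ∘ₗ toDirectSum.toLinearMap)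
  rw [barMap_eq_comap e h.morphism.zero]
  refine isQuasiIso_of_filtration (F := lenLT R A.Cohomology) (F' := lenLT R A.carrier)
    (φ := Φ) (ψ := Ψ) (δ := skew A.d LinearMap.id (signMap A.gr))
    (S := skew s (firstComponent f ∘ₗ q) (signMap A.gr)) lenLT_zero lenLT_zero exists_mem_lenLT
    exists_mem_lenLT lenLT_mono lenLT_mono (fun n x hx => ?_)
    (fun n y hy => barT_sub_skew_mem A.ops n hy) (fun n x hx => ?_)
    (fun n x hx => map_mem_lenLT _ hx) (fun n x hx => map_mem_lenLT _ hx)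
    (fun n y hy => skew_mem_lenLT _ _ _ hy) (LinearMap.congr_fun hΨd) (LinearMap.congr_fun hΨΦ)
    (fun y => ?_) (fun x => ?_) (barT_barT A)
  · have := barT_sub_skew_mem (gr := A.cohomologyGr) m n hx
    rwa [hm1, hskew, sub_zero] at this
  · have := comap_sub_map_mem e (hat_one (gr := A.cohomologyGr) h.morphism.zero) n hx
    rwa [hfirst] at this
  · rw [skew_homotopy (signMap_signMap A.gr) A.d_signMap (fun x => hfd _)
      (fun x => by rw [LinearMap.comp_apply, hqd, map_zero]) hs]
    exact congrArg (y - ·) (LinearMap.congr_fun hΦΨ y).symm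
  · rw [barT_eq_coder hHD h.algebra.zero]
    exact (LinearMap.congr_fun htw.barT_comap x).symm

end BarQuasiIso

end CInf

end

theorem mainTheorem3 {R : Type u} [CommRing R] [Algebra ℚ R] (A : CInf.CDGAlg.{u, v} R)
    (hA : ∀ i : ℤ, Module.Free R (A.cohomologyGr i)) :
    -- existence
    (∃ (m : CInf.MultiFamily R A.Cohomology A.Cohomology)
        (f : CInf.MultiFamily R A.Cohomology A.carrier), A.IsMinimalModel m f) ∧
    -- the weak equivalences also induce homology isomorphisms of bar constructions
    -- when the coboundaries form a projective module (for instance over a field)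
    (Module.Projective R (LinearMap.range A.d) →
      ∀ (m : CInf.MultiFamily R A.Cohomology A.Cohomology)
        (f : CInf.MultiFamily R A.Cohomology A.carrier), A.IsMinimalModel m f →
        CInf.IsBarQuasiIso A.cohomologyGr A.gr m A.ops f) ∧
    -- maps of commutative dg algebras extend to morphisms
    (∀ A' : CInf.CDGAlg.{u, w} R, (∀ i : ℤ, Module.Free R (A'.cohomologyGr i)) →
      ∀ (g : CInf.CDGAlg.Hom A A')
        (m : CInf.MultiFamily R A.Cohomology A.Cohomology)
        (f : CInf.MultiFamily R A.Cohomology A.carrier)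
        (m' : CInf.MultiFamily R A'.Cohomology A'.Cohomology)
        (f' : CInf.MultiFamily R A'.Cohomology A'.carrier),
        A.IsMinimalModel m f → A'.IsMinimalModel m' f' →
        ∃ G : CInf.MultiFamily R A.Cohomology A'.Cohomology,
          CInf.IsCInfMorphism A.cohomologyGr A'.cohomologyGr m m' G ∧
          CInf.firstComponent G = g.cohomologyMap) ∧
    -- uniqueness
    (∀ (m m' : CInf.MultiFamily R A.Cohomology A.Cohomology)
        (f f' : CInf.MultiFamily R A.Cohomology A.carrier),
        A.IsMinimalModel m f → A.IsMinimalModel m' f' →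
        ∃ G : CInf.MultiFamily R A.Cohomology A.Cohomology,
          CInf.IsCInfIso A.cohomologyGr A.cohomologyGr m m' G ∧
          CInf.firstComponent G = LinearMap.id) := by
  exact ⟨CInf.exists_minimalModel_of_free hA,
    fun hproj m f h => CInf.isBarQuasiIso_of_projective hA hproj h,
    fun A' hA' g m f m' f' h h' => CInf.exists_morphism_of_free hA hA' g h h',
    fun m m' f f' h h' => CInf.exists_isomorphism_of_free hA h h'⟩
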